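/- **Setting.** Let $k_+,k_->0$ with $k_+\neq k_-$, and put $\theta_c=\arccos(k_- /k_+)$ if $k_+>k_-$ and $\theta_c=0$ if $k_+<k_-$. Let $\mathbb R^2_\pm=\{x:\pm x_2>0\}$, $\Gamma=\{x:x_2=0\}$, $\nu=(0,1)$, and let $k=k_\pm$ in $\mathbb R^2_\pm$. A *buried obstacle* is a nonempty bounded open set $D\subset\mathbb R^2$ (possibly with several components) with connected complement and $\overline D\subset\mathbb R^2_-$. Let $d=(\cos\theta_d,\sin\theta_d)$ with $\theta_d\in[\pi+\theta_c,2\pi-\theta_c]$, let $\theta_d^t\in[\pi,2\pi]$ satisfy $k_+\cos\theta_d=k_-\cos\theta_d^t$, and put $d^t=(\cos\theta_d^t,\sin\theta_d^t)$, $d^r=(\cos\theta_d,-\sin\theta_d)$. The reference field of the incident wave $e^{ik_+x\cdot d}$ is $$u^0(x)=e^{ik_+x\cdot d}+R\,e^{ik_+x\cdot d^r}\ (x_2>0),\qquad u^0(x)=T\,e^{ik_-x\cdot d^t}\ (x_2<0),$$ $$R=\frac{k_+\sin\theta_d-k_-\sin\theta_d^t}{k_+\sin\theta_d+k_-\sin\theta_d^t},\qquad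 T=\frac{2k_+\sin\theta_d}{k_+\sin\theta_d+k_-\sin\theta_d^t}.$$ A *scattered wave* of $D$ is a function $u^s$, continuous on $\mathbb R^2\setminus D$, of class $C^2$ on $\mathbb R^2\setminus(\overline D\cup\Gamma)$ and $C^1$ up to $\Gamma$ from either side, with $$\Delta u^s+k^2u^s=0\ \text{in }\mathbb R^2\setminus(\overline D\cup\Gamma),\quad [u^s]=[\partial u^s/\partial\nu]=0\ \text{on }\Gamma,\quad u^s=-u^0\ \text{on }\partial D,$$ $$\lim_{r\to\infty}\int_{|x|=r}\Big|\frac{\partial u^s}{\partial r}-iku^s\Big|^2ds=0.$$ A *far-field pattern* of $u^s$ is a function $u^\infty$ on the upper unit half-circle $\{\hat x:|\hat x|=1,\hat x_2\ge0\}$ such that $$u^s(x)=\frac{e^{ik_+|x|}}{\sqrt{|x|}}\,u^\infty\!\Big(\frac{x}{|x|}\Big)+o\Big(\frac1{\sqrt{|x|}}\Big)\qquad(|x|\to\infty,\ x_2\ge0).$$ **Lemma 2.1.** Let $D$ be a buried obstacle, $z=(z_1,0)$ with $z_1\in\mathbb R$, and $D_z=D+z$. Let $u^s$ be a scattered wave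 of $D$, for the incident wave $e^{ik_+x\cdot d}$, with far-field pattern $u^\infty(\cdot,D)$. Then $D_z$ is a buried obstacle, $D_z\neq D$ if $z_1\neq0$, and $D_z$ has, for the same incident wave, a scattered wave with a far-field pattern. For every far-field pattern $u^\infty(\cdot,D_z)$ of a scattered wave of $D_z$, $$u^\infty(\hat x,D_z)=e^{ik_-z\cdot(d^t-\hat x^t)}\,u^\infty(\hat x,D)$$ for every $\hat x=(\cos\theta_{\hat x},\sin\theta_{\hat x})$ with $\theta_{\hat x}\in[\theta_c,\pi-\theta_c]$, where $\hat x^t=(\cos\theta_{\hat x}^t,\sin\theta_{\hat x}^t)$, $\theta^t_{\hat x}\in[0,\pi]$ and $k_+\cos\theta_{\hat x}=k_-\cos\theta^t_{\hat x}$. In particular $|u^\infty(\hat x,D_z)|=|u^\infty(\hat x,D)|$ for these $\hat x$: the modulus of the far-field pattern of one plane wave does not distinguish $D$ from its horizontal translates. -/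

import Mathlib

open Filter Topology Set

noncomputable section

namespace TwoLayer

/-- The Euclidean plane `ℝ²`. -/
abbrev Plane := EuclideanSpace ℝ (Fin 2)

/-- The upper half-space `x₂ > 0`. -/
def upper : Set Plane := {x | 0 < x 1}

/-- The lower half-space `x₂ < 0`. -/
def lower : Set Plane := {x | x 1 < 0}

/-- The interface `x₂ = 0`. -/
def interface : Set Plane := {x | x 1 = 0}

/-- The unit vector `(cos θ, sin θ)`. -/
def dir (θ : ℝ) : Plane := !₂[Real.cos θ, Real.sin θ]

/-- The unit normal `ν = (0, 1)` of the interface, directed into the upper half-space. -/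
def nu : Plane := !₂[0, 1]

/-- The angle `θ_c`: `arccos (k₋ / k₊)` if `k₊ > k₋`, and `0` if `k₊ < k₋`. -/
def critAngle (kp km : ℝ) : ℝ := if km < kp then Real.arccos (km / kp) else 0

/-- The piecewise constant wave number: `k₊` above the interface and `k₋` below it
(its value on the interface itself is never relevant). -/
def waveNumber (kp km : ℝ) (x : Plane) : ℝ := if 0 < x 1 then kp else km

/-- The Fresnel reflection coefficient. -/
def reflCoeff (kp km θd θdt : ℝ) : ℝ :=
  (kp * Real.sin θd - km * Real.sin θdt) / (kp * Real.sin θd + km * Real.sin θdt)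

/-- The Fresnel transmission coefficient. -/
def transCoeff (kp km θd θdt : ℝ) : ℝ :=
  2 * kp * Real.sin θd / (kp * Real.sin θd + km * Real.sin θdt)

/-- The plane wave `exp (i k x · d)`. -/
def planeWave (k : ℝ) (d x : Plane) : ℂ := Complex.exp (Complex.I * (k * inner ℝ x d : ℝ))

/-- The reference field `u⁰`: incident plus reflected plane wave above the interface, transmitted
plane wave below it. Here `θd` is the angle of incidence, `dir (-θd) = (cos θd, - sin θd)` is the
direction of reflection, and `θdt` is the transmission angle. -/
def refField (kp km θd θdt : ℝ) (x : Plane) : ℂ :=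
  if 0 < x 1 then
    planeWave kp (dir θd) x + (reflCoeff kp km θd θdt : ℂ) * planeWave kp (dir (-θd)) x
  else (transCoeff kp km θd θdt : ℂ) * planeWave km (dir θdt) x

/-- An obstacle buried in the lower half-space: a nonempty bounded open set (it may have several
components) with connected complement, whose closure lies in the lower half-space. -/
structure IsBuriedObstacle (D : Set Plane) : Prop where
  isOpen : IsOpen D
  nonempty : D.Nonempty
  isBounded : Bornology.IsBounded D
  connected_compl : IsConnected Dᶜ
  closure_subset : closure D ⊆ lower

/-- `∫_{|x| = r} |∂u/∂r - i k u|² ds`, in polar coordinates. -/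
def radiationIntegral (kp km : ℝ) (u : Plane → ℂ) (r : ℝ) : ℝ :=
  ∫ θ in (0 : ℝ)..(2 * Real.pi),
    ‖fderiv ℝ u (r • dir θ) (dir θ)
        - Complex.I * (waveNumber kp km (r • dir θ) : ℂ) * u (r • dir θ)‖ ^ 2 * r

/-- `u` is the scattered wave generated by the sound-soft obstacle `D` and the incident plane wave
`exp (i k₊ x · dir θd)`: a classical solution, `C²` off the interface and `C¹` up to the interface
from either side, of the two-layered scattering problem. The values of `u` inside `D` are
irrelevant. -/
structure IsScatteredWave (kp km θd θdt : ℝ) (D : Set Plane) (u : Plane → ℂ) : Prop where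
  /-- `u` is twice continuously differentiable off the interface and the closed obstacle. -/
  contDiffOn : ContDiffOn ℝ 2 u (closure D ∪ interface)ᶜ
  /-- The Helmholtz equation `Δu + k² u = 0`. -/
  helmholtz : ∀ x ∈ (closure D ∪ interface)ᶜ,
    Laplacian.laplacian u x + (waveNumber kp km x : ℂ) ^ 2 * u x = 0
  /-- `u` is continuous on the exterior of `D`, up to the boundary of `D` and across the interface;
  in particular its jump across the interface is zero. -/
  continuousOn : ContinuousOn u Dᶜ
  /-- The gradient of `u` has one-sided limits at the interface, and the jump of the normal
  derivative is zero. -/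
  normal_jump : ∀ y ∈ interface, ∃ Lp Lm : Plane →L[ℝ] ℂ,
    Tendsto (fderiv ℝ u) (𝓝[upper] y) (𝓝 Lp) ∧ Tendsto (fderiv ℝ u) (𝓝[lower] y) (𝓝 Lm) ∧
      Lp nu = Lm nu
  /-- The sound-soft boundary condition `u = -u⁰` on the boundary of the obstacle. -/
  boundary : ∀ x ∈ frontier D, u x = -refField kp km θd θdt x
  /-- The Sommerfeld radiation condition in integral form. -/
  radiation : Tendsto (radiationIntegral kp km u) atTop (𝓝 0)

/-- `F` is the far-field pattern of `u`:
`u(x) = exp (i k₊ |x|) / √|x| * F(x / |x|) + o(1 / √|x|)` as `|x| → ∞` in the closed upper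
half-space. Only the values of `F` on the closed upper unit half-circle matter. -/
def IsFarField (kp : ℝ) (u F : Plane → ℂ) : Prop :=
  (fun x : Plane =>
      u x - Complex.exp (Complex.I * (kp * ‖x‖ : ℝ)) / (Real.sqrt ‖x‖ : ℂ) * F (‖x‖⁻¹ • x))
    =o[Bornology.cobounded Plane ⊓ 𝓟 {x : Plane | 0 ≤ x 1}]
  (fun x : Plane => 1 / Real.sqrt ‖x‖)

/-- The horizontal translation vector `(z₁, 0)`. -/
def horiz (z₁ : ℝ) : Plane := !₂[z₁, 0]

/-- The translated set `D + z`. -/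
def translate (D : Set Plane) (z : Plane) : Set Plane := (fun x => x + z) '' D

end TwoLayer

end

/-!
# Far-field patterns of horizontally translated buried obstacles

Write `z = (z₁, 0)`. Below the interface the reference field is the plane wave `T exp (i k₋ x · dᵗ)`,
and the obstacle lies there, so the function `v x = exp (i k₋ z · dᵗ) u (x - z)` has the right
boundary values on the translated obstacle. As `z` is horizontal, `v` solves the same transmission
problem (`IsTransmission.comp_sub_horiz`). Expanding `|x - z| = |x| - z · x / |x| + o(1)` shows that
`v` has the far-field pattern `exp (i k₋ z · dᵗ) exp (-i k₊ z · x̂) F x̂` (`IsFarField.comp_sub_horiz`),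
which is the asserted formula because `k₊ z · x̂ = k₋ z · x̂ᵗ` by Snell's law. Two points remain.

*The translate satisfies the radiation condition.* The condition refers to circles centred at the
origin, which are not preserved. Integrated over the radius, it says that the radiation defect
`∂w/∂r - i k w` tends to zero in `L²` on annuli of fixed width, a statement that tolerates
translations as soon as `∇w` is bounded in `L²` on such annuli, since the direction `x / |x|` changes
by `O(1 / |x|)`. The bound on `w` comes from Sommerfeld's argument (the energy flux is conserved,
`IsTransmission.flux_eq`, and with the defect it controls the `L²` norm,
`IsTransmission.lintegral_norm_sq_le`), that on `∇w` from the Caccioppoli inequality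
(`IsTransmission.caccioppoli`). To return from annuli to circles, a one-dimensional trace inequality
uses an `L²` bound on the second derivatives. These are bounded by the Caccioppoli inequality for the
tangential derivative `∂₁w`, as a limit of difference quotients
(`IsTransmission.lintegral_hessSq_le`), and by the Helmholtz equation for `∂₂₂w`. The result is
`IsTransmission.radiation_comp_sub_horiz`.

*The far-field pattern is unique.* The difference `w` of two scattered waves vanishes on the boundary
of the obstacle and radiates. No regularity of the obstacle, nor of `∇w` near it, is available, so
the energy identity is tested with `conj w` times a truncation of `|w|²` near zero. The real part
bounds the Dirichlet integral, and then the imaginary part shows that the flux of `w` is zero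
(`IsTransmission.flux_eq_zero`). By Sommerfeld's argument `w` tends to zero in `L²` on annuli
(`IsScatteredWave.annVanish_sub`), which determines the far-field pattern (`farField_eq`). Equality
of the two waves is not needed, so neither is Rellich's lemma.
-/

noncomputable section

namespace TwoLayer

open MeasureTheory ComplexConjugate

/-! ### The divergence theorem across the interface -/

lemma volume_snd_eq_zero : volume {p : ℝ × ℝ | p.2 = 0} = 0 := by
  have : {p : ℝ × ℝ | p.2 = 0} = Set.univ ×ˢ {0} := by ext p; simp
  rw [this, Measure.volume_eq_prod, Measure.prod_prod]
  simp

lemma ae_snd_ne_zero : ∀ᵐ p : ℝ × ℝ, p.2 ≠ 0 := by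
  rw [ae_iff]; simpa using volume_snd_eq_zero

/-- The divergence theorem on the plane for a compactly supported field `(P, Q)` which may be
discontinuous on the axis `y = 0`, provided that its normal component `Q` does not jump there. -/
lemma integral_div_eq_zero {P Q : ℝ × ℝ → ℂ} (hPs : HasCompactSupport P)
    (hQs : HasCompactSupport Q) (hP : ∀ p : ℝ × ℝ, p.2 ≠ 0 → DifferentiableAt ℝ P p)
    (hQ : ∀ p : ℝ × ℝ, p.2 ≠ 0 → DifferentiableAt ℝ Q p)
    (hi : Integrable (fun p => fderiv ℝ P p (1, 0) + fderiv ℝ Q p (0, 1)))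
    {C : ℝ} (hC : ∀ p : ℝ × ℝ, p.2 ≠ 0 → ‖Q p‖ ≤ C)
    (hj : ∀ x, Tendsto (fun δ => Q (x, δ) - Q (x, -δ)) (𝓝[>] 0) (𝓝 0)) :
    ∫ p, (fderiv ℝ P p (1, 0) + fderiv ℝ Q p (0, 1)) = 0 := by
  obtain ⟨M, hM0, hM⟩ : ∃ M : ℝ, 0 < M ∧ ∀ p : ℝ × ℝ, M ≤ ‖p‖ →
      p ∉ tsupport P ∧ p ∉ tsupport Q := by
    obtain ⟨M, hM⟩ := (hPs.isBounded.union hQs.isBounded).subset_ball (0 : ℝ × ℝ)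
    refine ⟨max M 1, by positivity, fun p hp => ?_⟩
    constructor <;> intro h
    · have := hM (Or.inl h)
      rw [mem_ball_zero_iff] at this
      exact absurd hp (not_le.2 (this.trans_le (le_max_left _ _)))
    · have := hM (Or.inr h)
      rw [mem_ball_zero_iff] at this
      exact absurd hp (not_le.2 (this.trans_le (le_max_left _ _)))
  have hP0 : ∀ p : ℝ × ℝ, M ≤ ‖p‖ → P p = 0 := fun p hp =>
    image_eq_zero_of_notMem_tsupport (hM p hp).1
  have hQ0 : ∀ p : ℝ × ℝ, M ≤ ‖p‖ → Q p = 0 := fun p hp =>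
    image_eq_zero_of_notMem_tsupport (hM p hp).2
  set dv : ℝ × ℝ → ℂ := fun p => fderiv ℝ P p (1, 0) + fderiv ℝ Q p (0, 1) with hdv
  have hd0 : ∀ p : ℝ × ℝ, M ≤ ‖p‖ → dv p = 0 := by
    intro p hp
    simp [hdv, fderiv_of_notMem_tsupport ℝ (hM p hp).1, fderiv_of_notMem_tsupport ℝ (hM p hp).2]
  have hn1 : ∀ x y : ℝ, |x| = M → M ≤ ‖((x, y) : ℝ × ℝ)‖ := fun x y h => by
    rw [Prod.norm_def]; exact le_max_of_le_left (by simp [h])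
  have hn2 : ∀ x y : ℝ, |y| = M → M ≤ ‖((x, y) : ℝ × ℝ)‖ := fun x y h => by
    rw [Prod.norm_def]; exact le_max_of_le_right (by simp [h])
  -- the divergence theorem on a box that does not meet the axis
  have box : ∀ a b : ℝ, a ≤ b → (∀ y ∈ Icc a b, y ≠ 0) →
      ∫ p in Icc ((-M, a) : ℝ × ℝ) (M, b), dv p =
        (∫ x in (-M)..M, Q (x, b)) - ∫ x in (-M)..M, Q (x, a) := by
    intro a b hab h0
    have := integral_divergence_prod_Icc_of_hasFDerivAt_of_le P Q (fderiv ℝ P) (fderiv ℝ Q)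
      (-M, a) (M, b) (Prod.mk_le_mk.2 ⟨by linarith, hab⟩)
      (fun p hp => (hP p (h0 _ ⟨hp.1.2, hp.2.2⟩)).continuousAt.continuousWithinAt)
      (fun p hp => (hQ p (h0 _ ⟨hp.1.2, hp.2.2⟩)).continuousAt.continuousWithinAt)
      (fun p hp => (hP p (h0 _ ⟨hp.2.1.le, hp.2.2.le⟩)).hasFDerivAt)
      (fun p hp => (hQ p (h0 _ ⟨hp.2.1.le, hp.2.2.le⟩)).hasFDerivAt) hi.integrableOn
    rw [this]
    simp only
    rw [intervalIntegral.integral_congr (g := fun _ => (0 : ℂ))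
      (fun y _ => hP0 (M, y) (hn1 _ _ (abs_of_pos hM0))),
      intervalIntegral.integral_congr (f := fun y => P (-M, y)) (g := fun _ => (0 : ℂ))
      (fun y _ => hP0 (-M, y) (hn1 _ _ (by rw [abs_neg, abs_of_pos hM0])))]
    simp
  have hQi : ∀ y : ℝ, y ≠ 0 → IntervalIntegrable (fun x => Q (x, y)) volume (-M) M := by
    intro y hy
    apply Continuous.intervalIntegrable
    rw [continuous_iff_continuousAt]
    intro x
    exact ContinuousAt.comp (f := fun x => (x, y)) (hQ (x, y) hy).continuousAt
      (by fun_prop)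
  have key : ∀ δ ∈ Ioo 0 M, (∫ p, ((Icc ((-M, δ) : ℝ × ℝ) (M, M)).indicator dv p +
      (Icc ((-M, -M) : ℝ × ℝ) (M, -δ)).indicator dv p)) =
      -∫ x in (-M)..M, (Q (x, δ) - Q (x, -δ)) := by
    intro δ hδ
    rw [integral_add (hi.indicator measurableSet_Icc) (hi.indicator measurableSet_Icc),
      integral_indicator measurableSet_Icc, integral_indicator measurableSet_Icc,
      box δ M hδ.2.le (fun y hy => (hδ.1.trans_le hy.1).ne'),
      box (-M) (-δ) (by linarith [hδ.2]) (fun y hy => (hy.2.trans_lt (by linarith [hδ.1])).ne),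
      intervalIntegral.integral_sub (hQi δ hδ.1.ne') (hQi (-δ) (by linarith [hδ.1]))]
    rw [intervalIntegral.integral_congr (g := fun _ => (0 : ℂ))
      (fun x _ => hQ0 (x, M) (hn2 _ _ (abs_of_pos hM0))),
      intervalIntegral.integral_congr (f := fun x => Q (x, -M)) (g := fun _ => (0 : ℂ))
      (fun x _ => hQ0 (x, -M) (hn2 _ _ (by rw [abs_neg, abs_of_pos hM0])))]
    simp
    ring
  have hev : ∀ᶠ δ in 𝓝[>] (0 : ℝ), δ ∈ Ioo 0 M := Ioo_mem_nhdsGT hM0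
  have lim1 : Tendsto (fun δ => ∫ p, ((Icc ((-M, δ) : ℝ × ℝ) (M, M)).indicator dv p +
      (Icc ((-M, -M) : ℝ × ℝ) (M, -δ)).indicator dv p)) (𝓝[>] 0) (𝓝 (∫ p, dv p)) := by
    refine tendsto_integral_filter_of_dominated_convergence (fun p => ‖dv p‖ + ‖dv p‖)
      (Eventually.of_forall fun δ => ((hi.indicator measurableSet_Icc).add
        (hi.indicator measurableSet_Icc)).aestronglyMeasurable)
      (Eventually.of_forall fun δ => Eventually.of_forall fun p =>
        (norm_add_le _ _).trans (add_le_add (norm_indicator_le_norm_self _ _)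
          (norm_indicator_le_norm_self _ _))) (hi.norm.add hi.norm) ?_
    filter_upwards [ae_snd_ne_zero] with p hp
    apply tendsto_const_nhds.congr'
    by_cases hpM : M ≤ ‖p‖
    · refine Eventually.of_forall fun δ => ?_
      simp [Set.indicator_apply, hd0 p hpM]
    · have h1 : |p.1| < M := lt_of_le_of_lt (norm_fst_le p) (not_le.1 hpM)
      have h2 : |p.2| < M := lt_of_le_of_lt (norm_snd_le p) (not_le.1 hpM)
      rw [abs_lt] at h1 h2
      rcases lt_or_gt_of_ne hp with h | h
      · filter_upwards [Ioo_mem_nhdsGT (show 0 < -p.2 by linarith)] with δ hδ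
        rw [indicator_of_notMem, indicator_of_mem, zero_add]
        · exact ⟨⟨h1.1.le, h2.1.le⟩, h1.2.le, by simp; linarith [hδ.2]⟩
        · intro hh
          have : δ ≤ p.2 := hh.1.2
          linarith [hδ.1]
      · filter_upwards [Ioo_mem_nhdsGT h] with δ hδ
        rw [indicator_of_mem, indicator_of_notMem, add_zero]
        · intro hh
          have : p.2 ≤ -δ := hh.2.2
          linarith [hδ.1]
        · exact ⟨⟨h1.1.le, hδ.2.le⟩, h1.2.le, h2.2.le⟩
  have lim2 : Tendsto (fun δ => ∫ x in (-M)..M, (Q (x, δ) - Q (x, -δ))) (𝓝[>] 0) (𝓝 0) := by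
    have := intervalIntegral.tendsto_integral_filter_of_dominated_convergence
      (F := fun δ x => Q (x, δ) - Q (x, -δ)) (f := fun _ => (0 : ℂ)) (μ := volume)
      (a := -M) (b := M) (l := 𝓝[>] (0 : ℝ)) (fun _ => C + C) ?_ ?_ (by simp) ?_
    · simpa using this
    · filter_upwards [hev] with δ hδ
      exact ((hQi δ hδ.1.ne').sub (hQi (-δ) (by linarith [hδ.1]))).def'.aestronglyMeasurable
    · filter_upwards [hev] with δ hδ
      refine Eventually.of_forall fun x _ => (norm_sub_le _ _).trans (add_le_add
        (hC _ hδ.1.ne') (hC _ ?_))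
      simp only; linarith [hδ.1]
    · exact Eventually.of_forall fun x _ => hj x
  have h3 := lim1.congr' (hev.mono key)
  have h4 := lim2.neg
  rw [neg_zero] at h4
  exact tendsto_nhds_unique h3 h4

/-- The horizontal unit vector. -/
def e1 : Plane := !₂[1, 0]

/-- The identification of `ℝ × ℝ` with the Euclidean plane. -/
def pt : (ℝ × ℝ) ≃L[ℝ] Plane :=
  (ContinuousLinearEquiv.finTwoArrow ℝ ℝ).symm.trans (EuclideanSpace.equiv (Fin 2) ℝ).symm

@[simp] lemma pt_zero (p : ℝ × ℝ) : pt p 0 = p.1 := rfl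

@[simp] lemma pt_one (p : ℝ × ℝ) : pt p 1 = p.2 := rfl

@[simp] lemma pt_fst : pt (1, 0) = e1 := rfl

@[simp] lemma pt_snd : pt (0, 1) = nu := rfl

lemma plane_eq (x : Plane) : x = x 0 • e1 + x 1 • nu := by
  ext i; fin_cases i <;> simp [e1, nu]

lemma ae_notMem_interface : ∀ᵐ p : ℝ × ℝ, pt p ∉ interface := by
  filter_upwards [ae_snd_ne_zero] with p hp
  simpa [interface] using hp

lemma isClosed_interface : IsClosed interface :=
  isClosed_eq (by fun_prop) continuous_const

/-! ### The transmission problem -/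

/-- `w` solves the homogeneous transmission problem outside the closed set `K`: the Helmholtz
equation away from the interface, with no jump of `w` and of its normal derivative across it. The
Laplacian is written as the trace of the second derivative. Measurability is imposed on the whole
plane, so that the values in `K` do not disturb integrals. -/
structure IsTransmission (kp km : ℝ) (K : Set Plane) (w : Plane → ℂ) : Prop where
  measurable : Measurable w
  contDiffOn : ContDiffOn ℝ 2 w (K ∪ interface)ᶜ
  helmholtz : ∀ x ∈ (K ∪ interface)ᶜ, fderiv ℝ (fderiv ℝ w) x e1 e1 +
    fderiv ℝ (fderiv ℝ w) x nu nu + (waveNumber kp km x : ℂ) ^ 2 * w x = 0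
  continuousOn : ContinuousOn w Kᶜ
  normal_jump : ∀ y ∈ interface, y ∉ K → ∃ Lp Lm : Plane →L[ℝ] ℂ,
    Tendsto (fderiv ℝ w) (𝓝[upper] y) (𝓝 Lp) ∧ Tendsto (fderiv ℝ w) (𝓝[lower] y) (𝓝 Lm) ∧
      Lp nu = Lm nu

/-- Integrability of functions that are bounded off the interface and vanish off a compact set. -/
lemma integrable_comp_pt {E : Type*} [NormedAddCommGroup E] {f : Plane → E}
    (hf : StronglyMeasurable f) {S : Set Plane} (hS : IsCompact S) (h0 : ∀ x ∉ S, f x = 0) {C : ℝ}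
    (hC : ∀ x ∈ S, x ∉ interface → ‖f x‖ ≤ C) : Integrable (fun p : ℝ × ℝ => f (pt p)) := by
  have hSc : IsCompact (pt ⁻¹' S) := pt.toHomeomorph.isCompact_preimage.2 hS
  have h1 : IntegrableOn (fun p : ℝ × ℝ => f (pt p)) (pt ⁻¹' S) := by
    refine Measure.integrableOn_of_bounded (M := C) hSc.measure_lt_top.ne
      (hf.comp_measurable pt.continuous.measurable).aestronglyMeasurable ?_
    rw [ae_restrict_iff' hSc.measurableSet]
    filter_upwards [ae_notMem_interface] with p hp hpS using hC _ hpS hp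
  refine (integrableOn_iff_integrable_of_support_subset fun p hp => ?_).1 h1
  by_contra h
  exact hp (h0 _ h)

namespace IsTransmission

variable {kp km : ℝ} {K : Set Plane} {w : Plane → ℂ}

lemma isOpen_compl (hK : IsClosed K) : IsOpen (K ∪ interface)ᶜ :=
  (hK.union isClosed_interface).isOpen_compl

lemma contDiffAt (hw : IsTransmission kp km K w) (hK : IsClosed K) {x : Plane} (hx : x ∉ K)
    (hx' : x ∉ interface) : ContDiffAt ℝ 2 w x :=
  hw.contDiffOn.contDiffAt ((isOpen_compl hK).mem_nhds (by simp [hx, hx']))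

lemma differentiableAt (hw : IsTransmission kp km K w) (hK : IsClosed K) {x : Plane} (hx : x ∉ K)
    (hx' : x ∉ interface) : DifferentiableAt ℝ w x :=
  (hw.contDiffAt hK hx hx').differentiableAt (by norm_num)

lemma contDiffAt_fderiv (hw : IsTransmission kp km K w) (hK : IsClosed K) {x : Plane}
    (hx : x ∉ K) (hx' : x ∉ interface) : ContDiffAt ℝ 1 (fderiv ℝ w) x :=
  (hw.contDiffAt hK hx hx').fderiv_right (by norm_num)

lemma differentiableAt_fderiv (hw : IsTransmission kp km K w) (hK : IsClosed K) {x : Plane}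
    (hx : x ∉ K) (hx' : x ∉ interface) : DifferentiableAt ℝ (fderiv ℝ w) x :=
  (hw.contDiffAt_fderiv hK hx hx').differentiableAt (by norm_num)

/-- Horizontal translates of a solution are solutions. -/
lemma comp_sub_horiz (hw : IsTransmission kp km K w) {K' : Set Plane} {h : ℝ}
    (hK : ∀ x ∉ K', x - horiz h ∉ K) : IsTransmission kp km K' fun x => w (x - horiz h) := by
  have h1 : ∀ x : Plane, (x - horiz h) 1 = x 1 := fun x => by simp [horiz]
  have hfd : fderiv ℝ (fun x => w (x - horiz h)) = fun x => fderiv ℝ w (x - horiz h) := by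
    ext1 x; exact fderiv_comp_sub (horiz h)
  have hmap : ∀ x ∈ (K' ∪ interface)ᶜ, x - horiz h ∈ (K ∪ interface)ᶜ := by
    intro x hx
    simp only [mem_compl_iff, mem_union, not_or] at hx ⊢
    exact ⟨hK x hx.1, by simpa [interface, h1] using hx.2⟩
  refine ⟨hw.measurable.comp (measurable_id.sub_const _), ?_, fun x hx => ?_, ?_, ?_⟩
  · exact hw.contDiffOn.comp (by fun_prop) hmap
  · have := hw.helmholtz _ (hmap x hx)
    rw [hfd]
    rw [fderiv_comp_sub (f := fderiv ℝ w) (horiz h)]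
    simpa [waveNumber, h1] using this
  · exact hw.continuousOn.comp (by fun_prop) hK
  · intro y hy hyK
    obtain ⟨Lp, Lm, h2, h3, h4⟩ := hw.normal_jump (y - horiz h) (by simpa [interface, h1] using hy)
      (hK y hyK)
    refine ⟨Lp, Lm, ?_, ?_, h4⟩ <;> rw [hfd]
    · refine h2.comp (tendsto_nhdsWithin_iff.2 ⟨?_, ?_⟩)
      · exact (Continuous.tendsto (by fun_prop) y).mono_left nhdsWithin_le_nhds
      · filter_upwards [self_mem_nhdsWithin] with x hx
        simpa [upper, h1] using hx
    · refine h3.comp (tendsto_nhdsWithin_iff.2 ⟨?_, ?_⟩)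
      · exact (Continuous.tendsto (by fun_prop) y).mono_left nhdsWithin_le_nhds
      · filter_upwards [self_mem_nhdsWithin] with x hx
        simpa [lower, h1] using hx

lemma mono (hw : IsTransmission kp km K w) {K' : Set Plane} (h : K ⊆ K') :
    IsTransmission kp km K' w := by
  have := hw.comp_sub_horiz (K' := K') (h := 0) (fun x hx => by
    have : horiz 0 = 0 := by ext i; fin_cases i <;> simp [horiz]
    rw [this, sub_zero]; exact fun hk => hx (h hk))
  have h0 : horiz 0 = 0 := by ext i; fin_cases i <;> simp [horiz]
  simpa [h0] using this

lemma sub (hw : IsTransmission kp km K w) {v : Plane → ℂ} (hv : IsTransmission kp km K v)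
    (hK : IsClosed K) : IsTransmission kp km K fun x => w x - v x := by
  have hfd : ∀ x ∈ (K ∪ interface)ᶜ, fderiv ℝ (fun x => w x - v x) x =
      fderiv ℝ w x - fderiv ℝ v x :=
    fun x hx => by
      simp only [mem_compl_iff, mem_union, not_or] at hx
      exact fderiv_fun_sub (hw.differentiableAt hK hx.1 hx.2) (hv.differentiableAt hK hx.1 hx.2)
  refine ⟨hw.measurable.sub hv.measurable, hw.contDiffOn.sub hv.contDiffOn, fun x hx => ?_,
    hw.continuousOn.sub hv.continuousOn, fun y hy hyK => ?_⟩
  · have h1 : fderiv ℝ (fun x => w x - v x) =ᶠ[𝓝 x] fun x => fderiv ℝ w x - fderiv ℝ v x := by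
      filter_upwards [(isOpen_compl hK).mem_nhds hx] with z hz using hfd z hz
    have hx' := hx
    simp only [mem_compl_iff, mem_union, not_or] at hx'
    rw [h1.fderiv_eq, fderiv_fun_sub (hw.differentiableAt_fderiv hK hx'.1 hx'.2)
      (hv.differentiableAt_fderiv hK hx'.1 hx'.2)]
    have e1 := hw.helmholtz x hx
    have e2 := hv.helmholtz x hx
    simp only [_root_.sub_apply]
    linear_combination e1 - e2
  · obtain ⟨Lp, Lm, h1, h2, h3⟩ := hw.normal_jump y hy hyK
    obtain ⟨Mp, Mm, h4, h5, h6⟩ := hv.normal_jump y hy hyK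
    have hK' := hK.isOpen_compl.mem_nhds hyK
    refine ⟨Lp - Mp, Lm - Mm, (h1.sub h4).congr' ?_, (h2.sub h5).congr' ?_, by simp [h3, h6]⟩
    · filter_upwards [nhdsWithin_le_nhds hK', self_mem_nhdsWithin] with z hz hz'
      refine (hfd z ?_).symm
      simp only [mem_compl_iff, mem_union, not_or]
      exact ⟨hz, fun h => (show 0 < z 1 from hz').ne' h⟩
    · filter_upwards [nhdsWithin_le_nhds hK', self_mem_nhdsWithin] with z hz hz'
      refine (hfd z ?_).symm
      simp only [mem_compl_iff, mem_union, not_or]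
      exact ⟨hz, fun h => (show z 1 < 0 from hz').ne h⟩

lemma const_mul (hw : IsTransmission kp km K w) (c : ℂ) :
    IsTransmission kp km K fun x => c * w x := by
  have hfd : fderiv ℝ (fun x => c * w x) = fun x => c • fderiv ℝ w x := by
    ext1 x; exact congrFun (fderiv_const_smul_field (𝕜 := ℝ) (f := w) c) x
  refine ⟨hw.measurable.const_mul c, contDiffOn_const.mul hw.contDiffOn, fun x hx => ?_,
    hw.continuousOn.const_smul c, fun y hy hyK => ?_⟩
  · rw [hfd]
    have : fderiv ℝ (fun x => c • fderiv ℝ w x) x = c • fderiv ℝ (fderiv ℝ w) x :=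
      congrFun (fderiv_const_smul_field (𝕜 := ℝ) (f := fderiv ℝ w) c) x
    rw [this]
    have e1 := hw.helmholtz x hx
    simp only [_root_.smul_apply, smul_eq_mul]
    linear_combination c * e1
  · obtain ⟨Lp, Lm, h1, h2, h3⟩ := hw.normal_jump y hy hyK
    rw [hfd]
    exact ⟨c • Lp, c • Lm, h1.const_smul c, h2.const_smul c, by simp [h3]⟩

/-- The gradient is bounded near the interface, hence on compact sets. -/
lemma exists_bound (hw : IsTransmission kp km K w) (hK : IsClosed K) {S : Set Plane}
    (hS : IsCompact S) (hSK : S ⊆ Kᶜ) :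
    ∃ C : ℝ, 0 ≤ C ∧ (∀ x ∈ S, ‖w x‖ ≤ C) ∧ ∀ x ∈ S, x ∉ interface → ‖fderiv ℝ w x‖ ≤ C := by
  obtain ⟨C₁, hC₁⟩ := hS.exists_bound_of_continuousOn (hw.continuousOn.mono hSK)
  have : ∃ C : ℝ, ∀ x ∈ S, x ∉ interface → ‖fderiv ℝ w x‖ ≤ C := by
    refine hS.induction_on (p := fun s => ∃ C : ℝ, ∀ x ∈ s, x ∉ interface → ‖fderiv ℝ w x‖ ≤ C)
      ⟨0, by simp⟩ (fun s t hst ⟨C, hC⟩ => ⟨C, fun x hx => hC x (hst hx)⟩) ?_ ?_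
    · rintro s t ⟨C, hC⟩ ⟨C', hC'⟩
      refine ⟨max C C', fun x hx hxi => ?_⟩
      rcases hx with hx | hx
      · exact (hC x hx hxi).trans (le_max_left _ _)
      · exact (hC' x hx hxi).trans (le_max_right _ _)
    · intro x hx
      by_cases hxi : x ∈ interface
      · obtain ⟨Lp, Lm, h1, h2, -⟩ := hw.normal_jump x hxi (hSK hx)
        have e1 := h1.norm.eventually_lt_const (lt_add_one _)
        have e2 := h2.norm.eventually_lt_const (lt_add_one _)
        rw [eventually_nhdsWithin_iff] at e1 e2
        refine ⟨_, nhdsWithin_le_nhds (e1.and e2), max (‖Lp‖ + 1) (‖Lm‖ + 1), fun y hy hyi => ?_⟩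
        rcases lt_or_gt_of_ne (show y 1 ≠ 0 from hyi) with h | h
        · exact (hy.2 h).le.trans (le_max_right _ _)
        · exact (hy.1 h).le.trans (le_max_left _ _)
      · have e1 := (hw.differentiableAt_fderiv hK (hSK hx) hxi).continuousAt.norm.eventually_lt_const
          (lt_add_one _)
        exact ⟨_, nhdsWithin_le_nhds e1, _, fun y hy _ => le_of_lt hy⟩
  obtain ⟨C₂, hC₂⟩ := this
  exact ⟨max (max C₁ C₂) 0, le_max_right _ _,
    fun x hx => (hC₁ x hx).trans ((le_max_left _ _).trans (le_max_left _ _)),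
    fun x hx hxi => (hC₂ x hx hxi).trans ((le_max_right _ _).trans (le_max_left _ _))⟩

end IsTransmission

/-! ### The energy identity -/

/-- The squared length of the gradient. -/
def gradSq (w : Plane → ℂ) (x : Plane) : ℝ := ‖fderiv ℝ w x e1‖ ^ 2 + ‖fderiv ℝ w x nu‖ ^ 2

/-- The bilinear product `∇w · ∇a`. -/
def gradDot (w : Plane → ℂ) (a : Plane → ℝ) (x : Plane) : ℂ :=
  fderiv ℝ w x e1 * fderiv ℝ a x e1 + fderiv ℝ w x nu * fderiv ℝ a x nu

/-- The density obtained by testing the transmission problem with `a * conj w`. -/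
def energyDensity (kp km : ℝ) (w : Plane → ℂ) (a : Plane → ℝ) (x : Plane) : ℂ :=
  a x * gradSq w x + conj (w x) * gradDot w a x - (waveNumber kp km x : ℂ) ^ 2 * a x * ‖w x‖ ^ 2

lemma gradSq_nonneg (w : Plane → ℂ) (x : Plane) : 0 ≤ gradSq w x := by unfold gradSq; positivity

lemma norm_e1 : ‖e1‖ = 1 := by simp [e1, EuclideanSpace.norm_eq, Fin.sum_univ_two]
lemma norm_nu : ‖nu‖ = 1 := by simp [nu, EuclideanSpace.norm_eq, Fin.sum_univ_two]

lemma norm_apply_e1_le {E : Type*} [NormedAddCommGroup E] [NormedSpace ℝ E] (L : Plane →L[ℝ] E) :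
    ‖L e1‖ ≤ ‖L‖ := by
  simpa [norm_e1] using L.le_opNorm e1

lemma norm_apply_nu_le {E : Type*} [NormedAddCommGroup E] [NormedSpace ℝ E] (L : Plane →L[ℝ] E) :
    ‖L nu‖ ≤ ‖L‖ := by
  simpa [norm_nu] using L.le_opNorm nu

lemma gradSq_le (w : Plane → ℂ) (x : Plane) : gradSq w x ≤ 2 * ‖fderiv ℝ w x‖ ^ 2 := by
  have h1 := pow_le_pow_left₀ (norm_nonneg _) (norm_apply_e1_le (fderiv ℝ w x)) 2
  have h2 := pow_le_pow_left₀ (norm_nonneg _) (norm_apply_nu_le (fderiv ℝ w x)) 2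
  unfold gradSq; linarith

lemma norm_gradDot_le (w : Plane → ℂ) (a : Plane → ℝ) (x : Plane) :
    ‖gradDot w a x‖ ≤ 2 * (‖fderiv ℝ w x‖ * ‖fderiv ℝ a x‖) := by
  unfold gradDot
  refine (norm_add_le _ _).trans ?_
  rw [norm_mul, norm_mul, Complex.norm_real, Complex.norm_real]
  have h1 := mul_le_mul (norm_apply_e1_le (fderiv ℝ w x)) (norm_apply_e1_le (fderiv ℝ a x))
    (norm_nonneg _) (norm_nonneg _)
  have h2 := mul_le_mul (norm_apply_nu_le (fderiv ℝ w x)) (norm_apply_nu_le (fderiv ℝ a x))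
    (norm_nonneg _) (norm_nonneg _)
  linarith

lemma measurable_waveNumber (kp km : ℝ) : Measurable (waveNumber kp km) := by
  unfold waveNumber
  refine Measurable.ite ?_ measurable_const measurable_const
  exact measurableSet_lt measurable_const (by fun_prop)

lemma measurable_gradSq (w : Plane → ℂ) : Measurable (gradSq w) := by
  have := fun v => measurable_fderiv_apply_const ℝ w v
  unfold gradSq; fun_prop (disch := assumption)

lemma measurable_gradDot (w : Plane → ℂ) (a : Plane → ℝ) : Measurable (gradDot w a) := by
  have h1 := fun v => measurable_fderiv_apply_const ℝ w v
  have h2 := fun v => Complex.measurable_ofReal.comp (measurable_fderiv_apply_const ℝ a v)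
  exact ((h1 e1).mul (h2 e1)).add ((h1 nu).mul (h2 nu))

lemma abs_waveNumber_le (kp km : ℝ) (x : Plane) : |waveNumber kp km x| ≤ |kp| + |km| := by
  unfold waveNumber
  split_ifs
  · linarith [abs_nonneg km]
  · linarith [abs_nonneg kp]

lemma measurable_energyDensity (kp km : ℝ) {w : Plane → ℂ} (hw : Measurable w) {a : Plane → ℝ}
    (ha : Measurable a) : Measurable (energyDensity kp km w a) := by
  have h1 := Complex.measurable_ofReal.comp (measurable_gradSq w)
  have h2 := measurable_gradDot w a
  have h3 := Complex.measurable_ofReal.comp (measurable_waveNumber kp km)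
  have h4 := Complex.measurable_ofReal.comp ha
  have h5 := Complex.measurable_ofReal.comp hw.norm
  have h6 : Measurable fun x => conj (w x) := Complex.continuous_conj.measurable.comp hw
  exact ((h4.mul h1).add (h6.mul h2)).sub (((h3.pow_const 2).mul h4).mul (h5.pow_const 2))

namespace IsTransmission

variable {kp km : ℝ} {K : Set Plane} {w : Plane → ℂ} {a : Plane → ℝ}

lemma integrable_energyDensity (hw : IsTransmission kp km K w) (hK : IsClosed K)
    (ha : Continuous a) (has : HasCompactSupport a) (hsub : tsupport a ⊆ Kᶜ) {C : ℝ}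
    (hC : ∀ x ∉ interface, ‖fderiv ℝ a x‖ ≤ C) :
    Integrable fun p : ℝ × ℝ => energyDensity kp km w a (pt p) := by
  obtain ⟨B, hB0, hB1, hB2⟩ := hw.exists_bound hK has.isCompact hsub
  obtain ⟨A, hA⟩ := has.isCompact.exists_bound_of_continuousOn ha.continuousOn
  refine integrable_comp_pt (measurable_energyDensity kp km hw.measurable
    ha.measurable).stronglyMeasurable has.isCompact (C := A * (2 * B ^ 2) + B * (2 * (B * C)) +
      (|kp| + |km|) ^ 2 * A * B ^ 2) (fun x hx => ?_) fun x hx hxi => ?_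
  · simp [energyDensity, gradDot, image_eq_zero_of_notMem_tsupport hx,
      fderiv_of_notMem_tsupport ℝ hx]
  · have h1 := hB1 x hx
    have h2 := hB2 x hx hxi
    have h3 := hA x hx
    have hA0 : 0 ≤ A := (norm_nonneg _).trans h3
    unfold energyDensity
    refine (norm_sub_le _ _).trans (add_le_add ((norm_add_le _ _).trans (add_le_add ?_ ?_)) ?_)
    · rw [norm_mul, Complex.norm_real, Complex.norm_real, Real.norm_of_nonneg (gradSq_nonneg w x)]
      exact mul_le_mul h3 ((gradSq_le w x).trans (by gcongr)) (gradSq_nonneg w x) hA0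
    · rw [norm_mul, RCLike.norm_conj]
      have := norm_gradDot_le w a x
      have h4 := hC x hxi
      gcongr
      exact this.trans (by gcongr)
    · rw [norm_mul, norm_mul, norm_pow, norm_pow, Complex.norm_real, Complex.norm_real,
        Complex.norm_real, norm_norm]
      have := abs_waveNumber_le kp km x
      gcongr
      exact this

lemma fderiv_flux_apply (hw : IsTransmission kp km K w) (hK : IsClosed K) {x : Plane} (hx : x ∉ K)
    (hxi : x ∉ interface) (had : DifferentiableAt ℝ a x) (v : Plane) :
    DifferentiableAt ℝ (fun y => (a y : ℂ) * conj (w y) * fderiv ℝ w y v) x ∧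
    fderiv ℝ (fun y => (a y : ℂ) * conj (w y) * fderiv ℝ w y v) x v =
      a x * ‖fderiv ℝ w x v‖ ^ 2 + conj (w x) * (fderiv ℝ w x v * fderiv ℝ a x v) +
        a x * conj (w x) * fderiv ℝ (fderiv ℝ w) x v v := by
  have h1 : HasFDerivAt (fun y => (a y : ℂ)) (Complex.ofRealCLM.comp (fderiv ℝ a x)) x :=
    Complex.ofRealCLM.hasFDerivAt.comp x had.hasFDerivAt
  have h2 : HasFDerivAt (fun y => conj (w y))
      (Complex.conjCLE.toContinuousLinearMap.comp (fderiv ℝ w x)) x :=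
    Complex.conjCLE.toContinuousLinearMap.hasFDerivAt.comp x
      (hw.differentiableAt hK hx hxi).hasFDerivAt
  have h3 : HasFDerivAt (fun y => fderiv ℝ w y v)
      ((ContinuousLinearMap.apply ℝ ℂ v).comp (fderiv ℝ (fderiv ℝ w) x)) x :=
    (ContinuousLinearMap.apply ℝ ℂ v).hasFDerivAt.comp x
      (hw.differentiableAt_fderiv hK hx hxi).hasFDerivAt
  have h4 : HasFDerivAt (fun y => (a y : ℂ) * conj (w y) * fderiv ℝ w y v) _ x :=
    (h1.mul h2).mul h3
  refine ⟨h4.differentiableAt, ?_⟩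
  have h5 : fderiv ℝ w x v * conj (fderiv ℝ w x v) = (‖fderiv ℝ w x v‖ : ℂ) ^ 2 :=
    Complex.mul_conj' _
  rw [h4.fderiv, ← h5]
  simp
  ring

/-- The energy identity: testing with `a * conj w`, where the weight `a` is supported in a compact
subset of the exterior of `K`. -/
theorem integral_energyDensity (hw : IsTransmission kp km K w) (hK : IsClosed K)
    (ha : Continuous a) (has : HasCompactSupport a) (hsub : tsupport a ⊆ Kᶜ)
    (had : ∀ x ∉ interface, DifferentiableAt ℝ a x) {C : ℝ}
    (hC : ∀ x ∉ interface, ‖fderiv ℝ a x‖ ≤ C) :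
    ∫ p : ℝ × ℝ, energyDensity kp km w a (pt p) = 0 := by
  obtain ⟨B, hB0, hB1, hB2⟩ := hw.exists_bound hK has.isCompact hsub
  obtain ⟨A, hA⟩ := has.isCompact.exists_bound_of_continuousOn ha.continuousOn
  set P : Plane → Plane → ℂ := fun v y => (a y : ℂ) * conj (w y) * fderiv ℝ w y v with hP
  have hPs : ∀ v, HasCompactSupport (P v) := fun v => by
    refine has.mono fun y hy => ?_
    contrapose! hy
    simp only [Function.mem_support, not_not] at hy
    simp [hP, hy]
  have hPc : ∀ v, HasCompactSupport fun p : ℝ × ℝ => P v (pt p) := fun v =>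
    (hPs v).comp_homeomorph pt.toHomeomorph
  have hP0 : ∀ v, ∀ x ∉ tsupport a, P v =ᶠ[𝓝 x] 0 := fun v x hx => by
    filter_upwards [(isClosed_tsupport a).isOpen_compl.mem_nhds hx] with y hy
    simp [hP, image_eq_zero_of_notMem_tsupport hy]
  have hPd : ∀ v, ∀ x ∉ interface, DifferentiableAt ℝ (P v) x ∧ fderiv ℝ (P v) x v =
      a x * ‖fderiv ℝ w x v‖ ^ 2 + conj (w x) * (fderiv ℝ w x v * fderiv ℝ a x v) +
        a x * conj (w x) * fderiv ℝ (fderiv ℝ w) x v v := by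
    intro v x hxi
    by_cases hx : x ∈ tsupport a
    · exact hw.fderiv_flux_apply hK (hsub hx) hxi (had x hxi) v
    · refine ⟨((differentiableAt_const (0 : ℂ)).congr_of_eventuallyEq (hP0 v x hx)), ?_⟩
      rw [(hP0 v x hx).fderiv_eq]
      simp [image_eq_zero_of_notMem_tsupport hx, fderiv_of_notMem_tsupport ℝ hx]
  have hcomp : ∀ v (p : ℝ × ℝ) q, fderiv ℝ (fun p => P v (pt p)) p q =
      fderiv ℝ (P v) (pt p) (pt q) := by
    intro v p q
    have : fderiv ℝ (P v ∘ pt) p = (fderiv ℝ (P v) (pt p)).comp (pt : (ℝ × ℝ) →L[ℝ] Plane) :=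
      pt.comp_right_fderiv
    exact congrArg (fun L => L q) this
  have hae : (fun p : ℝ × ℝ => energyDensity kp km w a (pt p)) =ᵐ[volume] fun p =>
      fderiv ℝ (fun p => P e1 (pt p)) p (1, 0) + fderiv ℝ (fun p => P nu (pt p)) p (0, 1) := by
    filter_upwards [ae_notMem_interface] with p hp
    rw [hcomp, hcomp, pt_fst, pt_snd, (hPd e1 _ hp).2, (hPd nu _ hp).2]
    simp only [energyDensity, gradSq, gradDot]
    by_cases hx : pt p ∈ tsupport a
    · have h1 := hw.helmholtz (pt p) (by simp [hp]; exact hsub hx)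
      have h2 : w (pt p) * conj (w (pt p)) = (‖w (pt p)‖ : ℂ) ^ 2 := Complex.mul_conj' _
      push_cast
      rw [← h2]
      linear_combination (-(a (pt p) : ℂ) * conj (w (pt p))) * h1
    · simp [image_eq_zero_of_notMem_tsupport hx, fderiv_of_notMem_tsupport ℝ hx]
  have hdiff : ∀ v, ∀ p : ℝ × ℝ, p.2 ≠ 0 → DifferentiableAt ℝ (fun p => P v (pt p)) p := by
    intro v p hp
    exact (hPd v (pt p) (by simpa [interface] using hp)).1.comp p pt.differentiableAt
  rw [integral_congr_ae hae]
  refine integral_div_eq_zero (hPc e1) (hPc nu) (hdiff e1) (hdiff nu)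
    ((hw.integrable_energyDensity hK ha has hsub hC).congr hae) (C := |A| * B * B) ?_ ?_
  · intro p hp
    by_cases hx : pt p ∈ tsupport a
    · simp only [hP, norm_mul, RCLike.norm_conj, Complex.norm_real]
      have h1 := hB1 _ hx
      have h2 := (norm_apply_nu_le _).trans (hB2 (pt p) hx (by simpa [interface] using hp))
      have h3 := (hA _ hx).trans (le_abs_self A)
      gcongr
    · simp only [hP, image_eq_zero_of_notMem_tsupport hx]
      simp; positivity
  · intro x
    have hc1 : Tendsto (fun δ : ℝ => pt (x, δ)) (𝓝[>] 0) (𝓝 (pt (x, 0))) :=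
      (Continuous.tendsto (by fun_prop) _).mono_left nhdsWithin_le_nhds
    have hc2 : Tendsto (fun δ : ℝ => pt (x, -δ)) (𝓝[>] 0) (𝓝 (pt (x, 0))) := by
      have : Tendsto (fun δ : ℝ => pt (x, -δ)) (𝓝 0) (𝓝 (pt (x, -0))) :=
        Continuous.tendsto (by fun_prop) _
      rw [neg_zero] at this
      exact this.mono_left nhdsWithin_le_nhds
    by_cases hx : pt (x, 0) ∈ tsupport a
    · have hxK := hsub hx
      obtain ⟨Lp, Lm, h1, h2, h3⟩ := hw.normal_jump (pt (x, 0)) (by simp [interface]) hxK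
      have hb : Tendsto (fun y => (a y : ℂ) * conj (w y)) (𝓝 (pt (x, 0)))
          (𝓝 ((a (pt (x, 0)) : ℂ) * conj (w (pt (x, 0))))) := by
        have hwc : ContinuousAt w (pt (x, 0)) :=
          hw.continuousOn.continuousAt (hK.isOpen_compl.mem_nhds hxK)
        exact (Complex.continuous_ofReal.continuousAt.comp ha.continuousAt).mul
          (Complex.continuous_conj.continuousAt.comp hwc)
      have g1 : Tendsto (fun δ : ℝ => fderiv ℝ w (pt (x, δ)) nu) (𝓝[>] 0) (𝓝 (Lp nu)) := by
        have : Tendsto (fun δ : ℝ => pt (x, δ)) (𝓝[>] 0) (𝓝[upper] (pt (x, 0))) :=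
          tendsto_nhdsWithin_iff.2 ⟨hc1, by
            filter_upwards [self_mem_nhdsWithin] with δ hδ using by simpa [upper] using hδ⟩
        exact ((ContinuousLinearMap.apply ℝ ℂ nu).continuous.tendsto Lp).comp (h1.comp this)
      have g2 : Tendsto (fun δ : ℝ => fderiv ℝ w (pt (x, -δ)) nu) (𝓝[>] 0) (𝓝 (Lm nu)) := by
        have : Tendsto (fun δ : ℝ => pt (x, -δ)) (𝓝[>] 0) (𝓝[lower] (pt (x, 0))) :=
          tendsto_nhdsWithin_iff.2 ⟨hc2, by
            filter_upwards [self_mem_nhdsWithin] with δ hδ using by simpa [lower] using hδ⟩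
        exact ((ContinuousLinearMap.apply ℝ ℂ nu).continuous.tendsto Lm).comp (h2.comp this)
      have := ((hb.comp hc1).mul g1).sub ((hb.comp hc2).mul g2)
      rw [h3, sub_self] at this
      exact this
    · have e1 := hc1.eventually (hP0 nu _ hx)
      have e2 := hc2.eventually (hP0 nu _ hx)
      refine tendsto_const_nhds.congr' ?_
      filter_upwards [e1, e2] with δ h1 h2
      simp [h1, h2]

/-- Real part of the energy identity. -/
theorem integral_energy_re (hw : IsTransmission kp km K w) (hK : IsClosed K)
    (ha : Continuous a) (has : HasCompactSupport a) (hsub : tsupport a ⊆ Kᶜ)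
    (had : ∀ x ∉ interface, DifferentiableAt ℝ a x) {C : ℝ}
    (hC : ∀ x ∉ interface, ‖fderiv ℝ a x‖ ≤ C) :
    Integrable (fun p : ℝ × ℝ => a (pt p) * gradSq w (pt p) +
      (conj (w (pt p)) * gradDot w a (pt p)).re -
        waveNumber kp km (pt p) ^ 2 * a (pt p) * ‖w (pt p)‖ ^ 2) ∧
    ∫ p : ℝ × ℝ, (a (pt p) * gradSq w (pt p) + (conj (w (pt p)) * gradDot w a (pt p)).re -
      waveNumber kp km (pt p) ^ 2 * a (pt p) * ‖w (pt p)‖ ^ 2) = 0 := by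
  have hi := hw.integrable_energyDensity hK ha has hsub hC
  have h0 := hw.integral_energyDensity hK ha has hsub had hC
  have he : ∀ x, (energyDensity kp km w a x).re = a x * gradSq w x +
      (conj (w x) * gradDot w a x).re - waveNumber kp km x ^ 2 * a x * ‖w x‖ ^ 2 := by
    intro x
    unfold energyDensity
    rw [Complex.sub_re, Complex.add_re]
    norm_cast
  have h1 := hi.re
  have h2 := integral_re hi
  rw [h0] at h2
  simp only [RCLike.re_eq_complex_re, he, Complex.zero_re] at h1 h2
  exact ⟨h1, h2⟩

/-- Imaginary part of the energy identity. -/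
theorem integral_energy_im (hw : IsTransmission kp km K w) (hK : IsClosed K)
    (ha : Continuous a) (has : HasCompactSupport a) (hsub : tsupport a ⊆ Kᶜ)
    (had : ∀ x ∉ interface, DifferentiableAt ℝ a x) {C : ℝ}
    (hC : ∀ x ∉ interface, ‖fderiv ℝ a x‖ ≤ C) :
    Integrable (fun p : ℝ × ℝ => (conj (w (pt p)) * gradDot w a (pt p)).im) ∧
    ∫ p : ℝ × ℝ, (conj (w (pt p)) * gradDot w a (pt p)).im = 0 := by
  have hi := hw.integrable_energyDensity hK ha has hsub hC
  have h0 := hw.integral_energyDensity hK ha has hsub had hC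
  have he : ∀ x, (energyDensity kp km w a x).im = (conj (w x) * gradDot w a x).im := by
    intro x
    unfold energyDensity
    rw [Complex.sub_im, Complex.add_im]
    norm_cast
    simp
  have h1 := hi.im
  have h2 := integral_im hi
  rw [h0] at h2
  simp only [RCLike.im_eq_complex_im, he, Complex.zero_im] at h1 h2
  exact ⟨h1, h2⟩

end IsTransmission

/-! ### Radial weights -/

/-- The closed annulus of mean radius `R` and half-width `L`. -/
def annulus (R L : ℝ) : Set Plane := {x | |‖x‖ - R| ≤ L}

lemma isClosed_annulus (R L : ℝ) : IsClosed (annulus R L) :=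
  isClosed_le (by fun_prop) continuous_const

lemma isCompact_annulus (R L : ℝ) : IsCompact (annulus R L) := by
  refine Metric.isCompact_of_isClosed_isBounded (isClosed_annulus R L)
    ((Metric.isBounded_closedBall (x := (0 : Plane)) (r := R + L)).subset fun x hx => ?_)
  rw [mem_closedBall_zero_iff]
  have := (abs_le.1 (show |‖x‖ - R| ≤ L from hx)).2
  linarith

lemma annulus_mono {R L L' : ℝ} (h : L ≤ L') : annulus R L ⊆ annulus R L' :=
  fun _ hx => le_trans (show _ ≤ L from hx) h

lemma annulus_subset_compl {R L R₀ : ℝ} (h : R₀ + L < R) :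
    annulus R L ⊆ (Metric.closedBall (0 : Plane) R₀)ᶜ := by
  intro x hx hx'
  rw [mem_closedBall_zero_iff] at hx'
  have := (abs_le.1 (show |‖x‖ - R| ≤ L from hx)).1
  linarith

lemma measurableSet_annulus (R L : ℝ) : MeasurableSet (pt ⁻¹' annulus R L) :=
  pt.continuous.measurable (isClosed_annulus R L).measurableSet

lemma hasFDerivAt_norm {x : Plane} (hx : x ≠ 0) :
    HasFDerivAt (fun y : Plane => ‖y‖) (‖x‖⁻¹ • innerSL ℝ x) x := by
  have h1 := (hasStrictFDerivAt_norm_sq x).hasFDerivAt.sqrt (by positivity)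
  have h2 : (fun y : Plane => √(‖y‖ ^ 2)) = fun y => ‖y‖ := by
    ext y; exact Real.sqrt_sq (norm_nonneg y)
  rw [h2] at h1
  refine h1.congr_fderiv ?_
  rw [Real.sqrt_sq (norm_nonneg x)]
  ext v
  have : ‖x‖ ≠ 0 := norm_ne_zero_iff.2 hx
  simp
  field_simp

/-- The outward radial derivative. -/
def radialDeriv (w : Plane → ℂ) (x : Plane) : ℂ := fderiv ℝ w x (‖x‖⁻¹ • x)

section radial
variable {ζ ζ' : ℝ → ℝ} (hζ : ∀ t, HasDerivAt ζ (ζ' t) t) {r : ℝ} (hr : 0 < r)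
  (hc : ∀ t < r, ζ t = ζ 0)

include hζ hr hc in
/-- The profile is constant near zero, where the norm is not differentiable. -/
lemma hasFDerivAt_radial (x : Plane) :
    HasFDerivAt (fun y : Plane => ζ ‖y‖) (ζ' ‖x‖ • ‖x‖⁻¹ • innerSL ℝ x) x := by
  by_cases hx : x = 0
  · subst hx
    simp only [norm_zero, inv_zero, zero_smul, smul_zero]
    refine (hasFDerivAt_const (ζ 0) (0 : Plane)).congr_of_eventuallyEq ?_
    filter_upwards [Metric.ball_mem_nhds (0 : Plane) hr] with y hy
    exact hc _ (by simpa using hy)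
  · exact (hζ ‖x‖).comp_hasFDerivAt x (hasFDerivAt_norm hx)

include hζ hr hc in
lemma norm_fderiv_radial_le (x : Plane) : ‖fderiv ℝ (fun y : Plane => ζ ‖y‖) x‖ ≤ |ζ' ‖x‖| := by
  rw [(hasFDerivAt_radial hζ hr hc x).fderiv, norm_smul, norm_smul, innerSL_apply_norm, norm_inv,
    norm_norm, Real.norm_eq_abs]
  refine mul_le_of_le_one_right (abs_nonneg _) ?_
  exact inv_mul_le_one

include hζ hr hc in
lemma gradDot_radial (w : Plane → ℂ) (x : Plane) :
    gradDot w (fun y : Plane => ζ ‖y‖) x = ζ' ‖x‖ * radialDeriv w x := by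
  have h : radialDeriv w x =
      (‖x‖⁻¹ : ℝ) * ((x 0 : ℝ) * fderiv ℝ w x e1 + (x 1 : ℝ) * fderiv ℝ w x nu) := by
    unfold radialDeriv
    nth_rw 3 [plane_eq x]
    simp
    ring
  rw [h, gradDot, (hasFDerivAt_radial hζ hr hc x).fderiv]
  simp [e1, nu, PiLp.inner_apply, Fin.sum_univ_two]
  ring

include hζ in
lemma continuous_radial : Continuous fun y : Plane => ζ ‖y‖ := by
  have : Continuous ζ := continuous_iff_continuousAt.2 fun t => (hζ t).continuousAt
  fun_prop

end radial

lemma tsupport_radial_subset {ζ : ℝ → ℝ} {R L : ℝ} (h0 : ∀ t, L ≤ |t - R| → ζ t = 0) :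
    tsupport (fun y : Plane => ζ ‖y‖) ⊆ annulus R L := by
  refine closure_minimal (fun y hy => ?_) (isClosed_annulus R L)
  by_contra h
  exact hy (h0 _ (not_le.1 h).le)

lemma hasCompactSupport_of_tsupport_subset {a : Plane → ℝ} {R L : ℝ}
    (h : tsupport a ⊆ annulus R L) : HasCompactSupport a :=
  (isCompact_annulus R L).of_isClosed_subset (isClosed_tsupport a) h

lemma norm_apply_sq_le {E : Type*} [NormedAddCommGroup E] [NormedSpace ℝ E] (L : Plane →L[ℝ] E)
    (v : Plane) : ‖L v‖ ^ 2 ≤ ‖v‖ ^ 2 * (‖L e1‖ ^ 2 + ‖L nu‖ ^ 2) := by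
  have h1 : ‖L v‖ ≤ |v 0| * ‖L e1‖ + |v 1| * ‖L nu‖ := by
    nth_rw 1 [plane_eq v]
    rw [map_add, map_smul, map_smul]
    refine (norm_add_le _ _).trans ?_
    rw [norm_smul, norm_smul, Real.norm_eq_abs, Real.norm_eq_abs]
  have h2 : ‖v‖ ^ 2 = |v 0| ^ 2 + |v 1| ^ 2 := by
    rw [EuclideanSpace.norm_sq_eq]; simp [Fin.sum_univ_two]
  have h3 := pow_le_pow_left₀ (norm_nonneg _) h1 2
  rw [h2]
  nlinarith [sq_nonneg (|v 0| * ‖L nu‖ - |v 1| * ‖L e1‖)]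

lemma norm_radialDeriv_sq_le (w : Plane → ℂ) (x : Plane) : ‖radialDeriv w x‖ ^ 2 ≤ gradSq w x := by
  refine (norm_apply_sq_le _ _).trans ?_
  rw [norm_smul, norm_inv, norm_norm]
  have : (‖x‖⁻¹ * ‖x‖) ^ 2 ≤ 1 := pow_le_one₀ (by positivity) inv_mul_le_one
  exact mul_le_of_le_one_left (gradSq_nonneg w x) this

lemma hasDerivAt_max_zero_sq (t : ℝ) :
    HasDerivAt (fun s : ℝ => (max 0 s) ^ 2) (2 * max 0 t) t := by
  rcases lt_trichotomy t 0 with h | h | h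
  · rw [max_eq_left h.le, mul_zero]
    refine (hasDerivAt_const t (0 : ℝ)).congr_of_eventuallyEq ?_
    filter_upwards [Iio_mem_nhds h] with s hs
    simp [max_eq_left (show s ≤ 0 from le_of_lt (mem_Iio.1 hs))]
  · subst h
    rw [hasDerivAt_iff_isLittleO_nhds_zero]
    have h1 : (fun h : ℝ => (max 0 (0 + h)) ^ 2 - (max 0 0) ^ 2 - h • (2 * max 0 0 : ℝ)) =O[𝓝 0]
        fun h : ℝ => h ^ 2 := by
      refine Asymptotics.isBigO_of_le _ fun h => ?_
      rw [Real.norm_eq_abs, Real.norm_eq_abs]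
      simp only [zero_add, max_self]
      rcases le_total h 0 with hh | hh
      · simp [max_eq_left hh, sq_nonneg]
      · simp [max_eq_right hh]
    refine h1.trans_isLittleO ?_
    simpa using Asymptotics.isLittleO_pow_id (𝕜 := ℝ) (n := 2) (by norm_num)
  · rw [max_eq_right h.le]
    have := (hasDerivAt_pow 2 t)
    simp only [Nat.cast_ofNat, Nat.add_one_sub_one, pow_one] at this
    refine this.congr_of_eventuallyEq ?_
    filter_upwards [Ioi_mem_nhds h] with s hs
    rw [max_eq_right (show 0 ≤ s from le_of_lt (mem_Ioi.1 hs))]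

/-- The compactly supported profile `(L² - s²)₊`. -/
def bump (L s : ℝ) : ℝ := max 0 (L ^ 2 - s ^ 2)

lemma bump_nonneg (L s : ℝ) : 0 ≤ bump L s := le_max_left _ _

lemma bump_le (L s : ℝ) : bump L s ≤ L ^ 2 := max_le (sq_nonneg L) (by nlinarith [sq_nonneg s])

lemma bump_eq_zero {L s : ℝ} (hL : 0 ≤ L) (h : L ≤ |s|) : bump L s = 0 := by
  have := pow_le_pow_left₀ hL h 2
  rw [sq_abs] at this
  exact max_eq_left (by linarith)

lemma le_bump {L s : ℝ} (h : |s| ≤ L / 2) : 3 / 4 * L ^ 2 ≤ bump L s := by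
  have := pow_le_pow_left₀ (abs_nonneg s) h 2
  rw [sq_abs] at this
  exact le_max_of_le_right (by nlinarith)

lemma continuous_bump (L : ℝ) : Continuous (bump L) := by unfold bump; fun_prop

lemma hasDerivAt_bump_sq (L R t : ℝ) :
    HasDerivAt (fun t => bump L (t - R) ^ 2) (-4 * (t - R) * bump L (t - R)) t := by
  have h1 : HasDerivAt (fun t : ℝ => L ^ 2 - (t - R) ^ 2) (-(2 * (t - R))) t := by
    have := (((hasDerivAt_id t).sub_const R).pow 2).const_sub (L ^ 2)
    simpa using this
  have := (hasDerivAt_max_zero_sq (L ^ 2 - (t - R) ^ 2)).comp t h1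
  refine this.congr_deriv ?_
  unfold bump
  ring

/-- The constant in the Caccioppoli inequality `IsTransmission.caccioppoli`. -/
def cacc (kp km L : ℝ) : ℝ :=
  2 * (16 / 9 / L ^ 4) * ((|kp| + |km|) ^ 2 * L ^ 4 + 8 * L ^ 2)

lemma lintegral_indicator_annulus {f : Plane → ℝ} (hf : Measurable f) (R L : ℝ) {c : ℝ}
    (hc0 : 0 ≤ c) :
    ∫⁻ p : ℝ × ℝ, ENNReal.ofReal ((annulus R L).indicator (fun x => c * f x) (pt p)) =
      ENNReal.ofReal c * ∫⁻ p in pt ⁻¹' annulus R L, ENNReal.ofReal (f (pt p)) := by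
  have hfm : Measurable fun p : ℝ × ℝ => ENNReal.ofReal (f (pt p)) :=
    (hf.comp pt.continuous.measurable).ennreal_ofReal
  rw [← lintegral_const_mul _ hfm,
      ← lintegral_indicator (measurableSet_annulus R L)]
  congr 1
  ext p
  by_cases hp : pt p ∈ annulus R L
  · rw [indicator_of_mem (show p ∈ pt ⁻¹' annulus R L from hp), indicator_of_mem hp,
      ENNReal.ofReal_mul hc0]
  · rw [indicator_of_notMem (show p ∉ pt ⁻¹' annulus R L from hp), indicator_of_notMem hp]
    simp

lemma measurable_ofReal_norm_sq {w : Plane → ℂ} (hw : Measurable w) :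
    Measurable fun p : ℝ × ℝ => ENNReal.ofReal (‖w (pt p)‖ ^ 2) :=
  ((hw.comp pt.continuous.measurable).norm.pow_const 2).ennreal_ofReal

namespace IsTransmission

variable {kp km R₀ : ℝ} {w : Plane → ℂ}

/-- The Caccioppoli inequality on annuli, uniform in the radius. It is the real part of the energy
identity with a cutoff `ζ` satisfying `|ζ'|² ≤ 16 L² ζ`. -/
theorem caccioppoli (hw : IsTransmission kp km (Metric.closedBall 0 R₀) w) (hR₀ : 0 < R₀) {R L : ℝ}
    (hL : 0 < L) (hR : R₀ + L < R) :
    ∫⁻ p in pt ⁻¹' annulus R (L / 2), ENNReal.ofReal (gradSq w (pt p)) ≤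
      ENNReal.ofReal (cacc kp km L) *
        ∫⁻ p in pt ⁻¹' annulus R L, ENNReal.ofReal (‖w (pt p)‖ ^ 2) := by
  have hζ := hasDerivAt_bump_sq L R
  set ζ : ℝ → ℝ := fun t => bump L (t - R) ^ 2 with hζdef
  have h0 : ∀ t, L ≤ |t - R| → ζ t = 0 := fun t ht => by simp [hζdef, bump_eq_zero hL.le ht]
  have hc : ∀ t < R₀, ζ t = ζ 0 := fun t ht => by
    rw [h0 t (by rw [abs_sub_comm]; exact le_trans (by linarith) (le_abs_self _)),
      h0 0 (by rw [abs_sub_comm]; exact le_trans (by linarith) (le_abs_self _))]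
  have hsub := tsupport_radial_subset h0
  have hsubK := hsub.trans (annulus_subset_compl hR)
  have hcs := hasCompactSupport_of_tsupport_subset hsub
  obtain ⟨B, hB0, hB1, hB2⟩ := hw.exists_bound Metric.isClosed_closedBall (isCompact_annulus R L)
    (annulus_subset_compl hR)
  have hder : ∀ t, |(-4 * (t - R) * bump L (t - R))| ≤ 4 * L * bump L (t - R) := by
    intro t
    rcases le_total L |t - R| with h | h
    · simp [bump_eq_zero hL.le h]
    · rw [abs_mul, abs_mul, abs_of_nonneg (bump_nonneg _ _)]
      have := bump_nonneg L (t - R)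
      norm_num
      gcongr
  obtain ⟨hei, he0⟩ := hw.integral_energy_re Metric.isClosed_closedBall (continuous_radial hζ) hcs
    hsubK (fun x _ => (hasFDerivAt_radial hζ hR₀ hc x).differentiableAt) (C := 4 * L * L ^ 2)
    (fun x _ => (norm_fderiv_radial_le hζ hR₀ hc x).trans ((hder _).trans
      (by have := bump_le L (‖x‖ - R); gcongr)))
  set c : ℝ := (|kp| + |km|) ^ 2 * L ^ 4 + 8 * L ^ 2 with hcdef
  have hc0 : 0 ≤ c := by positivity
  -- the two sides of the inequality, and the pointwise estimate between them
  set f : Plane → ℝ := fun x => 1 / 2 * ζ ‖x‖ * gradSq w x with hf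
  set g : Plane → ℝ := fun x => (annulus R L).indicator (fun x => c * ‖w x‖ ^ 2) x with hg
  have hζ0 : ∀ t, 0 ≤ ζ t := fun t => sq_nonneg _
  have hζL : ∀ t, ζ t ≤ L ^ 4 := fun t => by
    have := pow_le_pow_left₀ (bump_nonneg L (t - R)) (bump_le L (t - R)) 2
    calc ζ t ≤ (L ^ 2) ^ 2 := this
      _ = L ^ 4 := by ring
  have hζm : Measurable fun x : Plane => ζ ‖x‖ := (continuous_radial hζ).measurable
  have hfi : Integrable fun p : ℝ × ℝ => f (pt p) := by
    refine integrable_comp_pt ((hζm.const_mul _).mul (measurable_gradSq w)).stronglyMeasurable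
      (isCompact_annulus R L) (C := L ^ 4 * (2 * B ^ 2)) (fun x hx => ?_) fun x hx hxi => ?_
    · simp [hf, h0 _ (not_le.1 hx).le]
    · have h1 : gradSq w x ≤ 2 * B ^ 2 := (gradSq_le w x).trans (by have := hB2 x hx hxi; gcongr)
      have h2 := gradSq_nonneg w x
      rw [Real.norm_of_nonneg (mul_nonneg (mul_nonneg (by norm_num) (hζ0 _)) h2)]
      have h3 := hζL ‖x‖
      have h4 := hζ0 ‖x‖
      refine mul_le_mul ?_ h1 h2 (by positivity)
      linarith
  have hgi : Integrable fun p : ℝ × ℝ => g (pt p) := by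
    refine integrable_comp_pt (((hw.measurable.norm.pow_const 2).const_mul c).indicator
      (isClosed_annulus R L).measurableSet).stronglyMeasurable
      (isCompact_annulus R L) (C := c * B ^ 2) (fun x hx => indicator_of_notMem hx _)
      fun x hx _ => ?_
    rw [hg]
    simp only [indicator_of_mem hx]
    rw [Real.norm_of_nonneg (by positivity)]
    have := hB1 x hx
    gcongr
  have hpt : ∀ x, f x ≤ g x + (ζ ‖x‖ * gradSq w x +
      (conj (w x) * gradDot w (fun y : Plane => ζ ‖y‖) x).re -
        waveNumber kp km x ^ 2 * ζ ‖x‖ * ‖w x‖ ^ 2) := by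
    intro x
    rw [gradDot_radial hζ hR₀ hc]
    by_cases hx : x ∈ annulus R L
    · simp only [hf, hg, indicator_of_mem hx]
      have h1 : |(conj (w x) * (((-4 * (‖x‖ - R) * bump L (‖x‖ - R) : ℝ) : ℂ) *
          radialDeriv w x)).re| ≤ ‖w x‖ * (4 * L * bump L (‖x‖ - R) * ‖radialDeriv w x‖) := by
        refine (Complex.abs_re_le_norm _).trans ?_
        rw [norm_mul, RCLike.norm_conj, norm_mul, Complex.norm_real, Real.norm_eq_abs]
        have := hder ‖x‖
        gcongr
      have h2 := neg_le_of_abs_le h1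
      have h3 := norm_radialDeriv_sq_le w x
      have h4 : waveNumber kp km x ^ 2 ≤ (|kp| + |km|) ^ 2 := by
        rw [← sq_abs]; have := abs_waveNumber_le kp km x; gcongr
      have h5 : waveNumber kp km x ^ 2 * ζ ‖x‖ ≤ (|kp| + |km|) ^ 2 * L ^ 4 :=
        mul_le_mul h4 (hζL _) (hζ0 _) (by positivity)
      have h6 := mul_le_mul_of_nonneg_right h5 (sq_nonneg ‖w x‖)
      have h7 : ζ ‖x‖ * ‖radialDeriv w x‖ ^ 2 ≤ ζ ‖x‖ * gradSq w x :=
        mul_le_mul_of_nonneg_left h3 (hζ0 _)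
      have h8 : ζ ‖x‖ = bump L (‖x‖ - R) ^ 2 := rfl
      rw [h8] at h7 h6 ⊢
      set b := bump L (‖x‖ - R)
      set d := ‖radialDeriv w x‖
      have h9 : ‖w x‖ * (4 * L * b * d) ≤ 1 / 2 * (b ^ 2 * d ^ 2) + 8 * L ^ 2 * ‖w x‖ ^ 2 := by
        nlinarith [sq_nonneg (b * d - 4 * L * ‖w x‖)]
      have h10 : c * ‖w x‖ ^ 2 = (|kp| + |km|) ^ 2 * L ^ 4 * ‖w x‖ ^ 2 + 8 * L ^ 2 * ‖w x‖ ^ 2 := by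
        rw [hcdef]; ring
      linarith
    · have h1 : L ≤ |‖x‖ - R| := (not_le.1 hx).le
      simp [hf, hg, indicator_of_notMem hx, h0 _ h1, bump_eq_zero hL.le h1]
  have hint : ∫ p, f (pt p) ≤ ∫ p, g (pt p) := by
    have h1 := integral_mono hfi (hgi.add hei) fun p => hpt (pt p)
    rw [integral_add' hgi hei, he0, add_zero] at h1
    exact h1
  have hf0 : ∀ x, 0 ≤ f x := fun x => by
    have := gradSq_nonneg w x
    have := hζ0 ‖x‖
    simp only [hf]; positivity
  have hg0 : ∀ x, 0 ≤ g x := fun x => indicator_nonneg (fun x _ => by positivity) x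
  have hlin := ENNReal.ofReal_le_ofReal hint
  rw [ofReal_integral_eq_lintegral_ofReal hfi (Eventually.of_forall fun p => hf0 _),
    ofReal_integral_eq_lintegral_ofReal hgi (Eventually.of_forall fun p => hg0 _)] at hlin
  have hg' : ∫⁻ p, ENNReal.ofReal (g (pt p)) =
      ENNReal.ofReal c * ∫⁻ p in pt ⁻¹' annulus R L, ENNReal.ofReal (‖w (pt p)‖ ^ 2) :=
    lintegral_indicator_annulus (hw.measurable.norm.pow_const 2) R L hc0
  set m : ℝ := 2 * (16 / 9 / L ^ 4) with hm
  have hm0 : 0 ≤ m := by positivity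
  calc ∫⁻ p in pt ⁻¹' annulus R (L / 2), ENNReal.ofReal (gradSq w (pt p))
      ≤ ∫⁻ p in pt ⁻¹' annulus R (L / 2), ENNReal.ofReal m * ENNReal.ofReal (f (pt p)) := by
        refine setLIntegral_mono' (measurableSet_annulus _ _) fun p hp => ?_
        rw [← ENNReal.ofReal_mul hm0]
        refine ENNReal.ofReal_le_ofReal ?_
        have h1 : 3 / 4 * L ^ 2 ≤ bump L (‖pt p‖ - R) := le_bump hp
        have h2 := pow_le_pow_left₀ (by positivity) h1 2
        have h3 := mul_le_mul_of_nonneg_right h2 (gradSq_nonneg w (pt p))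
        have h4 : m * f (pt p) = 16 / 9 / L ^ 4 * (bump L (‖pt p‖ - R) ^ 2 * gradSq w (pt p)) := by
          simp only [hm, hf, hζdef]; ring
        rw [h4]
        have h5 := mul_le_mul_of_nonneg_left h3 (show 0 ≤ 16 / 9 / L ^ 4 by positivity)
        refine le_trans (le_of_eq ?_) h5
        field_simp
        ring
    _ ≤ ∫⁻ p, ENNReal.ofReal m * ENNReal.ofReal (f (pt p)) := setLIntegral_le_lintegral _ _
    _ = ENNReal.ofReal m * ∫⁻ p, ENNReal.ofReal (f (pt p)) :=
        lintegral_const_mul' _ _ ENNReal.ofReal_ne_top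
    _ ≤ ENNReal.ofReal m * ∫⁻ p, ENNReal.ofReal (g (pt p)) := by gcongr
    _ = _ := by rw [hg', ← mul_assoc, ← ENNReal.ofReal_mul hm0]; rfl

end IsTransmission

/-! ### Difference quotients -/

/-- The squared length of `∇∂₁w`. -/
def hessSq (w : Plane → ℂ) (x : Plane) : ℝ :=
  ‖fderiv ℝ (fderiv ℝ w) x e1 e1‖ ^ 2 + ‖fderiv ℝ (fderiv ℝ w) x e1 nu‖ ^ 2

/-- The forward difference quotient with step `1 / (n + 1)` in the horizontal direction. -/
def diffQuot (w : Plane → ℂ) (n : ℕ) (x : Plane) : ℂ :=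
  ((n + 1 : ℝ) : ℂ) * (w (x - horiz (-(n + 1 : ℝ)⁻¹)) - w x)

lemma sub_horiz_neg (x : Plane) (h : ℝ) : x - horiz (-h) = x + h • e1 := by
  ext i; fin_cases i <;> simp [horiz, e1]

lemma norm_horiz (h : ℝ) : ‖horiz h‖ = |h| := by
  simp [horiz, EuclideanSpace.norm_eq, Fin.sum_univ_two, Real.sqrt_sq_eq_abs]

lemma add_smul_e1_mem_interface {x : Plane} {h : ℝ} :
    x + h • e1 ∈ interface ↔ x ∈ interface := by
  simp [interface, e1]

namespace IsTransmission

variable {kp km R₀ : ℝ} {w : Plane → ℂ}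

lemma inv_natCast_add_one_le (n : ℕ) : ((n : ℝ) + 1)⁻¹ ≤ 1 :=
  inv_le_one_of_one_le₀ (by linarith [(n.cast_nonneg : (0 : ℝ) ≤ n)])

lemma sub_horiz_notMem {x : Plane} {h : ℝ} (hh : |h| ≤ 1)
    (hx : x ∉ Metric.closedBall (0 : Plane) (R₀ + 1)) :
    x - horiz h ∉ Metric.closedBall (0 : Plane) R₀ := by
  rw [mem_closedBall_zero_iff, not_le] at hx ⊢
  have := norm_sub_norm_le x (horiz h)
  rw [norm_horiz] at this
  linarith

lemma abs_neg_inv_le (n : ℕ) : |(-((n : ℝ) + 1)⁻¹)| ≤ 1 := by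
  rw [abs_neg, abs_of_nonneg (by positivity)]; exact inv_natCast_add_one_le n

lemma diffQuot (hw : IsTransmission kp km (Metric.closedBall 0 R₀) w) (n : ℕ) :
    IsTransmission kp km (Metric.closedBall 0 (R₀ + 1)) (diffQuot w n) :=
  ((hw.comp_sub_horiz fun _ hx => sub_horiz_notMem (abs_neg_inv_le n) hx).sub
    (hw.mono (Metric.closedBall_subset_closedBall (by linarith)))
      Metric.isClosed_closedBall).const_mul _

lemma norm_diffQuot_le (hw : IsTransmission kp km (Metric.closedBall 0 R₀) w) {R L B : ℝ}
    (hR : R₀ + (L + 1) < R) (hB : ∀ x ∈ annulus R (L + 1), x ∉ interface → ‖fderiv ℝ w x‖ ≤ B)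
    (n : ℕ) {x : Plane} (hx : x ∈ annulus R L) (hxi : x ∉ interface) :
    ‖TwoLayer.diffQuot w n x‖ ≤ B := by
  set h : ℝ := ((n : ℝ) + 1)⁻¹ with hh
  have hh0 : 0 < h := by positivity
  have hh1 : h ≤ 1 := inv_natCast_add_one_le n
  have hseg : ∀ y ∈ segment ℝ x (x + h • e1), y ∈ annulus R (L + 1) ∧ y ∉ interface := by
    intro y hy
    rw [segment_eq_image'] at hy
    obtain ⟨t, ht, rfl⟩ := hy
    have e : x + t • (x + h • e1 - x) = x + (t * h) • e1 := by
      rw [add_sub_cancel_left, smul_smul]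
    simp only [e]
    refine ⟨?_, fun hc => hxi (add_smul_e1_mem_interface.1 hc)⟩
    have h1 : |‖x + (t * h) • e1‖ - ‖x‖| ≤ 1 := by
      refine (abs_norm_sub_norm_le _ _).trans ?_
      rw [add_sub_cancel_left, norm_smul, norm_e1, mul_one, Real.norm_of_nonneg
        (mul_nonneg ht.1 hh0.le)]
      exact mul_le_one₀ ht.2 hh0.le hh1
    have h2 : |‖x‖ - R| ≤ L := hx
    show |‖x + (t * h) • e1‖ - R| ≤ L + 1
    rw [abs_le] at *
    constructor <;> linarith [h1.1, h1.2, h2.1, h2.2]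
  have hmv := (convex_segment x (x + h • e1)).norm_image_sub_le_of_norm_fderiv_le (𝕜 := ℝ) (f := w)
    (C := B) (fun y hy => hw.differentiableAt Metric.isClosed_closedBall
      (annulus_subset_compl hR (hseg y hy).1) (hseg y hy).2)
    (fun y hy => hB y (hseg y hy).1 (hseg y hy).2) (left_mem_segment ℝ _ _)
    (right_mem_segment ℝ _ _)
  rw [add_sub_cancel_left, norm_smul, norm_e1, mul_one, Real.norm_of_nonneg hh0.le] at hmv
  rw [TwoLayer.diffQuot, sub_horiz_neg, norm_mul, Complex.norm_real,
    Real.norm_of_nonneg (by positivity)]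
  calc ((n : ℝ) + 1) * ‖w (x + h • e1) - w x‖ ≤ ((n : ℝ) + 1) * (B * h) := by gcongr
    _ = B := by rw [hh]; field_simp

lemma tendsto_natCast_add_one : Tendsto (fun n : ℕ => ‖((n : ℝ) + 1)‖) atTop atTop :=
  tendsto_norm_atTop_atTop.comp (tendsto_atTop_add_const_right _ _ tendsto_natCast_atTop_atTop)

lemma tendsto_diffQuot (hw : IsTransmission kp km (Metric.closedBall 0 R₀) w) {x : Plane}
    (hx : x ∉ Metric.closedBall 0 R₀) (hxi : x ∉ interface) :
    Tendsto (fun n => TwoLayer.diffQuot w n x) atTop (𝓝 (fderiv ℝ w x e1)) := by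
  have := (hw.differentiableAt Metric.isClosed_closedBall hx hxi).hasFDerivAt.lim e1
    tendsto_natCast_add_one
  refine this.congr fun n => ?_
  rw [TwoLayer.diffQuot, sub_horiz_neg]
  simp

lemma tendsto_fderiv_diffQuot (hw : IsTransmission kp km (Metric.closedBall 0 R₀) w) {x : Plane}
    (hx : x ∉ Metric.closedBall 0 (R₀ + 1)) (hxi : x ∉ interface) :
    Tendsto (fun n => fderiv ℝ (TwoLayer.diffQuot w n) x) atTop
      (𝓝 (fderiv ℝ (fderiv ℝ w) x e1)) := by
  have hx' : x ∉ Metric.closedBall 0 R₀ := fun h =>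
    hx (Metric.closedBall_subset_closedBall (by linarith) h)
  have := (hw.differentiableAt_fderiv Metric.isClosed_closedBall hx' hxi).hasFDerivAt.lim e1
    tendsto_natCast_add_one
  refine this.congr fun n => ?_
  have hd : DifferentiableAt ℝ w (x - horiz (-((n : ℝ) + 1)⁻¹)) :=
    hw.differentiableAt Metric.isClosed_closedBall (sub_horiz_notMem (abs_neg_inv_le n) hx)
      (by rw [sub_horiz_neg, add_smul_e1_mem_interface]; exact hxi)
  have h1 := ((hd.hasFDerivAt.comp x ((hasFDerivAt_id x).sub_const
    (horiz (-((n : ℝ) + 1)⁻¹)))).sub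
    (hw.differentiableAt Metric.isClosed_closedBall hx' hxi).hasFDerivAt).const_mul
      (((n : ℝ) + 1 : ℝ) : ℂ)
  have h2 : HasFDerivAt (TwoLayer.diffQuot w n) _ x := h1
  rw [h2.fderiv, sub_horiz_neg]
  ext v
  simp

/-- The Caccioppoli inequality for the horizontal derivative: apply it to difference quotients,
which solve the same transmission problem. -/
theorem lintegral_hessSq_le (hw : IsTransmission kp km (Metric.closedBall 0 R₀) w) (hR₀ : 0 < R₀)
    {R L : ℝ} (hL : 0 < L) (hR : R₀ + 1 + L < R) :
    ∫⁻ p in pt ⁻¹' annulus R (L / 2), ENNReal.ofReal (hessSq w (pt p)) ≤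
      ENNReal.ofReal (cacc kp km L) *
        ∫⁻ p in pt ⁻¹' annulus R L, ENNReal.ofReal (‖fderiv ℝ w (pt p) e1‖ ^ 2) := by
  obtain ⟨B, hB0, -, hB⟩ := hw.exists_bound Metric.isClosed_closedBall
    (isCompact_annulus R (L + 1)) (annulus_subset_compl (by linarith))
  have hmem : ∀ L' ≤ L, ∀ p ∈ pt ⁻¹' annulus R L', pt p ∉ Metric.closedBall (0 : Plane) (R₀ + 1) :=
    fun L' hL' p hp => annulus_subset_compl (by linarith) hp
  have hlim : Tendsto (fun n => ∫⁻ p in pt ⁻¹' annulus R L,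
      ENNReal.ofReal (‖TwoLayer.diffQuot w n (pt p)‖ ^ 2)) atTop
      (𝓝 (∫⁻ p in pt ⁻¹' annulus R L, ENNReal.ofReal (‖fderiv ℝ w (pt p) e1‖ ^ 2))) := by
    refine tendsto_lintegral_of_dominated_convergence (fun _ => ENNReal.ofReal (B ^ 2))
      (fun n => measurable_ofReal_norm_sq (hw.diffQuot n).measurable) (fun n => ?_) ?_ ?_
    · rw [EventuallyLE, ae_restrict_iff' (measurableSet_annulus _ _)]
      filter_upwards [ae_notMem_interface] with p hp hpa
      have := hw.norm_diffQuot_le (by linarith) hB n hpa hp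
      gcongr
    · rw [setLIntegral_const]
      exact ENNReal.mul_ne_top ENNReal.ofReal_ne_top
        (pt.toHomeomorph.isCompact_preimage.2 (isCompact_annulus R L)).measure_lt_top.ne
    · rw [ae_restrict_iff' (measurableSet_annulus _ _)]
      filter_upwards [ae_notMem_interface] with p hp hpa
      have := hw.tendsto_diffQuot (fun h => hmem L le_rfl p hpa
        (Metric.closedBall_subset_closedBall (by linarith) h)) hp
      exact ENNReal.tendsto_ofReal (this.norm.pow 2)
  calc ∫⁻ p in pt ⁻¹' annulus R (L / 2), ENNReal.ofReal (hessSq w (pt p))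
      = ∫⁻ p in pt ⁻¹' annulus R (L / 2),
          liminf (fun n => ENNReal.ofReal (gradSq (TwoLayer.diffQuot w n) (pt p))) atTop := by
        refine lintegral_congr_ae ?_
        rw [EventuallyEq, ae_restrict_iff' (measurableSet_annulus _ _)]
        filter_upwards [ae_notMem_interface] with p hp hpa
        have h1 := hw.tendsto_fderiv_diffQuot (hmem (L / 2) (by linarith) p hpa) hp
        have h2 : ∀ v, Tendsto (fun n => fderiv ℝ (TwoLayer.diffQuot w n) (pt p) v) atTop
          (𝓝 (fderiv ℝ (fderiv ℝ w) (pt p) e1 v)) := fun v =>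
          ((ContinuousLinearMap.apply ℝ ℂ v).continuous.tendsto _).comp h1
        exact (ENNReal.tendsto_ofReal (((h2 e1).norm.pow 2).add
          ((h2 nu).norm.pow 2))).liminf_eq.symm
    _ ≤ liminf (fun n => ∫⁻ p in pt ⁻¹' annulus R (L / 2),
          ENNReal.ofReal (gradSq (TwoLayer.diffQuot w n) (pt p))) atTop :=
        lintegral_liminf_le fun n =>
          ((measurable_gradSq _).comp pt.continuous.measurable).ennreal_ofReal
    _ ≤ liminf (fun n => ENNReal.ofReal (cacc kp km L) * ∫⁻ p in pt ⁻¹' annulus R L,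
          ENNReal.ofReal (‖TwoLayer.diffQuot w n (pt p)‖ ^ 2)) atTop :=
        liminf_le_liminf (Eventually.of_forall fun n =>
          (hw.diffQuot n).caccioppoli (by linarith) hL hR)
    _ = _ := (ENNReal.Tendsto.const_mul hlim (Or.inr ENNReal.ofReal_ne_top)).liminf_eq

end IsTransmission

/-! ### The energy flux -/

/-- The primitive of `bump L` that vanishes at `-L`. -/
def step (L s : ℝ) : ℝ := ∫ x in (-L)..s, bump L x

lemma hasDerivAt_step (L s : ℝ) : HasDerivAt (step L) (bump L s) s :=
  intervalIntegral.integral_hasDerivAt_right ((continuous_bump L).intervalIntegrable _ _)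
    (continuous_bump L).stronglyMeasurable.stronglyMeasurableAtFilter
    (continuous_bump L).continuousAt

lemma step_of_le {L s : ℝ} (hL : 0 ≤ L) (hs : s ≤ -L) : step L s = 0 := by
  unfold step
  rw [intervalIntegral.integral_congr (g := fun _ => (0 : ℝ)), intervalIntegral.integral_zero]
  intro x hx
  rw [uIcc_of_ge hs] at hx
  exact bump_eq_zero hL (by rw [abs_of_nonpos (by linarith [hx.2])]; linarith [hx.2])

lemma step_of_ge {L s : ℝ} (hL : 0 ≤ L) (hs : L ≤ s) : step L s = step L L := by
  have h : ∫ x in L..s, bump L x = 0 := by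
    rw [intervalIntegral.integral_congr (g := fun _ => (0 : ℝ)), intervalIntegral.integral_zero]
    intro x hx
    rw [uIcc_of_le hs] at hx
    exact bump_eq_zero hL (hx.1.trans (le_abs_self _))
  unfold step
  rw [← intervalIntegral.integral_add_adjacent_intervals
    ((continuous_bump L).intervalIntegrable (-L) L) ((continuous_bump L).intervalIntegrable L s), h,
    add_zero]

lemma step_le {L : ℝ} (hL : 0 ≤ L) (s : ℝ) : step L s ≤ step L L := by
  rcases le_total s L with h | h
  · exact monotone_of_hasDerivAt_nonneg (hasDerivAt_step L) (fun s => bump_nonneg L s) h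
  · exact (step_of_ge hL h).le

lemma step_nonneg {L : ℝ} (hL : 0 ≤ L) (s : ℝ) : 0 ≤ step L s := by
  rcases le_total s (-L) with h | h
  · exact (step_of_le hL h).ge
  · exact (step_of_le hL le_rfl).symm.trans_le
      (monotone_of_hasDerivAt_nonneg (hasDerivAt_step L) (fun s => bump_nonneg L s) h)

/-- The energy flux `Im (conj w ∂w/∂r)`, averaged over an annulus with the weight `bump`. -/
def flux (L R : ℝ) (w : Plane → ℂ) : ℝ :=
  ∫ p : ℝ × ℝ, bump L (‖pt p‖ - R) * (conj (w (pt p)) * radialDeriv w (pt p)).im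

/-- The quantity that the radiation condition requires to be small. -/
def defect (kp km : ℝ) (w : Plane → ℂ) (x : Plane) : ℂ :=
  radialDeriv w x - Complex.I * (waveNumber kp km x : ℂ) * w x

lemma measurable_radialDeriv (w : Plane → ℂ) : Measurable (radialDeriv w) := by
  have h : radialDeriv w = fun x => ((‖x‖⁻¹ : ℝ) : ℂ) *
      (((x 0 : ℝ) : ℂ) * fderiv ℝ w x e1 + ((x 1 : ℝ) : ℂ) * fderiv ℝ w x nu) := by
    ext x
    unfold radialDeriv
    nth_rw 3 [plane_eq x]
    simp
    ring
  rw [h]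
  have h1 := fun v => measurable_fderiv_apply_const ℝ w v
  have h2 : Measurable fun x : Plane => ((‖x‖⁻¹ : ℝ) : ℂ) :=
    Complex.measurable_ofReal.comp measurable_norm.inv
  have h3 : ∀ i, Measurable fun x : Plane => ((x i : ℝ) : ℂ) := fun i =>
    Complex.measurable_ofReal.comp (by fun_prop)
  exact h2.mul (((h3 0).mul (h1 e1)).add ((h3 1).mul (h1 nu)))

lemma measurable_defect (kp km : ℝ) {w : Plane → ℂ} (hw : Measurable w) :
    Measurable (defect kp km w) :=
  (measurable_radialDeriv w).sub ((measurable_const.mul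
    (Complex.measurable_ofReal.comp (measurable_waveNumber kp km))).mul hw)

lemma norm_radialDeriv_le (w : Plane → ℂ) (x : Plane) : ‖radialDeriv w x‖ ≤ ‖fderiv ℝ w x‖ := by
  unfold radialDeriv
  refine (ContinuousLinearMap.le_opNorm _ _).trans (mul_le_of_le_one_right (norm_nonneg _) ?_)
  rw [norm_smul, norm_inv, norm_norm]
  exact inv_mul_le_one

lemma norm_sub_I_mul_sq (k : ℝ) (z w : ℂ) :
    ‖z - Complex.I * k * w‖ ^ 2 = ‖z‖ ^ 2 + k ^ 2 * ‖w‖ ^ 2 - 2 * k * (conj w * z).im := by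
  simp only [← Complex.normSq_eq_norm_sq, Complex.normSq_apply]
  simp
  ring

/-- The pointwise form of Sommerfeld's argument: `w` is controlled by the radiation defect and the
flux. -/
lemma mul_norm_sq_le (k : ℝ) (hk : 0 < k) (z w : ℂ) :
    k * ‖w‖ ^ 2 ≤ k⁻¹ * ‖z - Complex.I * k * w‖ ^ 2 + 2 * (conj w * z).im := by
  rw [norm_sub_I_mul_sq]
  have : k⁻¹ * (‖z‖ ^ 2 + k ^ 2 * ‖w‖ ^ 2 - 2 * k * (conj w * z).im) + 2 * (conj w * z).im =
    k⁻¹ * ‖z‖ ^ 2 + k * ‖w‖ ^ 2 := by field_simp; ring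
  rw [this]
  have : 0 ≤ k⁻¹ * ‖z‖ ^ 2 := by positivity
  linarith

namespace IsTransmission

variable {kp km R₀ : ℝ} {w : Plane → ℂ}

lemma integrable_flux (hw : IsTransmission kp km (Metric.closedBall 0 R₀) w) {R L : ℝ}
    (hL : 0 ≤ L) (hR : R₀ + L < R) : Integrable fun p : ℝ × ℝ =>
      bump L (‖pt p‖ - R) * (conj (w (pt p)) * radialDeriv w (pt p)).im := by
  obtain ⟨B, hB0, hB1, hB2⟩ := hw.exists_bound Metric.isClosed_closedBall (isCompact_annulus R L)
    (annulus_subset_compl hR)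
  have hm : Measurable fun x => bump L (‖x‖ - R) * (conj (w x) * radialDeriv w x).im :=
    ((continuous_bump L).measurable.comp (measurable_norm.sub_const R)).mul
      (Complex.measurable_im.comp ((Complex.continuous_conj.measurable.comp hw.measurable).mul
        (measurable_radialDeriv w)))
  refine integrable_comp_pt hm.stronglyMeasurable (isCompact_annulus R L) (C := L ^ 2 * (B * B))
    (fun x hx => ?_) fun x hx hxi => ?_
  · have h : L ≤ |‖x‖ - R| := (not_le.1 hx).le
    simp [bump_eq_zero hL h]
  · rw [norm_mul, Real.norm_of_nonneg (bump_nonneg _ _), Real.norm_eq_abs]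
    have h1 := bump_le L (‖x‖ - R)
    have h2 : |(conj (w x) * radialDeriv w x).im| ≤ B * B := by
      refine (Complex.abs_im_le_norm _).trans ?_
      rw [norm_mul, RCLike.norm_conj]
      have h3 := hB1 x hx
      have h4 := (norm_radialDeriv_le w x).trans (hB2 x hx hxi)
      gcongr
    gcongr

/-- Conservation of the flux outside a ball: the imaginary part of the energy identity, with a
weight whose radial derivative is the difference of two bumps. -/
theorem flux_eq (hw : IsTransmission kp km (Metric.closedBall 0 R₀) w) (hR₀ : 0 < R₀) {R R' L : ℝ}
    (hL : 0 < L) (hR : R₀ + L < R) (hRR' : R ≤ R') : flux L R w = flux L R' w := by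
  have hζ : ∀ t, HasDerivAt (fun t => step L (t - R) - step L (t - R'))
      (bump L (t - R) - bump L (t - R')) t := fun t =>
    ((hasDerivAt_step L _).comp_sub_const t R).sub ((hasDerivAt_step L _).comp_sub_const t R')
  set ζ : ℝ → ℝ := fun t => step L (t - R) - step L (t - R') with hζdef
  have h0 : ∀ t, (R' - R) / 2 + L ≤ |t - (R + R') / 2| → ζ t = 0 := by
    intro t ht
    rcases le_abs'.1 ht with h | h
    · simp only [hζdef]
      rw [step_of_le hL.le (by linarith), step_of_le hL.le (by linarith), sub_zero]
    · simp only [hζdef]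
      rw [step_of_ge (s := t - R) hL.le (by linarith), step_of_ge (s := t - R') hL.le (by linarith),
        sub_self]
  have hc : ∀ t < R₀, ζ t = ζ 0 := fun t ht => by
    rw [h0 t (by rw [abs_sub_comm]; exact le_trans (by linarith) (le_abs_self _)),
      h0 0 (by rw [abs_sub_comm]; exact le_trans (by linarith) (le_abs_self _))]
  have hsub := tsupport_radial_subset h0
  obtain ⟨-, he⟩ := hw.integral_energy_im Metric.isClosed_closedBall (continuous_radial hζ)
    (hasCompactSupport_of_tsupport_subset hsub) (hsub.trans (annulus_subset_compl (by linarith)))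
    (fun x _ => (hasFDerivAt_radial hζ hR₀ hc x).differentiableAt) (C := L ^ 2 + L ^ 2)
    (fun x _ => (norm_fderiv_radial_le hζ hR₀ hc x).trans ((abs_sub _ _).trans
      (by
        rw [abs_of_nonneg (bump_nonneg _ _), abs_of_nonneg (bump_nonneg _ _)]
        exact add_le_add (bump_le _ _) (bump_le _ _))))
  rw [flux, flux, ← sub_eq_zero, ← integral_sub (hw.integrable_flux hL.le hR)
    (hw.integrable_flux hL.le (by linarith)), ← he]
  congr 1
  ext p
  rw [gradDot_radial hζ hR₀ hc, mul_left_comm, Complex.im_ofReal_mul]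
  ring

/-- The `L²` norm on annuli is controlled by the radiation defect and the flux. -/
theorem lintegral_norm_sq_le (hw : IsTransmission kp km (Metric.closedBall 0 R₀) w) {κ : ℝ}
    (hκ : 0 < κ) (hkp : κ ≤ kp) (hkm : κ ≤ km) {R L : ℝ} (hL : 0 < L) (hR : R₀ + L < R) :
    ENNReal.ofReal (3 / 4 * L ^ 2 * κ) *
      ∫⁻ p in pt ⁻¹' annulus R (L / 2), ENNReal.ofReal (‖w (pt p)‖ ^ 2) ≤
    ENNReal.ofReal (L ^ 2 * κ⁻¹) *
      (∫⁻ p in pt ⁻¹' annulus R L, ENNReal.ofReal (‖defect kp km w (pt p)‖ ^ 2)) +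
      ENNReal.ofReal (2 * flux L R w) := by
  obtain ⟨B, hB0, hB1, hB2⟩ := hw.exists_bound Metric.isClosed_closedBall (isCompact_annulus R L)
    (annulus_subset_compl hR)
  set f : Plane → ℝ := fun x => (annulus R (L / 2)).indicator
    (fun x => (3 / 4 * L ^ 2 * κ) * ‖w x‖ ^ 2) x with hf
  set g : Plane → ℝ := fun x => (annulus R L).indicator
    (fun x => (L ^ 2 * κ⁻¹) * ‖defect kp km w x‖ ^ 2) x with hg
  have hwm : Measurable fun x => ‖w x‖ ^ 2 := hw.measurable.norm.pow_const 2
  have hdm : Measurable fun x => ‖defect kp km w x‖ ^ 2 :=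
    (measurable_defect kp km hw.measurable).norm.pow_const 2
  have hfi : Integrable fun p : ℝ × ℝ => f (pt p) := by
    refine integrable_comp_pt ((hwm.const_mul _).indicator
      (isClosed_annulus R (L / 2)).measurableSet).stronglyMeasurable (isCompact_annulus R (L / 2))
      (C := (3 / 4 * L ^ 2 * κ) * B ^ 2) (fun x hx => indicator_of_notMem hx _) fun x hx _ => ?_
    simp only [hf, indicator_of_mem hx]
    rw [Real.norm_of_nonneg (by positivity)]
    have := hB1 x (annulus_mono (by linarith) hx)
    gcongr
  have hgi : Integrable fun p : ℝ × ℝ => g (pt p) := by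
    refine integrable_comp_pt ((hdm.const_mul _).indicator
      (isClosed_annulus R L).measurableSet).stronglyMeasurable (isCompact_annulus R L)
      (C := (L ^ 2 * κ⁻¹) * (B + 1 * (|kp| + |km|) * B) ^ 2)
      (fun x hx => indicator_of_notMem hx _) fun x hx hxi => ?_
    simp only [hg, indicator_of_mem hx]
    rw [Real.norm_of_nonneg (by positivity)]
    have h1 := hB1 x hx
    have h2 := (norm_radialDeriv_le w x).trans (hB2 x hx hxi)
    have h3 : ‖defect kp km w x‖ ≤ B + 1 * (|kp| + |km|) * B := by
      refine (norm_sub_le _ _).trans ?_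
      rw [norm_mul, norm_mul, Complex.norm_I, Complex.norm_real, Real.norm_eq_abs]
      have := abs_waveNumber_le kp km x
      gcongr
    gcongr
  have hpt : ∀ x, f x ≤ g x + 2 * (bump L (‖x‖ - R) * (conj (w x) * radialDeriv w x).im) := by
    intro x
    have hk : κ ≤ waveNumber kp km x := by unfold waveNumber; split_ifs <;> assumption
    have hk0 := hκ.trans_le hk
    have h1 : κ * ‖w x‖ ^ 2 ≤ κ⁻¹ * ‖defect kp km w x‖ ^ 2 +
        2 * (conj (w x) * radialDeriv w x).im := by
      have h2 := mul_norm_sq_le (waveNumber kp km x) hk0 (radialDeriv w x) (w x)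
      have h3 : (waveNumber kp km x)⁻¹ * ‖defect kp km w x‖ ^ 2 ≤
          κ⁻¹ * ‖defect kp km w x‖ ^ 2 := by gcongr
      have h4 : κ * ‖w x‖ ^ 2 ≤ waveNumber kp km x * ‖w x‖ ^ 2 := by gcongr
      have h5 : defect kp km w x =
        radialDeriv w x - Complex.I * (waveNumber kp km x : ℂ) * w x := rfl
      rw [← h5] at h2
      linarith
    have hb0 := bump_nonneg L (‖x‖ - R)
    have h6 := mul_le_mul_of_nonneg_left h1 hb0
    have h7 : f x ≤ bump L (‖x‖ - R) * (κ * ‖w x‖ ^ 2) := by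
      by_cases hx : x ∈ annulus R (L / 2)
      · simp only [hf, indicator_of_mem hx]
        have := le_bump (L := L) hx
        rw [mul_assoc]
        gcongr
      · simp only [hf, indicator_of_notMem hx]
        positivity
    have h8 : bump L (‖x‖ - R) * (κ⁻¹ * ‖defect kp km w x‖ ^ 2) ≤ g x := by
      by_cases hx : x ∈ annulus R L
      · simp only [hg, indicator_of_mem hx]
        have := bump_le L (‖x‖ - R)
        rw [mul_assoc]
        gcongr
      · have h : L ≤ |‖x‖ - R| := (not_le.1 hx).le
        simp [hg, indicator_of_notMem hx, bump_eq_zero hL.le h]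
    linarith
  have hfl := hw.integrable_flux hL.le hR
  have hint : ∫ p, f (pt p) ≤ (∫ p, g (pt p)) + 2 * flux L R w := by
    have h1 := integral_mono hfi (hgi.add (hfl.const_mul 2)) fun p => hpt (pt p)
    rw [integral_add' hgi (hfl.const_mul 2), integral_const_mul] at h1
    exact h1
  have hlin := (ENNReal.ofReal_le_ofReal hint).trans ENNReal.ofReal_add_le
  rw [ofReal_integral_eq_lintegral_ofReal hfi
      (Eventually.of_forall fun p => indicator_nonneg (fun x _ => by positivity) _),
    ofReal_integral_eq_lintegral_ofReal hgi
      (Eventually.of_forall fun p => indicator_nonneg (fun x _ => by positivity) _)] at hlin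
  rwa [lintegral_indicator_annulus hwm R (L / 2) (by positivity),
    lintegral_indicator_annulus hdm R L (by positivity)] at hlin

end IsTransmission

/-! ### Truncation near the obstacle, and vanishing of the flux -/

/-- A `C¹` truncation that vanishes for `s ≤ ε` and tends to `1` as `ε → 0` for `s > 0`. -/
def trunc (ε s : ℝ) : ℝ := (max 0 (s - ε)) ^ 2 / (s + ε) ^ 2

/-- The derivative of `trunc ε`. -/
def truncDeriv (ε s : ℝ) : ℝ := 4 * ε * max 0 (s - ε) / (s + ε) ^ 3

section trunc
variable {ε s : ℝ}

lemma trunc_of_le (h : s ≤ ε) : trunc ε s = 0 := by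
  simp [trunc, max_eq_left (sub_nonpos.2 h)]

lemma truncDeriv_of_le (h : s ≤ ε) : truncDeriv ε s = 0 := by
  simp [truncDeriv, max_eq_left (sub_nonpos.2 h)]

lemma trunc_nonneg : 0 ≤ trunc ε s := by unfold trunc; positivity

lemma trunc_le_one (hε : 0 < ε) (hs : 0 ≤ s) : trunc ε s ≤ 1 := by
  unfold trunc
  rw [div_le_one (by positivity)]
  exact pow_le_pow_left₀ (le_max_left _ _) (max_le (by positivity) (by linarith)) 2

lemma truncDeriv_nonneg (hε : 0 < ε) (hs : 0 ≤ s) : 0 ≤ truncDeriv ε s := by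
  have := le_max_left 0 (s - ε)
  unfold truncDeriv; positivity

lemma truncDeriv_mul_le (hε : 0 < ε) (hs : 0 ≤ s) : truncDeriv ε s * s ≤ 4 := by
  have h0 := le_max_left 0 (s - ε)
  have h1 : max 0 (s - ε) ≤ s + ε := max_le (by positivity) (by linarith)
  unfold truncDeriv
  rw [div_mul_eq_mul_div, div_le_iff₀ (by positivity)]
  calc 4 * ε * max 0 (s - ε) * s ≤ 4 * (s + ε) * (s + ε) * (s + ε) := by
        gcongr <;> linarith
    _ = 4 * (s + ε) ^ 3 := by ring

lemma truncDeriv_le (hε : 0 < ε) (hs : 0 ≤ s) : truncDeriv ε s ≤ 4 / ε := by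
  rcases le_total s ε with h | h
  · rw [truncDeriv_of_le h]; positivity
  · rw [le_div_iff₀ hε]
    exact (mul_le_mul_of_nonneg_left h (truncDeriv_nonneg hε hs)).trans (truncDeriv_mul_le hε hs)

lemma hasDerivAt_trunc (hε : 0 < ε) (hs : 0 ≤ s) :
    HasDerivAt (trunc ε) (truncDeriv ε s) s := by
  have h1 : HasDerivAt (fun s => (max 0 (s - ε)) ^ 2) (2 * max 0 (s - ε)) s :=
    (hasDerivAt_max_zero_sq (s - ε)).comp_sub_const s ε
  have h2 : HasDerivAt (fun s => (s + ε) ^ 2) (2 * (s + ε)) s := by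
    simpa using ((hasDerivAt_id s).add_const ε).fun_pow 2
  have h3 := h1.div h2 (by positivity)
  refine h3.congr_deriv ?_
  have h4 : max 0 (s - ε) * max 0 (s - ε) = max 0 (s - ε) * (s - ε) := by
    rcases le_total (s - ε) 0 with h | h
    · simp [max_eq_left h]
    · simp [max_eq_right h]
  have h5 : s + ε ≠ 0 := by positivity
  unfold truncDeriv
  field_simp
  linear_combination (-2 : ℝ) * h4

lemma tendsto_trunc {ι : Type*} {l : Filter ι} {e : ι → ℝ} (he : Tendsto e l (𝓝 0)) (hs : 0 < s) :
    Tendsto (fun i => trunc (e i) s) l (𝓝 1) := by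
  have h : Tendsto (fun ε => trunc ε s) (𝓝 0) (𝓝 (trunc 0 s)) := by
    have : ContinuousAt (fun ε => trunc ε s) 0 := by
      unfold trunc
      exact ContinuousAt.div (by fun_prop) (by fun_prop) (by positivity)
    exact this
  have h1 : trunc 0 s = 1 := by
    unfold trunc
    rw [sub_zero, add_zero, max_eq_right hs.le, div_self (by positivity)]
  rw [h1] at h
  exact h.comp he

lemma tendsto_truncDeriv {ι : Type*} {l : Filter ι} {e : ι → ℝ} (he : Tendsto e l (𝓝 0))
    (hs : 0 < s) : Tendsto (fun i => truncDeriv (e i) s) l (𝓝 0) := by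
  have h : Tendsto (fun ε => truncDeriv ε s) (𝓝 0) (𝓝 (truncDeriv 0 s)) := by
    have : ContinuousAt (fun ε => truncDeriv ε s) 0 := by
      unfold truncDeriv
      exact ContinuousAt.div (by fun_prop) (by fun_prop) (by positivity)
    exact this
  have h1 : truncDeriv 0 s = 0 := by simp [truncDeriv]
  rw [h1] at h
  exact h.comp he

end trunc

/-- The contraction of `Re (conj w ∇w)` with `conj w ∇w`. -/
def truncTerm (w : Plane → ℂ) (x : Plane) : ℂ :=
  ((conj (w x) * fderiv ℝ w x e1).re : ℂ) * (conj (w x) * fderiv ℝ w x e1) +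
    ((conj (w x) * fderiv ℝ w x nu).re : ℂ) * (conj (w x) * fderiv ℝ w x nu)

lemma truncTerm_re_nonneg (w : Plane → ℂ) (x : Plane) : 0 ≤ (truncTerm w x).re := by
  unfold truncTerm
  rw [Complex.add_re, Complex.re_ofReal_mul, Complex.re_ofReal_mul]
  exact add_nonneg (mul_self_nonneg _) (mul_self_nonneg _)

lemma norm_truncTerm_le (w : Plane → ℂ) (x : Plane) :
    ‖truncTerm w x‖ ≤ ‖w x‖ ^ 2 * gradSq w x := by
  have h : ∀ z : ℂ, ‖(z.re : ℂ) * z‖ ≤ ‖z‖ ^ 2 := fun z => by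
    rw [norm_mul, Complex.norm_real, Real.norm_eq_abs, sq]
    exact mul_le_mul_of_nonneg_right (Complex.abs_re_le_norm z) (norm_nonneg z)
  refine (norm_add_le _ _).trans ((add_le_add (h _) (h _)).trans (le_of_eq ?_))
  rw [norm_mul, norm_mul, RCLike.norm_conj, gradSq]
  ring

namespace IsTransmission

variable {kp km R₀ : ℝ} {K : Set Plane} {w : Plane → ℂ}

/-- A solution that is continuous on the plane and vanishes on `K` carries no flux. No regularity
of the boundary of `K` is needed: `χ(|x|) trunc ε (|w|²) conj w` is an admissible test function, the
real part of the energy identity bounds `∫ χ |∇w|²` over `{w ≠ 0}`, and this makes the error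
term in the imaginary part tend to zero with `ε`. -/
theorem flux_eq_zero (hw : IsTransmission kp km K w) (hK : IsClosed K) (hR₀ : 0 < R₀)
    (hKR : K ⊆ Metric.closedBall 0 R₀) (hwc : Continuous w) (hwK : ∀ x ∈ K, w x = 0) {R L : ℝ}
    (hL : 0 < L) (hR : R₀ + L < R) : flux L R w = 0 := by
  have hχ : ∀ t, HasDerivAt (fun t => step L L - step L (t - R)) (-bump L (t - R)) t := fun t =>
    ((hasDerivAt_step L _).comp_sub_const t R).const_sub _
  set χ : ℝ → ℝ := fun t => step L L - step L (t - R) with hχdef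
  have hχc : ∀ t < R₀, χ t = χ 0 := fun t ht => by
    simp only [hχdef]
    rw [step_of_le (s := t - R) hL.le (by linarith), step_of_le (s := 0 - R) hL.le (by linarith)]
  have hχ0 : ∀ t, R + L ≤ t → χ t = 0 := fun t ht => by
    simp only [hχdef]
    rw [step_of_ge (s := t - R) hL.le (by linarith), sub_self]
  have hχn : ∀ t, 0 ≤ χ t := fun t => sub_nonneg.2 (step_le hL.le _)
  have hχm : ∀ t, χ t ≤ step L L := fun t => sub_le_self _ (step_nonneg hL.le _)
  have hχr := continuous_radial hχ
  have hd : ∀ x ∉ K, x ∉ interface → DifferentiableAt ℝ w x := fun x h h' =>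
    hw.differentiableAt hK h h'
  -- the weights and their derivatives
  set a : ℝ → Plane → ℝ := fun ε x => χ ‖x‖ * trunc ε (‖w x‖ ^ 2) with ha
  have hsq0 : ∀ x, 0 ≤ ‖w x‖ ^ 2 := fun x => sq_nonneg _
  have hac : ∀ ε, 0 < ε → Continuous (a ε) := by
    intro ε hε
    refine hχr.mul ?_
    rw [continuous_iff_continuousAt]
    intro x
    exact (hasDerivAt_trunc hε (hsq0 x)).continuousAt.comp (f := fun x => ‖w x‖ ^ 2)
      (by fun_prop)
  have hasup : ∀ ε, tsupport (a ε) ⊆ Metric.closedBall 0 (R + L) ∩ {x | ε ≤ ‖w x‖ ^ 2} := by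
    intro ε
    refine closure_minimal (fun x hx => ⟨?_, ?_⟩) (Metric.isClosed_closedBall.inter
      (isClosed_le continuous_const (by fun_prop)))
    · rw [mem_closedBall_zero_iff]
      by_contra h
      exact hx (by simp [ha, hχ0 _ (not_le.1 h).le])
    · by_contra h
      exact hx (by simp [ha, trunc_of_le (le_of_lt (not_le.1 h))])
  have hacs : ∀ ε, HasCompactSupport (a ε) := fun ε =>
    (isCompact_closedBall (0 : Plane) (R + L)).of_isClosed_subset (isClosed_tsupport _)
      ((hasup ε).trans inter_subset_left)
  have hasub : ∀ ε, 0 < ε → tsupport (a ε) ⊆ Kᶜ := fun ε hε x hx hxK => by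
    have : ε ≤ ‖w x‖ ^ 2 := (hasup ε hx).2
    rw [hwK x hxK] at this
    norm_num at this
    linarith
  have haz : ∀ ε, 0 < ε → ∀ x ∈ K, a ε =ᶠ[𝓝 x] fun _ => 0 := by
    intro ε hε x hx
    have : x ∉ tsupport (a ε) := fun h => hasub ε hε h hx
    exact notMem_tsupport_iff_eventuallyEq.1 this
  have hafd : ∀ ε, 0 < ε → ∀ x ∉ K, x ∉ interface → HasFDerivAt (a ε)
      ((χ ‖x‖) • (truncDeriv ε (‖w x‖ ^ 2) • (2 • (innerSL ℝ (w x)).comp (fderiv ℝ w x))) +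
        trunc ε (‖w x‖ ^ 2) • ((-bump L (‖x‖ - R)) • ‖x‖⁻¹ • innerSL ℝ x)) x := by
    intro ε hε x hxK hxi
    have h : HasFDerivAt (trunc ε ∘ fun x => ‖w x‖ ^ 2) _ x :=
      (hasDerivAt_trunc hε (hsq0 x)).comp_hasFDerivAt x (hd x hxK hxi).hasFDerivAt.norm_sq
    exact (hasFDerivAt_radial hχ hR₀ hχc x).mul h
  have had : ∀ ε, 0 < ε → ∀ x ∉ interface, DifferentiableAt ℝ (a ε) x := by
    intro ε hε x hxi
    by_cases hxK : x ∈ K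
    · exact (differentiableAt_const 0).congr_of_eventuallyEq (haz ε hε x hxK)
    · exact (hafd ε hε x hxK hxi).differentiableAt
  have hdot : ∀ ε, 0 < ε → ∀ x ∉ interface, conj (w x) * gradDot w (a ε) x =
      (-(trunc ε (‖w x‖ ^ 2) * bump L (‖x‖ - R)) : ℝ) * (conj (w x) * radialDeriv w x) +
        (2 * χ ‖x‖ * truncDeriv ε (‖w x‖ ^ 2) : ℝ) * truncTerm w x := by
    intro ε hε x hxi
    by_cases hxK : x ∈ K
    · simp [hwK x hxK, truncTerm]
    · have h1 := gradDot_radial hχ hR₀ hχc w x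
      have hre : ∀ v, (inner ℝ (w x) (fderiv ℝ w x v) : ℝ) = (conj (w x) * fderiv ℝ w x v).re :=
        fun v => by rw [Complex.inner, mul_comm]
      rw [gradDot, (hasFDerivAt_radial hχ hR₀ hχc x).fderiv] at h1
      rw [gradDot, (hafd ε hε x hxK hxi).fderiv]
      simp only [_root_.add_apply, _root_.smul_apply, ContinuousLinearMap.comp_apply,
        innerSL_apply_apply, smul_eq_mul, hre, truncTerm] at h1 ⊢
      push_cast at h1 ⊢
      linear_combination (trunc ε (‖w x‖ ^ 2) : ℂ) * conj (w x) * h1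
  have hbound : ∀ ε, 0 < ε → ∃ C, ∀ x ∉ interface, ‖fderiv ℝ (a ε) x‖ ≤ C := by
    intro ε hε
    obtain ⟨B, hB0, hB1, hB2⟩ := hw.exists_bound hK (hacs ε).isCompact (hasub ε hε)
    refine ⟨step L L * (4 / ε * (2 * (B * B))) + L ^ 2, fun x hxi => ?_⟩
    have hm0 : 0 ≤ step L L := step_nonneg hL.le L
    by_cases hx : x ∈ tsupport (a ε)
    · have h1 := hB1 x hx
      have h2 := hB2 x hx hxi
      rw [(hafd ε hε x (hasub ε hε hx) hxi).fderiv]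
      refine (norm_add_le _ _).trans (add_le_add ?_ ?_)
      · rw [norm_smul, norm_smul, Real.norm_of_nonneg (hχn _),
          Real.norm_of_nonneg (truncDeriv_nonneg hε (hsq0 x))]
        have h3 : ‖(2 • (innerSL ℝ (w x)).comp (fderiv ℝ w x) : Plane →L[ℝ] ℝ)‖ ≤ 2 * (B * B) := by
          rw [two_smul, two_mul]
          have : ‖(innerSL ℝ (w x)).comp (fderiv ℝ w x)‖ ≤ B * B := by
            refine (ContinuousLinearMap.opNorm_comp_le _ _).trans ?_
            rw [innerSL_apply_norm]
            gcongr
          exact (norm_add_le _ _).trans (add_le_add this this)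
        exact mul_le_mul (hχm _) (mul_le_mul (truncDeriv_le hε (hsq0 x)) h3 (norm_nonneg _)
          (by positivity)) (mul_nonneg (truncDeriv_nonneg hε (hsq0 x)) (norm_nonneg _)) hm0
      · rw [norm_smul, Real.norm_of_nonneg trunc_nonneg]
        have h4 := norm_fderiv_radial_le hχ hR₀ hχc x
        rw [(hasFDerivAt_radial hχ hR₀ hχc x).fderiv, abs_neg,
          abs_of_nonneg (bump_nonneg _ _)] at h4
        calc _ ≤ 1 * bump L (‖x‖ - R) :=
              mul_le_mul (trunc_le_one hε (hsq0 x)) h4 (norm_nonneg _) zero_le_one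
          _ ≤ L ^ 2 := by rw [one_mul]; exact bump_le _ _
    · rw [fderiv_of_notMem_tsupport ℝ hx, norm_zero]
      positivity
  -- a majorant that does not depend on the truncation
  set h₁ : Plane → ℝ := fun x => bump L (‖x‖ - R) * (‖w x‖ * ‖radialDeriv w x‖) with hh₁
  set h₂ : Plane → ℝ := fun x => waveNumber kp km x ^ 2 * χ ‖x‖ * ‖w x‖ ^ 2 with hh₂
  have hh₁0 : ∀ x, 0 ≤ h₁ x := fun x => mul_nonneg (bump_nonneg _ _) (by positivity)
  have hh₂0 : ∀ x, 0 ≤ h₂ x := fun x => mul_nonneg (mul_nonneg (sq_nonneg _) (hχn _)) (sq_nonneg _)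
  have hh₁i : Integrable fun p : ℝ × ℝ => h₁ (pt p) := by
    obtain ⟨B, hB0, hB1, hB2⟩ := hw.exists_bound hK (isCompact_annulus R L)
      ((annulus_subset_compl hR).trans (compl_subset_compl.2 hKR))
    refine integrable_comp_pt (((continuous_bump L).measurable.comp
      (measurable_norm.sub_const R)).mul (hw.measurable.norm.mul
        (measurable_radialDeriv w).norm)).stronglyMeasurable (isCompact_annulus R L)
      (C := L ^ 2 * (B * B)) (fun x hx => ?_) fun x hx hxi => ?_
    · have h : L ≤ |‖x‖ - R| := (not_le.1 hx).le
      simp [hh₁, bump_eq_zero hL.le h]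
    · rw [Real.norm_of_nonneg (hh₁0 x)]
      have h1 := bump_le L (‖x‖ - R)
      have h3 := hB1 x hx
      have h4 := (norm_radialDeriv_le w x).trans (hB2 x hx hxi)
      simp only [hh₁]
      gcongr
  have hh₂i : Integrable fun p : ℝ × ℝ => h₂ (pt p) := by
    obtain ⟨B, hB⟩ := (isCompact_closedBall (0 : Plane) (R + L)).exists_bound_of_continuousOn
      hwc.continuousOn
    refine integrable_comp_pt ((((measurable_waveNumber kp km).pow_const 2).mul
      hχr.measurable).mul (hw.measurable.norm.pow_const 2)).stronglyMeasurable
      (isCompact_closedBall (0 : Plane) (R + L))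
      (C := (|kp| + |km|) ^ 2 * step L L * B ^ 2) (fun x hx => ?_) fun x hx _ => ?_
    · rw [mem_closedBall_zero_iff] at hx
      simp [hh₂, hχ0 _ (not_le.1 hx).le]
    · rw [Real.norm_of_nonneg (hh₂0 x)]
      have h1 := hB x hx
      have h2 := hχm ‖x‖
      have h3 := hχn ‖x‖
      have h5 := step_nonneg hL.le L
      have h4 : waveNumber kp km x ^ 2 ≤ (|kp| + |km|) ^ 2 := by
        rw [← sq_abs]; have := abs_waveNumber_le kp km x; gcongr
      simp only [hh₂]
      gcongr
  set M : ℝ := ∫ p : ℝ × ℝ, (h₁ (pt p) + h₂ (pt p)) with hM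
  have henergy : ∀ ε, 0 < ε →
      ∫⁻ p : ℝ × ℝ, ENNReal.ofReal (a ε (pt p) * gradSq w (pt p)) ≤ ENNReal.ofReal M := by
    intro ε hε
    obtain ⟨C, hC⟩ := hbound ε hε
    obtain ⟨hei, he0⟩ := hw.integral_energy_re hK (hac ε hε) (hacs ε) (hasub ε hε) (had ε hε) hC
    have hle : ∀ x ∉ interface, a ε x * gradSq w x ≤ (a ε x * gradSq w x +
        (conj (w x) * gradDot w (a ε) x).re - waveNumber kp km x ^ 2 * a ε x * ‖w x‖ ^ 2) +
          (h₁ x + h₂ x) := by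
      intro x hxi
      rw [hdot ε hε x hxi, Complex.add_re, Complex.re_ofReal_mul, Complex.re_ofReal_mul]
      have e1 : 0 ≤ 2 * χ ‖x‖ * truncDeriv ε (‖w x‖ ^ 2) * (truncTerm w x).re :=
        mul_nonneg (mul_nonneg (mul_nonneg zero_le_two (hχn _)) (truncDeriv_nonneg hε (hsq0 x)))
          (truncTerm_re_nonneg w x)
      have e2 : waveNumber kp km x ^ 2 * a ε x * ‖w x‖ ^ 2 ≤ h₂ x := by
        have : a ε x ≤ χ ‖x‖ := mul_le_of_le_one_right (hχn _) (trunc_le_one hε (hsq0 x))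
        simp only [hh₂]
        gcongr
      have e3 : -h₁ x ≤ -(trunc ε (‖w x‖ ^ 2) * bump L (‖x‖ - R)) *
          (conj (w x) * radialDeriv w x).re := by
        rw [neg_mul, neg_le_neg_iff, hh₁]
        refine mul_le_mul_of_nonneg (mul_le_of_le_one_left (bump_nonneg _ _)
          (trunc_le_one hε (hsq0 x))) ?_ (mul_nonneg trunc_nonneg (bump_nonneg _ _)) (by positivity)
        refine (le_abs_self _).trans ((Complex.abs_re_le_norm _).trans ?_)
        rw [norm_mul, RCLike.norm_conj]
      linarith
    have h0 : ∀ x, 0 ≤ a ε x * gradSq w x := fun x =>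
      mul_nonneg (mul_nonneg (hχn _) trunc_nonneg) (gradSq_nonneg w x)
    refine (lintegral_mono_ae ?_).trans (le_of_eq (ofReal_integral_eq_lintegral_ofReal
      (hei.add (hh₁i.add hh₂i)) ?_).symm) |>.trans (le_of_eq ?_)
    · filter_upwards [ae_notMem_interface] with p hp using ENNReal.ofReal_le_ofReal (hle _ hp)
    · filter_upwards [ae_notMem_interface] with p hp using (h0 _).trans (hle _ hp)
    · rw [integral_add' hei (hh₁i.add hh₂i), he0, zero_add]
      rfl
  set e : ℕ → ℝ := fun n => 1 / ((n : ℝ) + 1) with he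
  have he0 : ∀ n, 0 < e n := fun n => by simp only [he]; positivity
  have hel : Tendsto e atTop (𝓝 0) := tendsto_one_div_add_atTop_nhds_zero_nat
  set N : Plane → ℝ := fun x => if w x = 0 then 0 else χ ‖x‖ * gradSq w x with hN
  have hN0 : ∀ x, 0 ≤ N x := fun x => by
    simp only [hN]; split_ifs
    exacts [le_rfl, mul_nonneg (hχn _) (gradSq_nonneg w x)]
  have hNm : Measurable N := Measurable.ite (hw.measurable (measurableSet_singleton 0))
    measurable_const (hχr.measurable.mul (measurable_gradSq w))
  have hNi : Integrable fun p : ℝ × ℝ => N (pt p) := by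
    refine ⟨(hNm.comp pt.continuous.measurable).aestronglyMeasurable, ?_⟩
    rw [hasFiniteIntegral_iff_ofReal (Eventually.of_forall fun p => hN0 _)]
    have hfat : ∫⁻ p : ℝ × ℝ, ENNReal.ofReal (N (pt p)) ≤ ENNReal.ofReal M := by
      calc ∫⁻ p : ℝ × ℝ, ENNReal.ofReal (N (pt p))
          = ∫⁻ p : ℝ × ℝ, liminf (fun n => ENNReal.ofReal (a (e n) (pt p) * gradSq w (pt p)))
              atTop := by
            congr 1
            ext p
            refine (Tendsto.liminf_eq (ENNReal.tendsto_ofReal ?_)).symm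
            simp only [hN, ha]
            split_ifs with h0
            · simp [h0, trunc_of_le (he0 _).le]
            · have := tendsto_trunc hel (s := ‖w (pt p)‖ ^ 2) (by positivity)
              have := (this.const_mul (χ ‖pt p‖)).mul_const (gradSq w (pt p))
              rwa [mul_one] at this
        _ ≤ liminf (fun n => ∫⁻ p : ℝ × ℝ, ENNReal.ofReal (a (e n) (pt p) * gradSq w (pt p)))
              atTop := lintegral_liminf_le fun n =>
            (((hac _ (he0 n)).measurable.mul (measurable_gradSq w)).comp
              pt.continuous.measurable).ennreal_ofReal
        _ ≤ liminf (fun _ : ℕ => ENNReal.ofReal M) atTop :=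
            liminf_le_liminf (Eventually.of_forall fun n => henergy _ (he0 n))
        _ = ENNReal.ofReal M := liminf_const _
    exact hfat.trans_lt ENNReal.ofReal_lt_top
  -- passage to the limit in the imaginary part
  have hlim : Tendsto (fun n => ∫ p : ℝ × ℝ, (conj (w (pt p)) * gradDot w (a (e n)) (pt p)).im)
      atTop (𝓝 (∫ p : ℝ × ℝ,
        -(bump L (‖pt p‖ - R) * (conj (w (pt p)) * radialDeriv w (pt p)).im))) := by
    refine tendsto_integral_of_dominated_convergence (fun p => h₁ (pt p) + 8 * N (pt p))
      (fun n => ?_) (hh₁i.add (hNi.const_mul 8)) (fun n => ?_) ?_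
    · exact ((Complex.measurable_im.comp ((Complex.continuous_conj.measurable.comp
        hw.measurable).mul (measurable_gradDot w _))).comp
          pt.continuous.measurable).aestronglyMeasurable
    · filter_upwards [ae_notMem_interface] with p hp
      rw [hdot _ (he0 n) _ hp, Complex.add_im, Complex.im_ofReal_mul, Complex.im_ofReal_mul]
      refine (norm_add_le _ _).trans (add_le_add ?_ ?_)
      · rw [norm_mul, norm_neg, Real.norm_of_nonneg (mul_nonneg trunc_nonneg (bump_nonneg _ _)),
          Real.norm_eq_abs]
        refine mul_le_mul (mul_le_of_le_one_left (bump_nonneg _ _)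
          (trunc_le_one (he0 n) (hsq0 _))) ?_ (abs_nonneg _) (bump_nonneg _ _)
        refine (Complex.abs_im_le_norm _).trans ?_
        rw [norm_mul, RCLike.norm_conj]
      · have e1 := (Complex.abs_im_le_norm _).trans (norm_truncTerm_le w (pt p))
        have e2 := truncDeriv_mul_le (he0 n) (hsq0 (pt p))
        have e3 := truncDeriv_nonneg (he0 n) (hsq0 (pt p))
        have e4 := hχn ‖pt p‖
        have e5 := gradSq_nonneg w (pt p)
        rw [norm_mul, Real.norm_of_nonneg (by positivity), Real.norm_eq_abs]
        by_cases h0 : w (pt p) = 0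
        · rw [h0, norm_zero, zero_pow two_ne_zero, truncDeriv_of_le (he0 n).le]
          simp [hN, h0]
        · simp only [hN, h0, if_false]
          calc _ ≤ 2 * χ ‖pt p‖ * truncDeriv (e n) (‖w (pt p)‖ ^ 2) *
                (‖w (pt p)‖ ^ 2 * gradSq w (pt p)) := by gcongr
            _ = 2 * χ ‖pt p‖ * (truncDeriv (e n) (‖w (pt p)‖ ^ 2) * ‖w (pt p)‖ ^ 2) *
                gradSq w (pt p) := by ring
            _ ≤ 2 * χ ‖pt p‖ * 4 * gradSq w (pt p) := by gcongr
            _ = _ := by ring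
    · filter_upwards [ae_notMem_interface] with p hp
      by_cases h0 : w (pt p) = 0
      · simp [h0]
      · have e1 := tendsto_trunc hel (s := ‖w (pt p)‖ ^ 2) (by positivity)
        have e2 := tendsto_truncDeriv hel (s := ‖w (pt p)‖ ^ 2) (by positivity)
        have e3 := (((e1.mul_const (bump L (‖pt p‖ - R))).neg).mul_const
          (conj (w (pt p)) * radialDeriv w (pt p)).im).add
          ((e2.const_mul (2 * χ ‖pt p‖)).mul_const (truncTerm w (pt p)).im)
        have e4 : -(1 * bump L (‖pt p‖ - R)) * (conj (w (pt p)) * radialDeriv w (pt p)).im +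
            2 * χ ‖pt p‖ * 0 * (truncTerm w (pt p)).im =
            -(bump L (‖pt p‖ - R) * (conj (w (pt p)) * radialDeriv w (pt p)).im) := by ring
        rw [e4] at e3
        refine e3.congr fun n => ?_
        rw [hdot _ (he0 n) _ hp, Complex.add_im, Complex.im_ofReal_mul, Complex.im_ofReal_mul]
  have hzero : ∀ n, ∫ p : ℝ × ℝ, (conj (w (pt p)) * gradDot w (a (e n)) (pt p)).im = 0 := by
    intro n
    obtain ⟨C, hC⟩ := hbound _ (he0 n)
    exact (hw.integral_energy_im hK (hac _ (he0 n)) (hacs _) (hasub _ (he0 n)) (had _ (he0 n)) hC).2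
  simp only [hzero] at hlim
  have := tendsto_nhds_unique hlim tendsto_const_nhds
  rw [integral_neg, neg_eq_zero] at this
  exact this

end IsTransmission

/-! ### Polar coordinates and the radiation condition -/

lemma norm_dir (θ : ℝ) : ‖dir θ‖ = 1 := by
  simp [dir, EuclideanSpace.norm_eq, Fin.sum_univ_two]

lemma norm_smul_dir {r : ℝ} (hr : 0 ≤ r) (θ : ℝ) : ‖r • dir θ‖ = r := by
  rw [norm_smul, norm_dir, mul_one, Real.norm_of_nonneg hr]

lemma continuous_dir : Continuous dir := by unfold dir; fun_prop

lemma pt_polarCoord_symm (q : ℝ × ℝ) : pt (polarCoord.symm q) = q.1 • dir q.2 := by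
  ext i; fin_cases i <;> simp [dir]

lemma lintegral_polar {f : Plane → ENNReal} (hf : Measurable f) :
    ∫⁻ p : ℝ × ℝ, f (pt p) =
      ∫⁻ r in Ioi 0, ∫⁻ θ in Ioo (-Real.pi) Real.pi, ENNReal.ofReal r * f (r • dir θ) := by
  have hc : Continuous fun q : ℝ × ℝ => q.1 • dir q.2 :=
    continuous_fst.smul (continuous_dir.comp continuous_snd)
  rw [← lintegral_comp_polarCoord_symm (fun p => f (pt p)), polarCoord_target,
    Measure.volume_eq_prod, ← Measure.prod_restrict, lintegral_prod]
  · simp only [pt_polarCoord_symm, smul_eq_mul]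
  · simp only [pt_polarCoord_symm, smul_eq_mul]
    exact (measurable_fst.ennreal_ofReal.mul (hf.comp hc.measurable)).aemeasurable

lemma lintegral_annulus {f : Plane → ENNReal} (hf : Measurable f) {R L : ℝ} (hR : L < R) :
    ∫⁻ p in pt ⁻¹' annulus R L, f (pt p) = ∫⁻ r in Icc (R - L) (R + L),
      ∫⁻ θ in Ioo (-Real.pi) Real.pi, ENNReal.ofReal r * f (r • dir θ) := by
  rw [← lintegral_indicator (measurableSet_annulus R L)]
  have h1 : (pt ⁻¹' annulus R L).indicator (fun p => f (pt p)) =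
      fun p => (annulus R L).indicator f (pt p) := by
    ext p; rfl
  rw [h1, lintegral_polar (hf.indicator (isClosed_annulus R L).measurableSet),
    ← lintegral_indicator measurableSet_Ioi, ← lintegral_indicator measurableSet_Icc]
  congr 1
  ext r
  by_cases hr : r ∈ Icc (R - L) (R + L)
  · have hr0 : 0 < r := by linarith [hr.1]
    rw [indicator_of_mem hr, indicator_of_mem (mem_Ioi.2 hr0)]
    congr 1
    ext θ
    rw [indicator_of_mem]
    show |‖r • dir θ‖ - R| ≤ L
    rw [norm_smul_dir hr0.le, abs_le]
    constructor <;> linarith [hr.1, hr.2]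
  · rw [indicator_of_notMem hr]
    by_cases hr0 : 0 < r
    · rw [indicator_of_mem (mem_Ioi.2 hr0)]
      have : ∀ θ, (annulus R L).indicator f (r • dir θ) = 0 := fun θ => by
        refine indicator_of_notMem (fun h => hr ?_) _
        have h : |‖r • dir θ‖ - R| ≤ L := h
        rw [norm_smul_dir hr0.le, abs_le] at h
        constructor <;> linarith [h.1, h.2]
      simp [this]
    · rw [indicator_of_notMem (show r ∉ Ioi 0 from hr0)]

/-- The radiation integral as a lower Lebesgue integral. -/
def radLintegral (kp km : ℝ) (w : Plane → ℂ) (r : ℝ) : ENNReal :=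
  ∫⁻ θ in Ioo (-Real.pi) Real.pi,
    ENNReal.ofReal r * ENNReal.ofReal (‖defect kp km w (r • dir θ)‖ ^ 2)

lemma inv_norm_smul_smul_dir {r : ℝ} (hr : 0 < r) (θ : ℝ) :
    ‖r • dir θ‖⁻¹ • (r • dir θ) = dir θ := by
  rw [norm_smul_dir hr.le, smul_smul, inv_mul_cancel₀ hr.ne', one_smul]

lemma radiationIntegral_eq (kp km : ℝ) (w : Plane → ℂ) {r : ℝ} (hr : 0 < r) :
    radiationIntegral kp km w r =
      ∫ θ in Ioo (-Real.pi) Real.pi, r * ‖defect kp km w (r • dir θ)‖ ^ 2 := by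
  have hper : Function.Periodic (fun θ => ‖fderiv ℝ w (r • dir θ) (dir θ)
        - Complex.I * (waveNumber kp km (r • dir θ) : ℂ) * w (r • dir θ)‖ ^ 2 * r)
      (2 * Real.pi) := by
    intro θ
    have : dir (θ + 2 * Real.pi) = dir θ := by simp [dir]
    simp only [this]
  have h := hper.intervalIntegral_add_eq 0 (-Real.pi)
  rw [zero_add, show -Real.pi + 2 * Real.pi = Real.pi by ring,
    intervalIntegral.integral_of_le (by linarith [Real.pi_pos]), integral_Ioc_eq_integral_Ioo,
    intervalIntegral.integral_of_le (by linarith [Real.pi_pos]), integral_Ioc_eq_integral_Ioo] at h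
  rw [radiationIntegral, intervalIntegral.integral_of_le (by linarith [Real.pi_pos]),
    integral_Ioc_eq_integral_Ioo, h]
  congr 1
  ext θ
  rw [defect, radialDeriv, inv_norm_smul_smul_dir hr, mul_comm]

lemma ofReal_radiationIntegral_le (kp km : ℝ) (w : Plane → ℂ) {r : ℝ} (hr : 0 < r) :
    ENNReal.ofReal (radiationIntegral kp km w r) ≤ radLintegral kp km w r := by
  rw [radiationIntegral_eq kp km w hr]
  have h0 : 0 ≤ ∫ θ in Ioo (-Real.pi) Real.pi, r * ‖defect kp km w (r • dir θ)‖ ^ 2 :=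
    integral_nonneg fun θ => by positivity
  rw [← Real.enorm_of_nonneg h0]
  refine (enorm_integral_le_lintegral_enorm _).trans (le_of_eq ?_)
  unfold radLintegral
  congr 1
  ext θ
  rw [Real.enorm_of_nonneg (by positivity), ENNReal.ofReal_mul hr.le]

lemma ae_smul_dir_notMem_interface {r : ℝ} (hr : 0 < r) :
    ∀ᵐ θ ∂volume.restrict (Ioo (-Real.pi) Real.pi), r • dir θ ∉ interface := by
  rw [ae_restrict_iff' measurableSet_Ioo]
  have : ∀ᵐ θ : ℝ, θ ≠ 0 := by simp [ae_iff]
  filter_upwards [this] with θ h0 hθ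
  have : Real.sin θ ≠ 0 := by
    rcases lt_or_gt_of_ne h0 with h | h
    · exact (Real.sin_neg_of_neg_of_neg_pi_lt h hθ.1).ne
    · exact (Real.sin_pos_of_pos_of_lt_pi h hθ.2).ne'
  simp [interface, dir, hr.ne', this]

lemma smul_dir_notMem_closedBall {r R₀ : ℝ} (h0 : 0 < R₀) (hr : R₀ < r) (θ : ℝ) :
    r • dir θ ∉ Metric.closedBall (0 : Plane) R₀ := by
  rw [mem_closedBall_zero_iff, norm_smul_dir (h0.trans hr).le]
  exact not_le.2 hr

lemma radiationIntegral_congr {kp km R₀ r : ℝ} {K : Set Plane} (hK : IsClosed K) (hR₀ : 0 < R₀)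
    (hKR : K ⊆ Metric.closedBall 0 R₀) {u w : Plane → ℂ} (h : ∀ x ∉ K, u x = w x) (hr : R₀ < r) :
    radiationIntegral kp km u r = radiationIntegral kp km w r := by
  unfold radiationIntegral
  congr 1
  ext θ
  have hx : r • dir θ ∉ K := fun hx => smul_dir_notMem_closedBall hR₀ hr θ (hKR hx)
  have he : u =ᶠ[𝓝 (r • dir θ)] w := by
    filter_upwards [hK.isOpen_compl.mem_nhds hx] with y hy using h y hy
  rw [he.fderiv_eq, h _ hx]

/-- Boundedness of the integrals of `f` over annuli of fixed width. -/
def AnnBdd (f : Plane → ℝ) : Prop :=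
  ∀ L : ℝ, 0 < L → ∃ M : ENNReal, M ≠ ⊤ ∧
    ∀ᶠ R in atTop, ∫⁻ p in pt ⁻¹' annulus R L, ENNReal.ofReal (f (pt p)) ≤ M

/-- Decay of the integrals of `f` over annuli of fixed width. -/
def AnnVanish (f : Plane → ℝ) : Prop :=
  ∀ L : ℝ, 0 < L →
    Tendsto (fun R => ∫⁻ p in pt ⁻¹' annulus R L, ENNReal.ofReal (f (pt p))) atTop (𝓝 0)

lemma AnnBdd.of_le {f g : Plane → ℝ} {C : ENNReal} (hC : C ≠ ⊤) (hg : AnnBdd g)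
    (h : ∀ L, 0 < L → ∃ L', 0 < L' ∧ ∀ᶠ R in atTop,
      ∫⁻ p in pt ⁻¹' annulus R L, ENNReal.ofReal (f (pt p)) ≤
        C * ∫⁻ p in pt ⁻¹' annulus R L', ENNReal.ofReal (g (pt p))) : AnnBdd f := by
  intro L hL
  obtain ⟨L', hL', h'⟩ := h L hL
  obtain ⟨M, hM, hM'⟩ := hg L' hL'
  refine ⟨C * M, ENNReal.mul_ne_top hC hM, ?_⟩
  filter_upwards [h', hM'] with R h1 h2
  exact h1.trans (by gcongr)

/-- Translation by `z` maps an annulus into the one that is wider by `|z|` on both sides. -/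
lemma lintegral_annulus_comp_sub_le {f : Plane → ENNReal} (z R L : ℝ) :
    ∫⁻ p in pt ⁻¹' annulus R L, f (pt p - horiz z) ≤
      ∫⁻ p in pt ⁻¹' annulus R (L + |z|), f (pt p) := by
  rw [← lintegral_indicator (measurableSet_annulus _ _),
    ← lintegral_indicator (measurableSet_annulus _ _),
    ← lintegral_sub_right_eq_self ((pt ⁻¹' annulus R (L + |z|)).indicator fun p => f (pt p))
      ((z, 0) : ℝ × ℝ)]
  refine lintegral_mono fun p => ?_
  have hp : pt (p - (z, 0)) = pt p - horiz z := by
    ext i; fin_cases i <;> simp [horiz]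
  by_cases h : p ∈ pt ⁻¹' annulus R L
  · rw [indicator_of_mem h, indicator_of_mem, hp]
    have h1 : |‖pt p‖ - R| ≤ L := h
    show |‖pt (p - (z, 0))‖ - R| ≤ L + |z|
    rw [hp]
    have h2 : |‖pt p - horiz z‖ - ‖pt p‖| ≤ |z| := by
      refine (abs_norm_sub_norm_le _ _).trans (le_of_eq ?_)
      rw [sub_sub_cancel_left, norm_neg, norm_horiz]
    rw [abs_le] at *
    constructor <;> linarith [h1.1, h1.2, h2.1, h2.2]
  · rw [indicator_of_notMem h]
    exact zero_le

lemma AnnBdd.comp_sub_horiz {f : Plane → ℝ} (hf : AnnBdd f) (z : ℝ) :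
    AnnBdd fun x => f (x - horiz z) :=
  hf.of_le ENNReal.one_ne_top fun L hL => ⟨L + |z|, by positivity, Eventually.of_forall fun R => by
    rw [one_mul]
    exact lintegral_annulus_comp_sub_le (f := fun x => ENNReal.ofReal (f x)) z R L⟩

lemma measurable_ofReal_norm_defect_sq (kp km : ℝ) {w : Plane → ℂ} (hw : Measurable w) :
    Measurable fun x => ENNReal.ofReal (‖defect kp km w x‖ ^ 2) :=
  ((measurable_defect kp km hw).norm.pow_const 2).ennreal_ofReal

/-- The derivative of `defect` in the radial direction. -/
def defectDeriv (kp km : ℝ) (w : Plane → ℂ) (x : Plane) : ℂ :=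
  fderiv ℝ (fderiv ℝ w) x (‖x‖⁻¹ • x) (‖x‖⁻¹ • x) -
    Complex.I * (waveNumber kp km x : ℂ) * radialDeriv w x

/-- A one-dimensional trace inequality. -/
lemma norm_sq_le_integral {f f' : ℝ → ℂ} {R : ℝ}
    (hf : ∀ s ∈ Icc R (R + 1), HasDerivAt f (f' s) s) (hf' : ContinuousOn f' (Icc R (R + 1)))
    {δ : ℝ} (hδ : 0 < δ) :
    ‖f R‖ ^ 2 ≤ ∫ s in R..(R + 1), ((1 + δ⁻¹) * ‖f s‖ ^ 2 + δ * ‖f' s‖ ^ 2) := by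
  have hR : R ≤ R + 1 := by linarith
  have hfc : ContinuousOn f (Icc R (R + 1)) := fun s hs => (hf s hs).continuousAt.continuousWithinAt
  have hd : ∀ s ∈ uIcc R (R + 1), HasDerivAt (fun s => (R + 1 - s) * ‖f s‖ ^ 2)
      (-1 * ‖f s‖ ^ 2 + (R + 1 - s) * (2 * inner ℝ (f s) (f' s))) s := by
    intro s hs
    rw [uIcc_of_le hR] at hs
    have h1 : HasDerivAt (fun s => R + 1 - s) (-1) s := by
      simpa using (hasDerivAt_id s).const_sub (R + 1)
    exact h1.mul (hf s hs).norm_sq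
  have hi : ContinuousOn (fun s => -1 * ‖f s‖ ^ 2 + (R + 1 - s) * (2 * inner ℝ (f s) (f' s)))
      (uIcc R (R + 1)) := by
    rw [uIcc_of_le hR]
    have : ContinuousOn (fun s => inner ℝ (f s) (f' s)) (Icc R (R + 1)) := hfc.inner hf'
    fun_prop
  have hftc := intervalIntegral.integral_eq_sub_of_hasDerivAt hd hi.intervalIntegrable
  have h2 : ‖f R‖ ^ 2 = ∫ s in R..(R + 1),
      -(-1 * ‖f s‖ ^ 2 + (R + 1 - s) * (2 * inner ℝ (f s) (f' s))) := by
    rw [intervalIntegral.integral_neg, hftc]; ring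
  rw [h2]
  refine intervalIntegral.integral_mono_on hR hi.neg.intervalIntegrable ?_ fun s hs => ?_
  · apply ContinuousOn.intervalIntegrable
    rw [uIcc_of_le hR]
    fun_prop
  · have h3 := abs_real_inner_le_norm (f s) (f' s)
    have h4 := neg_le_of_abs_le h3
    have h5 : -((R + 1 - s) * (2 * inner ℝ (f s) (f' s))) ≤ 2 * (‖f s‖ * ‖f' s‖) := by
      have h6 : |(R + 1 - s) * (2 * inner ℝ (f s) (f' s))| ≤ 1 * (2 * (‖f s‖ * ‖f' s‖)) := by
        rw [abs_mul, abs_mul, abs_two]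
        gcongr
        rw [abs_le]; constructor <;> linarith [hs.1, hs.2]
      linarith [neg_le_of_abs_le h6]
    have h7 : 2 * (‖f s‖ * ‖f' s‖) ≤ δ⁻¹ * ‖f s‖ ^ 2 + δ * ‖f' s‖ ^ 2 := by
      have h8 : 0 ≤ δ⁻¹ * (‖f s‖ - δ * ‖f' s‖) ^ 2 := by positivity
      have h9 : δ⁻¹ * (‖f s‖ - δ * ‖f' s‖) ^ 2 =
          δ⁻¹ * ‖f s‖ ^ 2 + δ * ‖f' s‖ ^ 2 - 2 * (‖f s‖ * ‖f' s‖) := by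
        field_simp; ring
      linarith
    linarith

lemma measurable_defectDeriv (kp km : ℝ) (w : Plane → ℂ) : Measurable (defectDeriv kp km w) := by
  have h : ∀ v v', Measurable fun x => fderiv ℝ (fderiv ℝ w) x v v' := fun v v' =>
    (ContinuousLinearMap.apply ℝ ℂ v').continuous.measurable.comp
      (measurable_fderiv_apply_const ℝ (fderiv ℝ w) v)
  have h1 : (fun x => fderiv ℝ (fderiv ℝ w) x (‖x‖⁻¹ • x) (‖x‖⁻¹ • x)) = fun x =>
      ((‖x‖⁻¹ : ℝ) : ℂ) * ((‖x‖⁻¹ : ℝ) : ℂ) *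
        (((x 0 : ℝ) : ℂ) * ((x 0 : ℝ) : ℂ) * fderiv ℝ (fderiv ℝ w) x e1 e1 +
         ((x 0 : ℝ) : ℂ) * ((x 1 : ℝ) : ℂ) * fderiv ℝ (fderiv ℝ w) x e1 nu +
         ((x 1 : ℝ) : ℂ) * ((x 0 : ℝ) : ℂ) * fderiv ℝ (fderiv ℝ w) x nu e1 +
         ((x 1 : ℝ) : ℂ) * ((x 1 : ℝ) : ℂ) * fderiv ℝ (fderiv ℝ w) x nu nu) := by
    ext x
    have : ∀ B : Plane →L[ℝ] Plane →L[ℝ] ℂ, B (‖x‖⁻¹ • x) (‖x‖⁻¹ • x) =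
        ((‖x‖⁻¹ : ℝ) : ℂ) * ((‖x‖⁻¹ : ℝ) : ℂ) * (((x 0 : ℝ) : ℂ) * ((x 0 : ℝ) : ℂ) * B e1 e1 +
         ((x 0 : ℝ) : ℂ) * ((x 1 : ℝ) : ℂ) * B e1 nu +
         ((x 1 : ℝ) : ℂ) * ((x 0 : ℝ) : ℂ) * B nu e1 +
         ((x 1 : ℝ) : ℂ) * ((x 1 : ℝ) : ℂ) * B nu nu) := by
      intro B
      generalize hn : ‖x‖⁻¹ = n
      nth_rw 1 2 [plane_eq x]
      simp
      ring
    exact this _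
  have h2 : Measurable fun x : Plane => ((‖x‖⁻¹ : ℝ) : ℂ) :=
    Complex.measurable_ofReal.comp measurable_norm.inv
  have h3 : ∀ i, Measurable fun x : Plane => ((x i : ℝ) : ℂ) := fun i =>
    Complex.measurable_ofReal.comp (by fun_prop)
  have h4 : Measurable fun x => fderiv ℝ (fderiv ℝ w) x (‖x‖⁻¹ • x) (‖x‖⁻¹ • x) := by
    rw [h1]
    exact (h2.mul h2).mul ((((((h3 0).mul (h3 0)).mul (h e1 e1)).add
      (((h3 0).mul (h3 1)).mul (h e1 nu))).add (((h3 1).mul (h3 0)).mul (h nu e1))).add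
      (((h3 1).mul (h3 1)).mul (h nu nu)))
  exact h4.sub ((measurable_const.mul (Complex.measurable_ofReal.comp
    (measurable_waveNumber kp km))).mul (measurable_radialDeriv w))

/-! ### Decay on annuli and the radiation condition -/

lemma measurable_polar_integrand {f : Plane → ENNReal} (hf : Measurable f) :
    Measurable fun q : ℝ × ℝ => ENNReal.ofReal q.1 * f (q.1 • dir q.2) :=
  measurable_fst.ennreal_ofReal.mul (hf.comp
    (continuous_fst.smul (continuous_dir.comp continuous_snd)).measurable)

namespace IsTransmission

variable {kp km R₀ : ℝ} {w : Plane → ℂ}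

lemma radLintegral_eq (hw : IsTransmission kp km (Metric.closedBall 0 R₀) w) (hR₀ : 0 < R₀) {r : ℝ}
    (hr : R₀ < r) : radLintegral kp km w r = ENNReal.ofReal (radiationIntegral kp km w r) := by
  have hr0 := hR₀.trans hr
  have hS : IsCompact (Metric.sphere (0 : Plane) r) := isCompact_sphere 0 r
  obtain ⟨B, hB0, hB1, hB2⟩ := hw.exists_bound Metric.isClosed_closedBall hS (by
    intro x hx hx'
    rw [mem_sphere_zero_iff_norm] at hx
    rw [mem_closedBall_zero_iff] at hx'
    linarith)
  rw [radiationIntegral_eq kp km w hr0, ofReal_integral_eq_lintegral_ofReal]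
  · unfold radLintegral
    simp only [ENNReal.ofReal_mul hr0.le]
  · have hm : Measurable fun θ => r * ‖defect kp km w (r • dir θ)‖ ^ 2 :=
      (((measurable_defect kp km hw.measurable).comp
        (continuous_dir.const_smul r).measurable).norm.pow_const 2).const_mul r
    refine Measure.integrableOn_of_bounded (M := r * (B + 1 * (|kp| + |km|) * B) ^ 2)
      (by simp) hm.aestronglyMeasurable ?_
    filter_upwards [ae_smul_dir_notMem_interface hr0] with θ hθ
    rw [Real.norm_of_nonneg (by positivity)]
    have hmem : r • dir θ ∈ Metric.sphere (0 : Plane) r := by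
      rw [mem_sphere_zero_iff_norm, norm_smul_dir hr0.le]
    have h1 := hB1 _ hmem
    have h2 := (norm_radialDeriv_le w _).trans (hB2 _ hmem hθ)
    have h3 : ‖defect kp km w (r • dir θ)‖ ≤ B + 1 * (|kp| + |km|) * B := by
      refine (norm_sub_le _ _).trans ?_
      rw [norm_mul, norm_mul, Complex.norm_I, Complex.norm_real, Real.norm_eq_abs]
      have := abs_waveNumber_le kp km (r • dir θ)
      gcongr
    gcongr
  · exact Eventually.of_forall fun θ => by positivity

/-- The radiation condition implies decay of the defect on annuli. -/
theorem annVanish_defect (hw : IsTransmission kp km (Metric.closedBall 0 R₀) w) (hR₀ : 0 < R₀)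
    (hrad : Tendsto (radiationIntegral kp km w) atTop (𝓝 0)) :
    AnnVanish fun x => ‖defect kp km w x‖ ^ 2 := by
  intro L hL
  rw [ENNReal.tendsto_nhds_zero]
  intro ε hε
  have h1 : Tendsto (radLintegral kp km w) atTop (𝓝 0) := by
    have := ENNReal.tendsto_ofReal hrad
    rw [ENNReal.ofReal_zero] at this
    refine this.congr' ?_
    filter_upwards [eventually_gt_atTop R₀] with r hr using (hw.radLintegral_eq hR₀ hr).symm
  have hc : ENNReal.ofReal (2 * L) ≠ 0 := by simpa using hL
  have hε' : 0 < ε / ENNReal.ofReal (2 * L) := ENNReal.div_pos hε.ne' ENNReal.ofReal_ne_top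
  have h2 := (ENNReal.tendsto_nhds_zero.1 h1) _ hε'
  obtain ⟨r₀, hr₀⟩ := eventually_atTop.1 h2
  filter_upwards [eventually_ge_atTop (r₀ + L), eventually_gt_atTop L] with R hR hRL
  rw [lintegral_annulus (measurable_ofReal_norm_defect_sq kp km hw.measurable) hRL]
  calc _ ≤ ∫⁻ r in Icc (R - L) (R + L), ε / ENNReal.ofReal (2 * L) :=
        setLIntegral_mono' measurableSet_Icc fun r hr => hr₀ r (by linarith [hr.1])
    _ = ε := by
        rw [setLIntegral_const, Real.volume_Icc, show R + L - (R - L) = 2 * L by ring,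
          ENNReal.div_mul_cancel hc ENNReal.ofReal_ne_top]

/-- The radiation condition and the conservation of the flux bound the `L²` norm on annuli. -/
theorem annBdd_norm_sq (hw : IsTransmission kp km (Metric.closedBall 0 R₀) w) (hR₀ : 0 < R₀)
    (hkp : 0 < kp) (hkm : 0 < km) (hd : AnnVanish fun x => ‖defect kp km w x‖ ^ 2) :
    AnnBdd fun x => ‖w x‖ ^ 2 := by
  intro L hL
  set κ := min kp km
  have hκ : 0 < κ := lt_min hkp hkm
  set c : ENNReal := ENNReal.ofReal (3 / 4 * (2 * L) ^ 2 * κ) with hc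
  have hc0 : c ≠ 0 := by rw [hc, Ne, ENNReal.ofReal_eq_zero, not_le]; positivity
  set A : ENNReal := ENNReal.ofReal ((2 * L) ^ 2 * κ⁻¹) * 1 +
    ENNReal.ofReal (2 * flux (2 * L) (R₀ + 2 * L + 1) w) with hA
  have hAt : A ≠ ⊤ := by
    simp only [hA, mul_one]
    exact ENNReal.add_ne_top.2 ⟨ENNReal.ofReal_ne_top, ENNReal.ofReal_ne_top⟩
  refine ⟨A / c, ENNReal.div_ne_top hAt hc0, ?_⟩
  have h1 := (ENNReal.tendsto_nhds_zero.1 (hd (2 * L) (by linarith))) 1 one_pos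
  filter_upwards [h1, eventually_ge_atTop (R₀ + 2 * L + 1)] with R hR hRL
  have h2 := hw.lintegral_norm_sq_le hκ (min_le_left _ _) (min_le_right _ _) (L := 2 * L)
    (R := R) (by linarith) (by linarith)
  rw [show 2 * L / 2 = L by ring, ← hw.flux_eq hR₀ (R := R₀ + 2 * L + 1) (by linarith)
    (by linarith) hRL] at h2
  rw [ENNReal.le_div_iff_mul_le (Or.inl hc0) (Or.inl ENNReal.ofReal_ne_top), mul_comm]
  refine h2.trans ?_
  rw [hA]
  gcongr

lemma annBdd_gradSq (hw : IsTransmission kp km (Metric.closedBall 0 R₀) w) (hR₀ : 0 < R₀)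
    (h : AnnBdd fun x => ‖w x‖ ^ 2) : AnnBdd (gradSq w) := by
  intro L hL
  obtain ⟨M, hM, hM'⟩ := h (2 * L) (by linarith)
  refine ⟨ENNReal.ofReal (cacc kp km (2 * L)) * M, ENNReal.mul_ne_top ENNReal.ofReal_ne_top hM, ?_⟩
  filter_upwards [hM', eventually_gt_atTop (R₀ + 2 * L)] with R h1 h2
  have h3 := hw.caccioppoli hR₀ (L := 2 * L) (by linarith) h2
  rw [show 2 * L / 2 = L by ring] at h3
  exact h3.trans (by gcongr)

lemma annBdd_hessSq (hw : IsTransmission kp km (Metric.closedBall 0 R₀) w) (hR₀ : 0 < R₀)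
    (h : AnnBdd (gradSq w)) : AnnBdd (hessSq w) := by
  intro L hL
  obtain ⟨M, hM, hM'⟩ := h (2 * L) (by linarith)
  refine ⟨ENNReal.ofReal (cacc kp km (2 * L)) * M, ENNReal.mul_ne_top ENNReal.ofReal_ne_top hM, ?_⟩
  filter_upwards [hM', eventually_gt_atTop (R₀ + 1 + 2 * L)] with R h1 h2
  have h3 := hw.lintegral_hessSq_le hR₀ (L := 2 * L) (by linarith) h2
  rw [show 2 * L / 2 = L by ring] at h3
  refine h3.trans ?_
  gcongr
  refine (lintegral_mono fun p => ENNReal.ofReal_le_ofReal ?_).trans h1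
  unfold gradSq
  linarith [sq_nonneg ‖fderiv ℝ w (pt p) nu‖]

/-- The Helmholtz equation eliminates the second vertical derivative, so that the horizontal
derivative of the gradient suffices. -/
lemma norm_defectDeriv_sq_le (hw : IsTransmission kp km (Metric.closedBall 0 R₀) w) {x : Plane}
    (hx : x ∉ Metric.closedBall 0 R₀) (hxi : x ∉ interface) :
    ‖defectDeriv kp km w x‖ ^ 2 ≤ 16 * hessSq w x + (4 * (|kp| + |km|) ^ 2 * gradSq w x +
      4 * (|kp| + |km|) ^ 4 * ‖w x‖ ^ 2) := by
  set κ := |kp| + |km| with hκ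
  have hκ0 : 0 ≤ κ := by positivity
  have hk := abs_waveNumber_le kp km x
  rw [← hκ] at hk
  have hsymm : fderiv ℝ (fderiv ℝ w) x e1 nu = fderiv ℝ (fderiv ℝ w) x nu e1 :=
    (hw.contDiffAt Metric.isClosed_closedBall hx hxi).isSymmSndFDerivAt (by simp) e1 nu
  have hhelm := hw.helmholtz x (by simp only [mem_compl_iff, mem_union, not_or]; exact ⟨hx, hxi⟩)
  set B := fderiv ℝ (fderiv ℝ w) x with hB
  set v : Plane := ‖x‖⁻¹ • x with hv
  have hv2 : |v 0| ^ 2 + |v 1| ^ 2 ≤ 1 := by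
    have h1 : ‖v‖ ^ 2 = |v 0| ^ 2 + |v 1| ^ 2 := by
      rw [EuclideanSpace.norm_sq_eq]; simp [Fin.sum_univ_two]
    rw [← h1, hv, norm_smul, norm_inv, norm_norm]
    exact pow_le_one₀ (by positivity) inv_mul_le_one
  have h0 : |v 0| ≤ 1 := by nlinarith [abs_nonneg (v 0), abs_nonneg (v 1)]
  have h1 : |v 1| ≤ 1 := by nlinarith [abs_nonneg (v 0), abs_nonneg (v 1)]
  have hBv : B v v = ((v 0 * v 0 - v 1 * v 1 : ℝ) : ℂ) * B e1 e1 +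
      ((2 * (v 0 * v 1) : ℝ) : ℂ) * B e1 nu -
        ((v 1 * v 1 : ℝ) : ℂ) * ((waveNumber kp km x : ℂ) ^ 2 * w x) := by
    have e : B v v = ((v 0 : ℝ) : ℂ) * ((v 0 : ℝ) : ℂ) * B e1 e1 +
         ((v 0 : ℝ) : ℂ) * ((v 1 : ℝ) : ℂ) * B e1 nu +
         ((v 1 : ℝ) : ℂ) * ((v 0 : ℝ) : ℂ) * B nu e1 +
         ((v 1 : ℝ) : ℂ) * ((v 1 : ℝ) : ℂ) * B nu nu := by
      nth_rw 1 2 [plane_eq v]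
      simp
      ring
    rw [e, ← hsymm]
    push_cast
    linear_combination ((v 1 : ℝ) : ℂ) * ((v 1 : ℝ) : ℂ) * hhelm
  have hn : ‖defectDeriv kp km w x‖ ≤
      2 * ‖B e1 e1‖ + 2 * ‖B e1 nu‖ + κ ^ 2 * ‖w x‖ + κ * ‖radialDeriv w x‖ := by
    unfold defectDeriv
    rw [← hv, ← hB, hBv]
    refine (norm_sub_le _ _).trans (add_le_add ((norm_sub_le _ _).trans (add_le_add
      ((norm_add_le _ _).trans (add_le_add ?_ ?_)) ?_)) ?_)
    · rw [norm_mul, Complex.norm_real, Real.norm_eq_abs]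
      gcongr
      refine (abs_sub _ _).trans ?_
      rw [abs_mul, abs_mul]
      nlinarith [abs_nonneg (v 0), abs_nonneg (v 1)]
    · rw [norm_mul, Complex.norm_real, Real.norm_eq_abs]
      gcongr
      rw [abs_mul, abs_mul, abs_two]
      nlinarith [abs_nonneg (v 0), abs_nonneg (v 1), mul_le_one₀ h0 (abs_nonneg _) h1]
    · rw [norm_mul, Complex.norm_real, Real.norm_eq_abs, norm_mul, norm_pow, Complex.norm_real,
        Real.norm_eq_abs, abs_mul]
      refine (mul_le_of_le_one_left (by positivity) (mul_le_one₀ h1 (abs_nonneg _) h1)).trans ?_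
      gcongr
    · rw [norm_mul, norm_mul, Complex.norm_I, one_mul, Complex.norm_real, Real.norm_eq_abs]
      gcongr
  have hr := norm_radialDeriv_sq_le w x
  have hsq := pow_le_pow_left₀ (norm_nonneg _) hn 2
  refine hsq.trans ?_
  have h4 : ∀ a b c d : ℝ, (a + b + c + d) ^ 2 ≤ 4 * (a ^ 2 + b ^ 2 + c ^ 2 + d ^ 2) := by
    intro a b c d
    nlinarith [sq_nonneg (a - b), sq_nonneg (a - c), sq_nonneg (a - d), sq_nonneg (b - c),
      sq_nonneg (b - d), sq_nonneg (c - d)]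
  refine (h4 _ _ _ _).trans ?_
  have h5 := mul_le_mul_of_nonneg_left hr (sq_nonneg κ)
  have h6 : hessSq w x = ‖B e1 e1‖ ^ 2 + ‖B e1 nu‖ ^ 2 := rfl
  rw [h6]
  nlinarith

lemma measurable_hessSq (w : Plane → ℂ) : Measurable (hessSq w) := by
  have h : ∀ v v', Measurable fun x => fderiv ℝ (fderiv ℝ w) x v v' := fun v v' =>
    (ContinuousLinearMap.apply ℝ ℂ v').continuous.measurable.comp
      (measurable_fderiv_apply_const ℝ (fderiv ℝ w) v)
  exact ((h e1 e1).norm.pow_const 2).add ((h e1 nu).norm.pow_const 2)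

lemma annBdd_defectDeriv (hw : IsTransmission kp km (Metric.closedBall 0 R₀) w)
    (h0 : AnnBdd fun x => ‖w x‖ ^ 2) (h1 : AnnBdd (gradSq w)) (h2 : AnnBdd (hessSq w)) :
    AnnBdd fun x => ‖defectDeriv kp km w x‖ ^ 2 := by
  intro L hL
  obtain ⟨M0, hM0, h0⟩ := h0 L hL
  obtain ⟨M1, hM1, h1⟩ := h1 L hL
  obtain ⟨M2, hM2, h2⟩ := h2 L hL
  set κ := |kp| + |km|
  have hκ0 : 0 ≤ κ := by positivity
  refine ⟨ENNReal.ofReal 16 * M2 + (ENNReal.ofReal (4 * κ ^ 2) * M1 +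
    ENNReal.ofReal (4 * κ ^ 4) * M0), ?_, ?_⟩
  · simp only [ne_eq, ENNReal.add_eq_top, not_or]
    exact ⟨ENNReal.mul_ne_top ENNReal.ofReal_ne_top hM2,
      ENNReal.mul_ne_top ENNReal.ofReal_ne_top hM1, ENNReal.mul_ne_top ENNReal.ofReal_ne_top hM0⟩
  · filter_upwards [h0, h1, h2, eventually_gt_atTop (R₀ + L)] with R g0 g1 g2 hR
    have m2 : Measurable fun p : ℝ × ℝ => ENNReal.ofReal 16 * ENNReal.ofReal (hessSq w (pt p)) :=
      (((measurable_hessSq w).comp pt.continuous.measurable).ennreal_ofReal).const_mul _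
    have m1 : Measurable fun p : ℝ × ℝ =>
        ENNReal.ofReal (4 * κ ^ 2) * ENNReal.ofReal (gradSq w (pt p)) :=
      (((measurable_gradSq w).comp pt.continuous.measurable).ennreal_ofReal).const_mul _
    calc ∫⁻ p in pt ⁻¹' annulus R L, ENNReal.ofReal (‖defectDeriv kp km w (pt p)‖ ^ 2)
        ≤ ∫⁻ p in pt ⁻¹' annulus R L, (ENNReal.ofReal 16 * ENNReal.ofReal (hessSq w (pt p)) +
          (ENNReal.ofReal (4 * κ ^ 2) * ENNReal.ofReal (gradSq w (pt p)) +
            ENNReal.ofReal (4 * κ ^ 4) * ENNReal.ofReal (‖w (pt p)‖ ^ 2))) := by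
          refine lintegral_mono_ae ?_
          rw [ae_restrict_iff' (measurableSet_annulus _ _)]
          filter_upwards [ae_notMem_interface] with p hp hpa
          have h := hw.norm_defectDeriv_sq_le (annulus_subset_compl hR hpa) hp
          have hg := gradSq_nonneg w (pt p)
          have hh : 0 ≤ hessSq w (pt p) := by unfold hessSq; positivity
          rw [← ENNReal.ofReal_mul (by norm_num), ← ENNReal.ofReal_mul (by positivity),
            ← ENNReal.ofReal_mul (by positivity), ← ENNReal.ofReal_add (by positivity)
              (by positivity), ← ENNReal.ofReal_add (by positivity) (by positivity)]
          exact ENNReal.ofReal_le_ofReal h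
      _ = ENNReal.ofReal 16 * (∫⁻ p in pt ⁻¹' annulus R L, ENNReal.ofReal (hessSq w (pt p))) +
          (ENNReal.ofReal (4 * κ ^ 2) *
              (∫⁻ p in pt ⁻¹' annulus R L, ENNReal.ofReal (gradSq w (pt p))) +
            ENNReal.ofReal (4 * κ ^ 4) *
              ∫⁻ p in pt ⁻¹' annulus R L, ENNReal.ofReal (‖w (pt p)‖ ^ 2)) := by
          rw [lintegral_add_left m2, lintegral_add_left m1,
            lintegral_const_mul' _ _ ENNReal.ofReal_ne_top,
            lintegral_const_mul' _ _ ENNReal.ofReal_ne_top,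
            lintegral_const_mul' _ _ ENNReal.ofReal_ne_top]
      _ ≤ _ := by gcongr

/-- The radiation integral over one circle is controlled by integrals over an annulus. -/
theorem radLintegral_le (hw : IsTransmission kp km (Metric.closedBall 0 R₀) w) (hR₀ : 0 < R₀)
    {R : ℝ} (hR : R₀ < R) {δ : ℝ} (hδ : 0 < δ) :
    radLintegral kp km w R ≤ ENNReal.ofReal (1 + δ⁻¹) * (∫⁻ p in pt ⁻¹' annulus (R + 1 / 2) (1 / 2),
      ENNReal.ofReal (‖defect kp km w (pt p)‖ ^ 2)) + ENNReal.ofReal δ *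
        ∫⁻ p in pt ⁻¹' annulus (R + 1 / 2) (1 / 2),
          ENNReal.ofReal (‖defectDeriv kp km w (pt p)‖ ^ 2) := by
  have hR0 := hR₀.trans hR
  set F : Plane → ENNReal := fun x => ENNReal.ofReal (1 + δ⁻¹) *
    ENNReal.ofReal (‖defect kp km w x‖ ^ 2) + ENNReal.ofReal δ *
      ENNReal.ofReal (‖defectDeriv kp km w x‖ ^ 2) with hF
  have hm1 := measurable_ofReal_norm_defect_sq kp km hw.measurable
  have hm2 : Measurable fun x => ENNReal.ofReal (‖defectDeriv kp km w x‖ ^ 2) :=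
    ((measurable_defectDeriv kp km w).norm.pow_const 2).ennreal_ofReal
  have hFm : Measurable F := (hm1.const_mul _).add (hm2.const_mul _)
  have hRHS : ∫⁻ p in pt ⁻¹' annulus (R + 1 / 2) (1 / 2), F (pt p) =
      ENNReal.ofReal (1 + δ⁻¹) * (∫⁻ p in pt ⁻¹' annulus (R + 1 / 2) (1 / 2),
      ENNReal.ofReal (‖defect kp km w (pt p)‖ ^ 2)) + ENNReal.ofReal δ *
        ∫⁻ p in pt ⁻¹' annulus (R + 1 / 2) (1 / 2),
          ENNReal.ofReal (‖defectDeriv kp km w (pt p)‖ ^ 2) := by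
    have hm1' : Measurable fun p : ℝ × ℝ =>
        ENNReal.ofReal (1 + δ⁻¹) * ENNReal.ofReal (‖defect kp km w (pt p)‖ ^ 2) :=
      (hm1.comp pt.continuous.measurable).const_mul _
    simp only [hF]
    rw [lintegral_add_left hm1',
      lintegral_const_mul' _ _ ENNReal.ofReal_ne_top,
      lintegral_const_mul' _ _ ENNReal.ofReal_ne_top]
  rw [← hRHS, lintegral_annulus hFm (by linarith), lintegral_lintegral_swap
    (measurable_polar_integrand hFm).aemeasurable, show R + 1 / 2 - 1 / 2 = R by ring,
    show R + 1 / 2 + 1 / 2 = R + 1 by ring]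
  refine lintegral_mono_ae ?_
  filter_upwards [ae_smul_dir_notMem_interface (one_pos : (0 : ℝ) < 1)] with θ hθ
  have hni : ∀ s : ℝ, 0 < s → s • dir θ ∉ interface := by
    intro s hs hsi
    have : Real.sin θ ≠ 0 := by simpa [interface, dir] using hθ
    simp [interface, dir, hs.ne', this] at hsi
  have hk : ∀ s : ℝ, 0 < s → waveNumber kp km (s • dir θ) = waveNumber kp km (dir θ) := by
    intro s hs
    simp [waveNumber, dir, hs]
  have hpos : ∀ s ∈ Icc R (R + 1), 0 < s := fun s hs => hR0.trans_le hs.1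
  have hout : ∀ s ∈ Icc R (R + 1), s • dir θ ∉ Metric.closedBall (0 : Plane) R₀ := fun s hs =>
    smul_dir_notMem_closedBall hR₀ (hR.trans_le hs.1) θ
  set γ : ℝ → ℂ := fun s => fderiv ℝ w (s • dir θ) (dir θ) -
    Complex.I * (waveNumber kp km (dir θ) : ℂ) * w (s • dir θ) with hγ
  set γ' : ℝ → ℂ := fun s => fderiv ℝ (fderiv ℝ w) (s • dir θ) (dir θ) (dir θ) -
    Complex.I * (waveNumber kp km (dir θ) : ℂ) * fderiv ℝ w (s • dir θ) (dir θ) with hγ'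
  have hγe : ∀ s ∈ Icc R (R + 1), γ s = defect kp km w (s • dir θ) := fun s hs => by
    simp only [hγ]
    rw [defect, radialDeriv, inv_norm_smul_smul_dir (hpos s hs), hk s (hpos s hs)]
  have hγe' : ∀ s ∈ Icc R (R + 1), γ' s = defectDeriv kp km w (s • dir θ) := fun s hs => by
    simp only [hγ']
    rw [defectDeriv, radialDeriv, inv_norm_smul_smul_dir (hpos s hs), hk s (hpos s hs)]
  have hline : ∀ s, HasDerivAt (fun s : ℝ => s • dir θ) (dir θ) s := fun s => by
    simpa using (hasDerivAt_id s).smul_const (dir θ)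
  have hder : ∀ s ∈ Icc R (R + 1), HasDerivAt γ (γ' s) s := by
    intro s hs
    have hs1 := hout s hs
    have hs2 := hni s (hpos s hs)
    have d1 : HasDerivAt (fun s => w (s • dir θ)) (fderiv ℝ w (s • dir θ) (dir θ)) s :=
      (hw.differentiableAt Metric.isClosed_closedBall hs1 hs2).hasFDerivAt.comp_hasDerivAt s
        (hline s)
    have d2 : HasDerivAt (fun s => fderiv ℝ w (s • dir θ))
        (fderiv ℝ (fderiv ℝ w) (s • dir θ) (dir θ)) s :=
      (hw.differentiableAt_fderiv Metric.isClosed_closedBall hs1 hs2).hasFDerivAt.comp_hasDerivAt s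
        (hline s)
    have d3 : HasDerivAt (fun s => fderiv ℝ w (s • dir θ) (dir θ))
        (fderiv ℝ (fderiv ℝ w) (s • dir θ) (dir θ) (dir θ)) s :=
      (ContinuousLinearMap.apply ℝ ℂ (dir θ)).hasFDerivAt.comp_hasDerivAt s d2
    exact d3.sub (d1.const_mul _)
  have hcont : ContinuousOn γ' (Icc R (R + 1)) := by
    intro s hs
    have hs1 := hout s hs
    have hs2 := hni s (hpos s hs)
    have hl : ContinuousAt (fun s : ℝ => s • dir θ) s := (hline s).continuousAt
    have c1 : ContinuousAt (fun s => fderiv ℝ w (s • dir θ)) s :=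
      ContinuousAt.comp (f := fun s : ℝ => s • dir θ)
        (hw.differentiableAt_fderiv Metric.isClosed_closedBall hs1 hs2).continuousAt hl
    have c2 : ContinuousAt (fun s => fderiv ℝ (fderiv ℝ w) (s • dir θ)) s :=
      ContinuousAt.comp (f := fun s : ℝ => s • dir θ)
        (((hw.contDiffAt_fderiv Metric.isClosed_closedBall hs1 hs2).fderiv_right (m := 0)
          (by norm_num)).continuousAt) hl
    exact (((c2.clm_apply continuousAt_const).clm_apply continuousAt_const).sub
      (continuousAt_const.mul (c1.clm_apply continuousAt_const))).continuousWithinAt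
  have htr := norm_sq_le_integral hder hcont hδ
  have hRR : R ≤ R + 1 := by linarith
  have hnn : ∀ s, 0 ≤ (1 + δ⁻¹) * ‖γ s‖ ^ 2 + δ * ‖γ' s‖ ^ 2 := fun s => by positivity
  have hii : IntegrableOn (fun s => (1 + δ⁻¹) * ‖γ s‖ ^ 2 + δ * ‖γ' s‖ ^ 2) (Icc R (R + 1)) := by
    have hγc : ContinuousOn γ (Icc R (R + 1)) := fun s hs =>
      (hder s hs).continuousAt.continuousWithinAt
    apply ContinuousOn.integrableOn_Icc
    fun_prop
  rw [intervalIntegral.integral_of_le hRR, ← integral_Icc_eq_integral_Ioc] at htr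
  have hlin := ENNReal.ofReal_le_ofReal htr
  rw [ofReal_integral_eq_lintegral_ofReal hii (Eventually.of_forall hnn)] at hlin
  rw [← hγe R ⟨le_rfl, hRR⟩]
  calc ENNReal.ofReal R * ENNReal.ofReal (‖γ R‖ ^ 2)
      ≤ ENNReal.ofReal R * ∫⁻ s in Icc R (R + 1),
          ENNReal.ofReal ((1 + δ⁻¹) * ‖γ s‖ ^ 2 + δ * ‖γ' s‖ ^ 2) := by gcongr
    _ = ∫⁻ s in Icc R (R + 1), ENNReal.ofReal R *
          ENNReal.ofReal ((1 + δ⁻¹) * ‖γ s‖ ^ 2 + δ * ‖γ' s‖ ^ 2) :=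
        (lintegral_const_mul' _ _ ENNReal.ofReal_ne_top).symm
    _ ≤ _ := by
        refine setLIntegral_mono' measurableSet_Icc fun s hs => ?_
        rw [hγe s hs, hγe' s hs]
        refine mul_le_mul' (ENNReal.ofReal_le_ofReal hs.1) (le_of_eq ?_)
        rw [ENNReal.ofReal_add (by positivity) (by positivity), ENNReal.ofReal_mul (by positivity),
          ENNReal.ofReal_mul hδ.le]

/-- From annuli back to circles, by the trace inequality `radLintegral_le` with small `δ`. -/
theorem tendsto_radiationIntegral (hw : IsTransmission kp km (Metric.closedBall 0 R₀) w)
    (hR₀ : 0 < R₀) (h0 : AnnVanish fun x => ‖defect kp km w x‖ ^ 2)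
    (h1 : AnnBdd fun x => ‖defectDeriv kp km w x‖ ^ 2) :
    Tendsto (radiationIntegral kp km w) atTop (𝓝 0) := by
  have hlin : Tendsto (radLintegral kp km w) atTop (𝓝 0) := by
    rw [ENNReal.tendsto_nhds_zero]
    intro ε hε
    by_cases hεt : ε = ⊤
    · simp [hεt]
    obtain ⟨M, hM, hM'⟩ := h1 (1 / 2) (by norm_num)
    set δ : ℝ := ε.toReal / 2 / (M.toReal + 1) with hδ
    have hε0 : 0 < ε.toReal := ENNReal.toReal_pos hε.ne' hεt
    have hMn := ENNReal.toReal_nonneg (a := M)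
    have hδ0 : 0 < δ := by positivity
    have hshift : Tendsto (fun R : ℝ => R + 1 / 2) atTop atTop :=
      tendsto_atTop_add_const_right _ _ tendsto_id
    have h2 := (ENNReal.Tendsto.const_mul (a := ENNReal.ofReal (1 + δ⁻¹))
      ((h0 (1 / 2) (by norm_num)).comp hshift) (Or.inr ENNReal.ofReal_ne_top))
    rw [mul_zero] at h2
    filter_upwards [ENNReal.tendsto_nhds_zero.1 h2 (ε / 2) (ENNReal.half_pos hε.ne'),
      hshift.eventually hM', eventually_gt_atTop R₀] with R g1 g2 g3
    refine (hw.radLintegral_le hR₀ g3 hδ0).trans ?_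
    rw [← ENNReal.add_halves ε]
    refine add_le_add g1 ((mul_le_mul_right g2 _).trans ?_)
    rw [← ENNReal.ofReal_toReal hM, ← ENNReal.ofReal_mul hδ0.le, ← ENNReal.ofReal_toReal hεt,
      show (2 : ENNReal) = ENNReal.ofReal 2 by simp, ← ENNReal.ofReal_div_of_pos (by norm_num)]
    refine ENNReal.ofReal_le_ofReal ?_
    rw [hδ, div_mul_eq_mul_div, div_le_iff₀ (by positivity)]
    gcongr
    linarith
  have hnn : ∀ r, 0 < r → 0 ≤ radiationIntegral kp km w r := fun r hr => by
    rw [radiationIntegral_eq kp km w hr]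
    exact integral_nonneg fun θ => by positivity
  have h3 : Tendsto (fun r => ENNReal.ofReal (radiationIntegral kp km w r)) atTop (𝓝 0) :=
    tendsto_of_tendsto_of_tendsto_of_le_of_le' tendsto_const_nhds hlin
      (Eventually.of_forall fun _ => zero_le)
      ((eventually_gt_atTop 0).mono fun r hr => ofReal_radiationIntegral_le kp km w hr)
  have h4 := (ENNReal.tendsto_toReal ENNReal.zero_ne_top).comp h3
  rw [ENNReal.toReal_zero] at h4
  refine h4.congr' ?_
  filter_upwards [eventually_gt_atTop 0] with r hr using ENNReal.toReal_ofReal (hnn r hr)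

end IsTransmission

/-! ### Horizontal translation preserves the radiation condition -/

lemma norm_normalize_sub_le {x y : Plane} (hx : x ≠ 0) (hy : y ≠ 0) :
    ‖‖x‖⁻¹ • x - ‖y‖⁻¹ • y‖ ≤ 2 * ‖x - y‖ / ‖x‖ := by
  have hx' : 0 < ‖x‖ := norm_pos_iff.2 hx
  have hy' : 0 < ‖y‖ := norm_pos_iff.2 hy
  have e : ‖x‖⁻¹ • x - ‖y‖⁻¹ • y = ‖x‖⁻¹ • (x - y) + (‖x‖⁻¹ - ‖y‖⁻¹) • y := by
    rw [smul_sub, sub_smul]; abel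
  rw [e]
  refine (norm_add_le _ _).trans ?_
  rw [norm_smul, norm_smul, norm_inv, norm_norm, Real.norm_eq_abs]
  have h1 : |‖x‖⁻¹ - ‖y‖⁻¹| * ‖y‖ ≤ ‖x‖⁻¹ * ‖x - y‖ := by
    have h2 : ‖x‖⁻¹ - ‖y‖⁻¹ = (‖y‖ - ‖x‖) * (‖x‖⁻¹ * ‖y‖⁻¹) := by field_simp
    rw [h2, abs_mul, abs_of_pos (by positivity : 0 < ‖x‖⁻¹ * ‖y‖⁻¹)]
    have h3 : |‖y‖ - ‖x‖| ≤ ‖x - y‖ := by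
      rw [abs_sub_comm]; exact abs_norm_sub_norm_le x y
    calc |‖y‖ - ‖x‖| * (‖x‖⁻¹ * ‖y‖⁻¹) * ‖y‖ = ‖x‖⁻¹ * |‖y‖ - ‖x‖| := by field_simp
      _ ≤ _ := by gcongr
  calc _ ≤ ‖x‖⁻¹ * ‖x - y‖ + ‖x‖⁻¹ * ‖x - y‖ := by gcongr
    _ = _ := by ring

lemma sub_horiz_apply_one (x : Plane) (z : ℝ) : (x - horiz z) 1 = x 1 := by simp [horiz]

/-- A horizontal translation commutes with the defect up to the change of the radial direction,
which is of order `1 / |x|`. -/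
lemma norm_defect_comp_sub_sq_le (kp km : ℝ) (w : Plane → ℂ) (z : ℝ) {x : Plane} (hx : x ≠ 0)
    (hy : x - horiz z ≠ 0) :
    ‖defect kp km (fun x => w (x - horiz z)) x‖ ^ 2 ≤ 2 * ‖defect kp km w (x - horiz z)‖ ^ 2 +
      8 * z ^ 2 / ‖x‖ ^ 2 * gradSq w (x - horiz z) := by
  set y := x - horiz z with hydef
  have h1 : defect kp km (fun x => w (x - horiz z)) x =
      defect kp km w y + fderiv ℝ w y (‖x‖⁻¹ • x - ‖y‖⁻¹ • y) := by
    have hk : waveNumber kp km x = waveNumber kp km y := by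
      simp only [waveNumber, hydef, sub_horiz_apply_one]
    rw [defect, defect, radialDeriv, radialDeriv, fderiv_comp_sub, hk, map_sub]
    ring
  have h2 : ‖‖x‖⁻¹ • x - ‖y‖⁻¹ • y‖ ≤ 2 * |z| / ‖x‖ := by
    have := norm_normalize_sub_le hx hy
    rwa [hydef, sub_sub_cancel, norm_horiz] at this
  have h3 := norm_apply_sq_le (fderiv ℝ w y) (‖x‖⁻¹ • x - ‖y‖⁻¹ • y)
  have h4 := pow_le_pow_left₀ (norm_nonneg _) h2 2
  have h5 : (2 * |z| / ‖x‖) ^ 2 = 4 * z ^ 2 / ‖x‖ ^ 2 := by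
    rw [div_pow, mul_pow, sq_abs]; norm_num
  have h6 : ‖fderiv ℝ w y (‖x‖⁻¹ • x - ‖y‖⁻¹ • y)‖ ^ 2 ≤ 4 * z ^ 2 / ‖x‖ ^ 2 * gradSq w y := by
    rw [← h5]
    exact h3.trans (mul_le_mul_of_nonneg_right h4 (gradSq_nonneg w y))
  rw [h1]
  have h7 := pow_le_pow_left₀ (norm_nonneg _)
    (norm_add_le (defect kp km w y) (fderiv ℝ w y (‖x‖⁻¹ • x - ‖y‖⁻¹ • y))) 2
  have h8 : 8 * z ^ 2 / ‖x‖ ^ 2 * gradSq w y = 2 * (4 * z ^ 2 / ‖x‖ ^ 2 * gradSq w y) := by ring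
  rw [h8]
  nlinarith [sq_nonneg (‖defect kp km w y‖ - ‖fderiv ℝ w y (‖x‖⁻¹ • x - ‖y‖⁻¹ • y)‖)]

/-- The estimate is only required almost everywhere on far annuli, as gradients are not controlled
on the interface and near the obstacle. -/
lemma AnnVanish.add_le {f g h : Plane → ℝ} (hf : AnnVanish f) (hg : AnnVanish g)
    (hfm : Measurable f)
    (hle : ∀ L, 0 < L → ∀ᶠ R in atTop, ∀ᵐ p : ℝ × ℝ, pt p ∈ annulus R L →
      h (pt p) ≤ 2 * f (pt p) + 2 * g (pt p)) : AnnVanish h := by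
  intro L hL
  have h1 := (ENNReal.Tendsto.const_mul (a := 2) (hf L hL) (Or.inr (by norm_num))).add
    (ENNReal.Tendsto.const_mul (a := 2) (hg L hL) (Or.inr (by norm_num)))
  simp only [mul_zero, add_zero] at h1
  refine tendsto_of_tendsto_of_tendsto_of_le_of_le' tendsto_const_nhds h1
    (Eventually.of_forall fun _ => zero_le) ?_
  filter_upwards [hle L hL] with R hR
  have hfm' : Measurable fun p : ℝ × ℝ => 2 * ENNReal.ofReal (f (pt p)) :=
    ((hfm.comp pt.continuous.measurable).ennreal_ofReal).const_mul _
  rw [← lintegral_const_mul' _ _ (by norm_num), ← lintegral_const_mul' _ _ (by norm_num),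
    ← lintegral_add_left hfm']
  refine lintegral_mono_ae ?_
  rw [ae_restrict_iff' (measurableSet_annulus _ _)]
  filter_upwards [hR] with p hp hpa
  refine (ENNReal.ofReal_le_ofReal (hp hpa)).trans (ENNReal.ofReal_add_le.trans (le_of_eq ?_))
  rw [ENNReal.ofReal_mul zero_le_two, ENNReal.ofReal_mul zero_le_two]
  simp

lemma AnnVanish.comp_sub_horiz {f : Plane → ℝ} (hf : AnnVanish f) (z : ℝ) :
    AnnVanish fun x => f (x - horiz z) := fun L hL =>
  tendsto_of_tendsto_of_tendsto_of_le_of_le tendsto_const_nhds (hf (L + |z|) (by positivity))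
    (fun _ => zero_le) fun R =>
      lintegral_annulus_comp_sub_le (f := fun x => ENNReal.ofReal (f x)) z R L

/-- A bounded quantity divided by `|x|²` is negligible. -/
lemma AnnBdd.annVanish_div {f : Plane → ℝ} (hf : AnnBdd f) (hf0 : ∀ x, 0 ≤ f x) {c : ℝ}
    (hc : 0 ≤ c) : AnnVanish fun x => c / ‖x‖ ^ 2 * f x := by
  intro L hL
  obtain ⟨M, hM, hM'⟩ := hf L hL
  have h1 : Tendsto (fun R : ℝ => ENNReal.ofReal (c / (R - L) ^ 2) * M) atTop (𝓝 0) := by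
    have h2 : Tendsto (fun R : ℝ => c / (R - L) ^ 2) atTop (𝓝 0) :=
      ((tendsto_pow_atTop (two_ne_zero)).comp
        (tendsto_atTop_add_const_right _ (-L) tendsto_id)).const_div_atTop c
    have h3 := ENNReal.Tendsto.mul_const (ENNReal.tendsto_ofReal h2) (Or.inr hM)
    rwa [ENNReal.ofReal_zero, zero_mul] at h3
  refine tendsto_of_tendsto_of_tendsto_of_le_of_le' tendsto_const_nhds h1
    (Eventually.of_forall fun _ => zero_le) ?_
  filter_upwards [hM', eventually_gt_atTop L] with R hR hRL
  calc _ ≤ ∫⁻ p in pt ⁻¹' annulus R L,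
        ENNReal.ofReal (c / (R - L) ^ 2) * ENNReal.ofReal (f (pt p)) := by
        refine setLIntegral_mono' (measurableSet_annulus _ _) fun p hp => ?_
        have h4 : |‖pt p‖ - R| ≤ L := hp
        have h5 := (abs_le.1 h4).1
        have h7 : 0 < R - L := by linarith
        rw [← ENNReal.ofReal_mul (by positivity)]
        refine ENNReal.ofReal_le_ofReal (mul_le_mul_of_nonneg_right ?_ (hf0 _))
        have h6 : R - L ≤ ‖pt p‖ := by linarith
        gcongr
    _ = ENNReal.ofReal (c / (R - L) ^ 2) * ∫⁻ p in pt ⁻¹' annulus R L, ENNReal.ofReal (f (pt p)) :=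
        lintegral_const_mul' _ _ ENNReal.ofReal_ne_top
    _ ≤ _ := by gcongr

namespace IsTransmission

variable {kp km R₀ : ℝ} {w : Plane → ℂ}

/-- The radiation condition is invariant under horizontal translations. -/
theorem radiation_comp_sub_horiz (hw : IsTransmission kp km (Metric.closedBall 0 R₀) w)
    (hR₀ : 0 < R₀) (hkp : 0 < kp) (hkm : 0 < km)
    (hrad : Tendsto (radiationIntegral kp km w) atTop (𝓝 0)) (z : ℝ) :
    Tendsto (radiationIntegral kp km fun x => w (x - horiz z)) atTop (𝓝 0) := by
  have hd := hw.annVanish_defect hR₀ hrad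
  have hb := hw.annBdd_norm_sq hR₀ hkp hkm hd
  have hg := hw.annBdd_gradSq hR₀ hb
  have hz0 : 0 < R₀ + |z| := by positivity
  have hv : IsTransmission kp km (Metric.closedBall 0 (R₀ + |z|)) fun x => w (x - horiz z) := by
    refine hw.comp_sub_horiz fun x hx => ?_
    rw [mem_closedBall_zero_iff, not_le] at hx ⊢
    have := norm_sub_norm_le x (horiz z)
    rw [norm_horiz] at this
    linarith
  have hvb : AnnBdd fun x => ‖w (x - horiz z)‖ ^ 2 := hb.comp_sub_horiz z
  have hvg := hv.annBdd_gradSq hz0 hvb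
  have hvh := hv.annBdd_hessSq hz0 hvg
  refine hv.tendsto_radiationIntegral hz0 ?_ (hv.annBdd_defectDeriv hvb hvg hvh)
  have hg' := (hg.comp_sub_horiz z).annVanish_div (fun x => gradSq_nonneg w _)
    (c := 4 * z ^ 2) (by positivity)
  refine (hd.comp_sub_horiz z).add_le hg' ?_ fun L hL => ?_
  · exact ((measurable_defect kp km hw.measurable).norm.pow_const 2).comp
      (measurable_id.sub_const _)
  · filter_upwards [eventually_gt_atTop (|z| + L)] with R hR
    refine Eventually.of_forall fun p hp => ?_
    have h1 : R - L ≤ ‖pt p‖ := by have := (abs_le.1 (show |‖pt p‖ - R| ≤ L from hp)).1; linarith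
    have h2 : |z| < ‖pt p‖ := by linarith
    refine (norm_defect_comp_sub_sq_le kp km w z (x := pt p) ?_ ?_).trans (le_of_eq ?_)
    · exact norm_pos_iff.1 ((abs_nonneg z).trans_lt h2)
    · intro h0
      rw [sub_eq_zero] at h0
      rw [h0, norm_horiz] at h2
      exact lt_irrefl _ h2
    · ring

end IsTransmission

/-! ### Scattered waves -/

lemma e1_eq : e1 = EuclideanSpace.basisFun (Fin 2) ℝ 0 := by
  ext i; fin_cases i <;> simp [e1]

lemma nu_eq : nu = EuclideanSpace.basisFun (Fin 2) ℝ 1 := by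
  ext i; fin_cases i <;> simp [nu]

lemma laplacian_eq (f : Plane → ℂ) (x : Plane) : Laplacian.laplacian f x =
    fderiv ℝ (fderiv ℝ f) x e1 e1 + fderiv ℝ (fderiv ℝ f) x nu nu := by
  rw [InnerProductSpace.laplacian_eq_iteratedFDeriv_orthonormalBasis f
    (EuclideanSpace.basisFun (Fin 2) ℝ)]
  simp only [Fin.sum_univ_two, iteratedFDeriv_two_apply, e1_eq, nu_eq]
  rfl

lemma IsBuriedObstacle.notMem_closure {D : Set Plane} (hD : IsBuriedObstacle D) {y : Plane}
    (hy : y ∈ interface) : y ∉ closure D := fun h => by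
  have h1 : y 1 < 0 := hD.closure_subset h
  have h2 : y 1 = 0 := hy
  linarith

lemma IsBuriedObstacle.exists_radius {D : Set Plane} (hD : IsBuriedObstacle D) :
    ∃ R₀ : ℝ, 0 < R₀ ∧ closure D ⊆ Metric.closedBall 0 R₀ := by
  obtain ⟨R, hR⟩ := hD.isBounded.closure.subset_closedBall (0 : Plane)
  exact ⟨max R 1, by positivity, hR.trans (Metric.closedBall_subset_closedBall (le_max_left _ _))⟩

section scattered

variable {kp km θd θdt : ℝ} {D : Set Plane} {u v : Plane → ℂ}

lemma IsScatteredWave.measurable_indicator (hu : IsScatteredWave kp km θd θdt D u)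
    (hD : IsBuriedObstacle D) : Measurable (Dᶜ.indicator u) := by
  classical
  rw [← piecewise_eq_indicator]
  exact hu.continuousOn.measurable_piecewise continuousOn_const hD.isOpen.measurableSet.compl

/-- Extended by zero to the obstacle, a scattered wave solves the transmission problem. -/
lemma IsScatteredWave.isTransmission (hu : IsScatteredWave kp km θd θdt D u)
    (hD : IsBuriedObstacle D) : IsTransmission kp km (closure D) (Dᶜ.indicator u) := by
  have h : ∀ x ∉ closure D, Dᶜ.indicator u x = u x := fun x hx =>
    indicator_of_mem (show x ∈ Dᶜ from fun hxD => hx (subset_closure hxD)) u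
  have he : ∀ x ∉ closure D, Dᶜ.indicator u =ᶠ[𝓝 x] u := fun x hx => by
    filter_upwards [isClosed_closure.isOpen_compl.mem_nhds hx] with y hy using h y hy
  refine ⟨hu.measurable_indicator hD,
    hu.contDiffOn.congr fun x hx => h x fun hk => hx (Or.inl hk), fun x hx => ?_,
    (hu.continuousOn.mono (compl_subset_compl.2 subset_closure)).congr fun x hx => h x hx,
    fun y hy hyK => ?_⟩
  · have hxK : x ∉ closure D := fun hk => hx (Or.inl hk)
    rw [((he x hxK).fderiv (𝕜 := ℝ)).fderiv_eq, h x hxK, ← laplacian_eq]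
    exact hu.helmholtz x hx
  · obtain ⟨Lp, Lm, h1, h2, h3⟩ := hu.normal_jump y hy
    have := (he y hyK).fderiv (𝕜 := ℝ)
    exact ⟨Lp, Lm, h1.congr' (this.symm.filter_mono nhdsWithin_le_nhds),
      h2.congr' (this.symm.filter_mono nhdsWithin_le_nhds), h3⟩

lemma IsScatteredWave.radiation_indicator (hu : IsScatteredWave kp km θd θdt D u)
    (hD : IsBuriedObstacle D) :
    Tendsto (radiationIntegral kp km (Dᶜ.indicator u)) atTop (𝓝 0) := by
  obtain ⟨R₀, hR₀, hR⟩ := hD.exists_radius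
  refine hu.radiation.congr' ?_
  filter_upwards [eventually_gt_atTop R₀] with r hr
  refine radiationIntegral_congr isClosed_closure hR₀ hR (fun x hx => ?_) hr
  exact (indicator_of_mem (show x ∈ Dᶜ from fun hxD => hx (subset_closure hxD)) u).symm

/-- Two scattered waves of the same obstacle differ by a function that decays in the mean: it
radiates, but its energy flux is zero. -/
theorem IsScatteredWave.annVanish_sub (hu : IsScatteredWave kp km θd θdt D u)
    (hv : IsScatteredWave kp km θd θdt D v) (hD : IsBuriedObstacle D) (hkp : 0 < kp)
    (hkm : 0 < km) : AnnVanish fun x => ‖Dᶜ.indicator u x - Dᶜ.indicator v x‖ ^ 2 := by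
  obtain ⟨R₀, hR₀, hR⟩ := hD.exists_radius
  have hu' := hu.isTransmission hD
  have hv' := hv.isTransmission hD
  have hw := hu'.sub hv' isClosed_closure
  have huB := hu'.mono hR
  have hvB := hv'.mono hR
  have hwB := hw.mono hR
  set w : Plane → ℂ := fun x => Dᶜ.indicator u x - Dᶜ.indicator v x with hwdef
  have hw0 : ∀ x ∈ closure D, w x = 0 := by
    intro x hx
    by_cases hxD : x ∈ D
    · simp [hwdef, hxD]
    · have hf : x ∈ frontier D := by rw [hD.isOpen.frontier_eq]; exact ⟨hx, hxD⟩
      simp [hwdef, hxD, hu.boundary x hf, hv.boundary x hf]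
  have hwc : Continuous w := by
    have h1 : ContinuousOn w Dᶜ := (hu.continuousOn.congr fun x hx => indicator_of_mem hx u).sub
      (hv.continuousOn.congr fun x hx => indicator_of_mem hx v)
    have h2 : ContinuousOn w (closure D) := continuousOn_const.congr hw0
    have h3 := h1.union_of_isClosed h2 hD.isOpen.isClosed_compl isClosed_closure
    rw [← continuousOn_univ]
    refine h3.mono fun x _ => ?_
    by_cases hxD : x ∈ D
    · exact Or.inr (subset_closure hxD)
    · exact Or.inl hxD
  have hdef : AnnVanish fun x => ‖defect kp km w x‖ ^ 2 := by
    refine (huB.annVanish_defect hR₀ (hu.radiation_indicator hD)).add_le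
      (hvB.annVanish_defect hR₀ (hv.radiation_indicator hD))
      ((measurable_defect kp km huB.measurable).norm.pow_const 2) fun L hL => ?_
    filter_upwards [eventually_gt_atTop (R₀ + L)] with R hRL
    filter_upwards [ae_notMem_interface] with p hp hpa
    have hpB := annulus_subset_compl hRL hpa
    have e : defect kp km w (pt p) =
        defect kp km (Dᶜ.indicator u) (pt p) - defect kp km (Dᶜ.indicator v) (pt p) := by
      rw [defect, defect, defect, radialDeriv, radialDeriv, radialDeriv, hwdef,
        fderiv_fun_sub (huB.differentiableAt Metric.isClosed_closedBall hpB hp)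
          (hvB.differentiableAt Metric.isClosed_closedBall hpB hp)]
      simp only [_root_.sub_apply]
      ring
    rw [e]
    have h7 := pow_le_pow_left₀ (norm_nonneg _)
      (norm_sub_le (defect kp km (Dᶜ.indicator u) (pt p)) (defect kp km (Dᶜ.indicator v) (pt p))) 2
    nlinarith [sq_nonneg (‖defect kp km (Dᶜ.indicator u) (pt p)‖ -
      ‖defect kp km (Dᶜ.indicator v) (pt p)‖)]
  intro L hL
  set κ := min kp km
  have hκ : 0 < κ := lt_min hkp hkm
  set c : ENNReal := ENNReal.ofReal (3 / 4 * (2 * L) ^ 2 * κ) with hc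
  have hc0 : c ≠ 0 := by rw [hc, Ne, ENNReal.ofReal_eq_zero, not_le]; positivity
  have h1 := (ENNReal.Tendsto.const_mul (a := ENNReal.ofReal ((2 * L) ^ 2 * κ⁻¹))
    (hdef (2 * L) (by linarith)) (Or.inr ENNReal.ofReal_ne_top))
  have h2 := ENNReal.Tendsto.div_const h1 (Or.inr hc0)
  rw [mul_zero, ENNReal.zero_div] at h2
  refine tendsto_of_tendsto_of_tendsto_of_le_of_le' tendsto_const_nhds h2
    (Eventually.of_forall fun _ => zero_le) ?_
  filter_upwards [eventually_gt_atTop (R₀ + 2 * L)] with R hRL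
  have h3 := hwB.lintegral_norm_sq_le hκ (min_le_left _ _) (min_le_right _ _) (L := 2 * L)
    (R := R) (by linarith) hRL
  rw [show 2 * L / 2 = L by ring, hw.flux_eq_zero isClosed_closure hR₀ hR hwc hw0 (by linarith) hRL,
    mul_zero, ENNReal.ofReal_zero, add_zero] at h3
  rw [ENNReal.le_div_iff_mul_le (Or.inl hc0) (Or.inl ENNReal.ofReal_ne_top), mul_comm]
  exact h3

end scattered

/-! ### Far-field patterns -/

/-- The closed upper unit half-circle. -/
def halfCircle : Set Plane := {x | ‖x‖ = 1 ∧ 0 ≤ x 1}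

lemma isCompact_halfCircle : IsCompact halfCircle := by
  have : halfCircle = Metric.sphere (0 : Plane) 1 ∩ {x | 0 ≤ x 1} := by
    ext x; simp [halfCircle]
  rw [this]
  exact (isCompact_sphere 0 1).inter_right (isClosed_le continuous_const (by fun_prop))

lemma dir_mem_halfCircle {θ : ℝ} (h : θ ∈ Icc 0 Real.pi) : dir θ ∈ halfCircle :=
  ⟨norm_dir θ, by simpa [dir] using Real.sin_nonneg_of_mem_Icc h⟩

lemma normalize_mem_halfCircle {x : Plane} (hx : x ≠ 0) (h : 0 ≤ x 1) :
    ‖x‖⁻¹ • x ∈ halfCircle := by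
  refine ⟨by rw [norm_smul, norm_inv, norm_norm, inv_mul_cancel₀ (norm_ne_zero_iff.2 hx)], ?_⟩
  simp only [PiLp.smul_apply, smul_eq_mul]
  positivity

/-- The outgoing oscillation `exp (i k t)`. -/
def osc (k t : ℝ) : ℂ := Complex.exp (Complex.I * (k * t : ℝ))

lemma norm_osc (k t : ℝ) : ‖osc k t‖ = 1 := by
  rw [osc, mul_comm, Complex.norm_exp_ofReal_mul_I]

lemma osc_add (k s t : ℝ) : osc k (s + t) = osc k s * osc k t := by
  rw [osc, osc, osc, ← Complex.exp_add]; congr 1; push_cast; ring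

lemma continuous_osc (k : ℝ) : Continuous (osc k) := by unfold osc; fun_prop

/-- Far-field patterns without denominators. -/
lemma isFarField_iff {kp : ℝ} {u F : Plane → ℂ} : IsFarField kp u F ↔
    ∀ ε > 0, ∃ R > 0, ∀ x : Plane, R ≤ ‖x‖ → 0 ≤ x 1 →
      ‖(√‖x‖ : ℂ) * u x - osc kp ‖x‖ * F (‖x‖⁻¹ • x)‖ ≤ ε := by
  have key : ∀ x : Plane, 0 < ‖x‖ → ∀ c : ℝ,
      (‖u x - Complex.exp (Complex.I * (kp * ‖x‖ : ℝ)) / (√‖x‖ : ℂ) * F (‖x‖⁻¹ • x)‖ ≤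
        c * ‖1 / √‖x‖‖ ↔ ‖(√‖x‖ : ℂ) * u x - osc kp ‖x‖ * F (‖x‖⁻¹ • x)‖ ≤ c) := by
    intro x hx c
    have hs : 0 < √‖x‖ := Real.sqrt_pos.2 hx
    have hs' : (√‖x‖ : ℂ) ≠ 0 := by exact_mod_cast hs.ne'
    have e : (√‖x‖ : ℂ) * u x - osc kp ‖x‖ * F (‖x‖⁻¹ • x) = (√‖x‖ : ℂ) *
        (u x - Complex.exp (Complex.I * (kp * ‖x‖ : ℝ)) / (√‖x‖ : ℂ) * F (‖x‖⁻¹ • x)) := by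
      unfold osc; field_simp
    rw [e, norm_mul, Complex.norm_real, Real.norm_of_nonneg hs.le,
      Real.norm_of_nonneg (by positivity), mul_one_div, le_div_iff₀' hs]
  unfold IsFarField
  rw [Asymptotics.isLittleO_iff]
  constructor
  · intro h ε hε
    have h1 := h hε
    rw [eventually_inf_principal, (hasBasis_cobounded_norm (E := Plane)).eventually_iff] at h1
    obtain ⟨R, -, hR⟩ := h1
    refine ⟨max R 1, by positivity, fun x hx hx1 => ?_⟩
    have hx0 : 0 < ‖x‖ := lt_of_lt_of_le (by positivity) hx
    exact (key x hx0 ε).1 (hR (show x ∈ {x | R ≤ ‖x‖} from (le_max_left _ _).trans hx) hx1)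
  · intro h c hc
    obtain ⟨R, hR0, hR⟩ := h c hc
    rw [eventually_inf_principal, (hasBasis_cobounded_norm (E := Plane)).eventually_iff]
    refine ⟨R, trivial, fun x hx hx1 => ?_⟩
    have hx' : R ≤ ‖x‖ := hx
    exact (key x (hR0.trans_le hx') c).2 (hR x hx' hx1)

/-- A far-field pattern is continuous, as a uniform limit of continuous functions. -/
lemma IsFarField.continuousOn {kp R₀ : ℝ} {u F : Plane → ℂ} (hF : IsFarField kp u F)
    (hu : ContinuousOn u (Metric.closedBall 0 R₀)ᶜ) : ContinuousOn F halfCircle := by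
  rw [isFarField_iff] at hF
  have hunif : TendstoUniformlyOn (fun (r : ℝ) (x : Plane) => osc kp (-r) * ((√r : ℂ) * u (r • x)))
      F atTop halfCircle := by
    rw [Metric.tendstoUniformlyOn_iff]
    intro ε hε
    obtain ⟨R, hR0, hR⟩ := hF (ε / 2) (by linarith)
    filter_upwards [eventually_ge_atTop R] with r hr x hx
    have hr0 : 0 < r := hR0.trans_le hr
    have hn : ‖r • x‖ = r := by rw [norm_smul, hx.1, mul_one, Real.norm_of_nonneg hr0.le]
    have h1 := hR (r • x) (by rw [hn]; exact hr) (by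
      simp only [PiLp.smul_apply, smul_eq_mul]; exact mul_nonneg hr0.le hx.2)
    rw [hn, smul_smul, inv_mul_cancel₀ hr0.ne', one_smul] at h1
    rw [dist_comm, dist_eq_norm]
    have e : osc kp (-r) * ((√r : ℂ) * u (r • x)) - F x =
        osc kp (-r) * ((√r : ℂ) * u (r • x) - osc kp r * F x) := by
      have : osc kp (-r) * osc kp r = 1 := by rw [← osc_add]; simp [osc]
      linear_combination F x * this
    rw [e, norm_mul, norm_osc, one_mul]
    linarith
  refine hunif.continuousOn (Eventually.frequently ?_)
  filter_upwards [eventually_gt_atTop (max R₀ 0)] with r hr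
  have hr0 : 0 < r := (le_max_right _ _).trans_lt hr
  refine continuousOn_const.mul (continuousOn_const.mul (hu.comp (by fun_prop) fun x hx => ?_))
  rw [mem_compl_iff, mem_closedBall_zero_iff, norm_smul, hx.1, mul_one,
    Real.norm_of_nonneg hr0.le, not_le]
  exact (le_max_left _ _).trans_lt hr

/-- Functions whose difference decays in the mean have the same far-field pattern: by continuity,
distinct patterns would differ by a fixed amount on a whole sector. -/
theorem farField_eq {kp R₀ : ℝ} {u v F G : Plane → ℂ} (hum : Measurable u) (hvm : Measurable v)
    (hu : ContinuousOn u (Metric.closedBall 0 R₀)ᶜ) (hv : ContinuousOn v (Metric.closedBall 0 R₀)ᶜ)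
    (hF : IsFarField kp u F) (hG : IsFarField kp v G)
    (h : AnnVanish fun x => ‖u x - v x‖ ^ 2) {θ : ℝ} (hθ : θ ∈ Icc 0 Real.pi) :
    F (dir θ) = G (dir θ) := by
  have hcont : ContinuousOn (fun x => F x - G x) halfCircle := (hF.continuousOn hu).sub
    (hG.continuousOn hv)
  by_contra hne
  set c := ‖F (dir θ) - G (dir θ)‖ / 4 with hc
  have hc0 : 0 < c := div_pos (norm_pos_iff.2 (sub_ne_zero.2 hne)) (by norm_num)
  have hcθ : ContinuousOn (fun t => ‖F (dir t) - G (dir t)‖) (Icc 0 Real.pi) :=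
    (hcont.comp continuous_dir.continuousOn fun t ht => dir_mem_halfCircle ht).norm
  obtain ⟨δ, hδ, hδ'⟩ := Metric.continuousWithinAt_iff.1 (hcθ θ hθ) c hc0
  set a := max 0 (θ - δ) with ha
  set b := min Real.pi (θ + δ) with hb
  have hab : a < b := by
    refine max_lt (lt_min Real.pi_pos (by linarith [hθ.1]))
      (lt_min (by linarith [hθ.2]) (by linarith))
  have hlow : ∀ t ∈ Ioo a b, t ∈ Icc 0 Real.pi ∧ 3 * c ≤ ‖F (dir t) - G (dir t)‖ := by
    intro t ht
    have h1 : t ∈ Icc 0 Real.pi :=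
      ⟨(le_max_left _ _).trans ht.1.le, ht.2.le.trans (min_le_left _ _)⟩
    have h2 := hδ' h1 (by
      rw [Real.dist_eq, abs_lt]
      constructor
      · linarith [(le_max_right 0 (θ - δ)).trans_lt ht.1]
      · linarith [ht.2.trans_le (min_le_right Real.pi (θ + δ))])
    rw [Real.dist_eq, abs_lt] at h2
    refine ⟨h1, ?_⟩
    have h3 : ‖F (dir θ) - G (dir θ)‖ = 4 * c := by rw [hc]; ring
    linarith [h2.1]
  obtain ⟨R₁, hR₁0, hR₁⟩ := isFarField_iff.1 hF c hc0
  obtain ⟨R₂, hR₂0, hR₂⟩ := isFarField_iff.1 hG c hc0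
  have hbig : ∀ r, R₁ ≤ r → R₂ ≤ r → ∀ t ∈ Ioo a b,
      c ^ 2 ≤ r * ‖u (r • dir t) - v (r • dir t)‖ ^ 2 := by
    intro r h1 h2 t ht
    have hr0 : 0 < r := hR₁0.trans_le h1
    have hn := norm_smul_dir hr0.le t
    have hpos : 0 ≤ (r • dir t) 1 := by
      simp only [PiLp.smul_apply, smul_eq_mul]
      exact mul_nonneg hr0.le (dir_mem_halfCircle (hlow t ht).1).2
    have g1 := hR₁ (r • dir t) (by rw [hn]; exact h1) hpos
    have g2 := hR₂ (r • dir t) (by rw [hn]; exact h2) hpos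
    rw [inv_norm_smul_smul_dir hr0, hn] at g1 g2
    have e : osc kp r * (F (dir t) - G (dir t)) =
        (√r : ℂ) * (u (r • dir t) - v (r • dir t)) -
          ((√r : ℂ) * u (r • dir t) - osc kp r * F (dir t)) +
          ((√r : ℂ) * v (r • dir t) - osc kp r * G (dir t)) := by ring
    have g3 : ‖F (dir t) - G (dir t)‖ ≤ √r * ‖u (r • dir t) - v (r • dir t)‖ + c + c := by
      have g4 : ‖osc kp r * (F (dir t) - G (dir t))‖ ≤
          √r * ‖u (r • dir t) - v (r • dir t)‖ + c + c := by
        rw [e]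
        refine (norm_add_le _ _).trans (add_le_add ((norm_sub_le _ _).trans (add_le_add ?_ g1)) g2)
        rw [norm_mul, Complex.norm_real, Real.norm_of_nonneg (Real.sqrt_nonneg r)]
      rwa [norm_mul, norm_osc, one_mul] at g4
    have g5 : c ≤ √r * ‖u (r • dir t) - v (r • dir t)‖ := by linarith [(hlow t ht).2]
    have g6 := pow_le_pow_left₀ hc0.le g5 2
    rwa [mul_pow, Real.sq_sqrt hr0.le] at g6
  have hm : Measurable fun x => ENNReal.ofReal (‖u x - v x‖ ^ 2) :=
    ((hum.sub hvm).norm.pow_const 2).ennreal_ofReal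
  have hsub : Ioo a b ⊆ Ioo (-Real.pi) Real.pi := fun t ht =>
    ⟨by linarith [Real.pi_pos, (le_max_left 0 (θ - δ)).trans_lt ht.1],
      ht.2.trans_le (min_le_left _ _)⟩
  set κ : ENNReal := ENNReal.ofReal (c ^ 2) * ENNReal.ofReal (b - a) * ENNReal.ofReal 2 with hκ
  have hκ0 : 0 < κ := by
    have h1 : 0 < b - a := sub_pos.2 hab
    simp only [hκ]
    refine ENNReal.mul_pos (ENNReal.mul_pos ?_ ?_).ne' ?_ <;>
      rw [Ne, ENNReal.ofReal_eq_zero, not_le] <;> positivity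
  have hge : ∀ᶠ R in atTop, κ ≤ ∫⁻ p in pt ⁻¹' annulus R 1,
      ENNReal.ofReal (‖u (pt p) - v (pt p)‖ ^ 2) := by
    filter_upwards [eventually_ge_atTop (R₁ + 1), eventually_ge_atTop (R₂ + 1)] with R h1 h2
    rw [lintegral_annulus hm (by linarith)]
    calc κ = ∫⁻ r in Icc (R - 1) (R + 1), ENNReal.ofReal (c ^ 2) * ENNReal.ofReal (b - a) := by
          rw [setLIntegral_const, Real.volume_Icc, show R + 1 - (R - 1) = 2 by ring]
      _ ≤ _ := by
          refine setLIntegral_mono' measurableSet_Icc fun r hr => ?_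
          have hr0 : 0 ≤ r := by linarith [hr.1]
          calc ENNReal.ofReal (c ^ 2) * ENNReal.ofReal (b - a)
              = ∫⁻ t in Ioo a b, ENNReal.ofReal (c ^ 2) := by
                rw [setLIntegral_const, Real.volume_Ioo]
            _ ≤ ∫⁻ t in Ioo a b, ENNReal.ofReal r *
                  ENNReal.ofReal (‖u (r • dir t) - v (r • dir t)‖ ^ 2) := by
                refine setLIntegral_mono' measurableSet_Ioo fun t ht => ?_
                rw [← ENNReal.ofReal_mul hr0]
                exact ENNReal.ofReal_le_ofReal
                  (hbig r (by linarith [hr.1]) (by linarith [hr.1]) t ht)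
            _ ≤ _ := lintegral_mono_set hsub
  have hlt := (h 1 one_pos).eventually_lt_const hκ0
  obtain ⟨R, g1, g2⟩ := (hge.and hlt).exists
  exact absurd g1 (not_le.2 g2)

/-- `|x - z| - |x| + z · x / |x|` tends to zero at infinity. -/
lemma abs_norm_sub_norm_add_inner_le {x z : Plane} (hx : x ≠ 0) :
    |‖x - z‖ - (‖x‖ - inner ℝ z (‖x‖⁻¹ • x))| ≤ 2 * ‖z‖ ^ 2 / ‖x‖ := by
  have hx' : 0 < ‖x‖ := norm_pos_iff.2 hx
  set s := inner ℝ z (‖x‖⁻¹ • x) with hs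
  have hs1 : inner ℝ z x = ‖x‖ * s := by
    rw [hs, inner_smul_right]; field_simp
  have hs2 : |s| ≤ ‖z‖ := by
    refine (abs_real_inner_le_norm _ _).trans ?_
    rw [norm_smul, norm_inv, norm_norm, inv_mul_cancel₀ hx'.ne', mul_one]
  have h1 : ‖x - z‖ ^ 2 = ‖x‖ ^ 2 - 2 * (‖x‖ * s) + ‖z‖ ^ 2 := by
    rw [norm_sub_sq_real, real_inner_comm, hs1]
  set n := ‖x - z‖
  have hn0 : 0 ≤ n := norm_nonneg _
  have h2 : |n - ‖x‖| ≤ ‖z‖ := by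
    have := abs_norm_sub_norm_le (x - z) x
    rwa [sub_sub_cancel_left, norm_neg] at this
  have h3 : (n - (‖x‖ - s)) * (n + ‖x‖) = ‖z‖ ^ 2 + s * (n - ‖x‖) := by
    have : (n - (‖x‖ - s)) * (n + ‖x‖) = n ^ 2 - ‖x‖ ^ 2 + s * (n + ‖x‖) := by ring
    rw [this, h1]; ring
  have h4 : |n - (‖x‖ - s)| * (n + ‖x‖) ≤ 2 * ‖z‖ ^ 2 := by
    rw [← abs_of_nonneg (by positivity : 0 ≤ n + ‖x‖), ← abs_mul, h3]
    refine (abs_add_le _ _).trans ?_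
    rw [abs_mul, abs_of_nonneg (sq_nonneg ‖z‖)]
    have := mul_le_mul hs2 h2 (abs_nonneg _) (norm_nonneg z)
    nlinarith
  rw [le_div_iff₀ hx']
  refine le_trans ?_ h4
  gcongr
  linarith

/-- The far-field pattern of a horizontal translate. -/
theorem IsFarField.comp_sub_horiz {kp R₀ : ℝ} {u F : Plane → ℂ} (hF : IsFarField kp u F)
    (hu : ContinuousOn u (Metric.closedBall 0 R₀)ᶜ) (z : ℝ) :
    IsFarField kp (fun x => u (x - horiz z))
      fun x => osc kp (-inner ℝ (horiz z) x) * F x := by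
  have hFc := hF.continuousOn hu
  obtain ⟨B, hB⟩ := isCompact_halfCircle.exists_bound_of_continuousOn hFc
  have hFu := isCompact_halfCircle.uniformContinuousOn_of_continuous hFc
  have hl : ∀ x : Plane, 0 ≤ x 1 → 0 ≤ (x - horiz z) 1 := fun x hx => by
    rwa [sub_horiz_apply_one]
  set l := Bornology.cobounded Plane ⊓ 𝓟 {x : Plane | 0 ≤ x 1} with hldef
  have hmem : ∀ᶠ x : Plane in l, 0 ≤ x 1 := mem_inf_of_right (mem_principal_self _)
  have hnorm : Tendsto (fun x : Plane => ‖x‖) l atTop :=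
    tendsto_norm_cobounded_atTop.mono_left inf_le_left
  have hnormz : Tendsto (fun x : Plane => ‖x - horiz z‖) l atTop := by
    refine tendsto_atTop_mono (fun x => ?_) (tendsto_atTop_add_const_right _ (-|z|) hnorm)
    have := norm_sub_norm_le x (horiz z)
    rw [norm_horiz] at this
    linarith
  have hx0 : ∀ᶠ x : Plane in l, x ≠ 0 := (hnorm.eventually_gt_atTop 0).mono fun x hx =>
    norm_pos_iff.1 hx
  have hy0 : ∀ᶠ x : Plane in l, x - horiz z ≠ 0 := (hnormz.eventually_gt_atTop 0).mono fun x hx =>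
    norm_pos_iff.1 hx
  -- the ingredients of the limit
  have hratio : Tendsto (fun x : Plane => √(‖x‖ / ‖x - horiz z‖)) l (𝓝 1) := by
    have h1 : Tendsto (fun x : Plane => ‖x‖ / ‖x - horiz z‖) l (𝓝 1) := by
      have h2 : Tendsto (fun x : Plane => |z| / ‖x - horiz z‖) l (𝓝 0) :=
        hnormz.const_div_atTop _
      have h3 : Tendsto (fun x : Plane => ‖x‖ / ‖x - horiz z‖ - 1) l (𝓝 0) := by
        refine squeeze_zero_norm' ?_ h2
        filter_upwards [hy0] with x hx
        have hx' : 0 < ‖x - horiz z‖ := norm_pos_iff.2 hx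
        rw [div_sub_one hx'.ne', norm_div, norm_norm, Real.norm_eq_abs]
        have := abs_norm_sub_norm_le x (x - horiz z)
        rw [sub_sub_cancel, norm_horiz] at this
        exact div_le_div_of_nonneg_right this hx'.le
      simpa using h3.add_const 1
    simpa using h1.sqrt
  have hphase : Tendsto (fun x : Plane => osc kp
      (‖x - horiz z‖ - (‖x‖ - inner ℝ (horiz z) (‖x‖⁻¹ • x)))) l (𝓝 1) := by
    have h1 : Tendsto (fun x : Plane => ‖x - horiz z‖ - (‖x‖ - inner ℝ (horiz z) (‖x‖⁻¹ • x))) l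
        (𝓝 0) := by
      refine squeeze_zero_norm' ?_ (hnorm.const_div_atTop (2 * ‖horiz z‖ ^ 2))
      filter_upwards [hx0] with x hx using abs_norm_sub_norm_add_inner_le hx
    have h2 := ((continuous_osc kp).tendsto 0).comp h1
    have h3 : osc kp 0 = 1 := by simp [osc]
    rwa [h3] at h2
  have hFdiff : Tendsto (fun x : Plane => F (‖x - horiz z‖⁻¹ • (x - horiz z)) - F (‖x‖⁻¹ • x)) l
      (𝓝 0) := by
    rw [Metric.tendsto_nhds]
    intro ε hε
    obtain ⟨δ, hδ, hδ'⟩ := Metric.uniformContinuousOn_iff.1 hFu ε hε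
    have h1 : Tendsto (fun x : Plane => 2 * |z| / ‖x‖) l (𝓝 0) := hnorm.const_div_atTop _
    filter_upwards [hx0, hy0, hmem, h1.eventually_lt_const hδ] with x g1 g2 g3 g4
    rw [dist_zero_right, ← dist_eq_norm]
    refine hδ' _ (normalize_mem_halfCircle g2 (hl x g3)) _ (normalize_mem_halfCircle g1 g3) ?_
    rw [dist_comm, dist_eq_norm]
    have := norm_normalize_sub_le g1 g2
    rw [sub_sub_cancel, norm_horiz] at this
    linarith
  have hu0 : Tendsto (fun x : Plane => (√‖x - horiz z‖ : ℂ) * u (x - horiz z) -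
      osc kp ‖x - horiz z‖ * F (‖x - horiz z‖⁻¹ • (x - horiz z))) l (𝓝 0) := by
    rw [Metric.tendsto_nhds]
    intro ε hε
    obtain ⟨R, hR0, hR⟩ := isFarField_iff.1 hF (ε / 2) (by linarith)
    filter_upwards [hnormz.eventually_ge_atTop R, hmem] with x g1 g2
    rw [dist_zero_right]
    linarith [hR (x - horiz z) g1 (hl x g2)]
  -- the decomposition of the remainder
  have hsum : Tendsto (fun x : Plane => (√(‖x‖ / ‖x - horiz z‖) : ℂ) *
      ((√‖x - horiz z‖ : ℂ) * u (x - horiz z) -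
        osc kp ‖x - horiz z‖ * F (‖x - horiz z‖⁻¹ • (x - horiz z))) +
      ((√(‖x‖ / ‖x - horiz z‖) : ℂ) *
        osc kp (‖x - horiz z‖ - (‖x‖ - inner ℝ (horiz z) (‖x‖⁻¹ • x))) *
        (F (‖x - horiz z‖⁻¹ • (x - horiz z)) - F (‖x‖⁻¹ • x)) +
      ((√(‖x‖ / ‖x - horiz z‖) : ℂ) *
        osc kp (‖x - horiz z‖ - (‖x‖ - inner ℝ (horiz z) (‖x‖⁻¹ • x))) - 1) * F (‖x‖⁻¹ • x)) *
        osc kp (‖x‖ - inner ℝ (horiz z) (‖x‖⁻¹ • x))) l (𝓝 0) := by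
    have hr : Tendsto (fun x : Plane => (√(‖x‖ / ‖x - horiz z‖) : ℂ)) l (𝓝 1) := by
      have := (Complex.continuous_ofReal.tendsto 1).comp hratio
      rwa [Complex.ofReal_one] at this
    have hrp := hr.mul hphase
    have t1 := hr.mul hu0
    have t2 := hrp.mul hFdiff
    have t3 : Tendsto (fun x : Plane => ((√(‖x‖ / ‖x - horiz z‖) : ℂ) *
        osc kp (‖x - horiz z‖ - (‖x‖ - inner ℝ (horiz z) (‖x‖⁻¹ • x))) - 1) * F (‖x‖⁻¹ • x)) l
        (𝓝 0) := by
      refine (by simpa using hrp.sub_const 1 : Tendsto _ l (𝓝 (0 : ℂ))).zero_mul_isBoundedUnder_le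
        (isBoundedUnder_of_eventually_le (a := B) ?_)
      filter_upwards [hx0, hmem] with x g1 g2 using hB _ (normalize_mem_halfCircle g1 g2)
    have t4 : Tendsto (fun x : Plane => ((√(‖x‖ / ‖x - horiz z‖) : ℂ) *
        osc kp (‖x - horiz z‖ - (‖x‖ - inner ℝ (horiz z) (‖x‖⁻¹ • x))) *
        (F (‖x - horiz z‖⁻¹ • (x - horiz z)) - F (‖x‖⁻¹ • x)) +
      ((√(‖x‖ / ‖x - horiz z‖) : ℂ) *
        osc kp (‖x - horiz z‖ - (‖x‖ - inner ℝ (horiz z) (‖x‖⁻¹ • x))) - 1) * F (‖x‖⁻¹ • x)) *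
        osc kp (‖x‖ - inner ℝ (horiz z) (‖x‖⁻¹ • x))) l (𝓝 0) := by
      have t5 := t2.add t3
      rw [mul_zero, add_zero] at t5
      exact t5.zero_mul_isBoundedUnder_le
        (isBoundedUnder_of_eventually_le (a := 1) (Eventually.of_forall fun x => (norm_osc _ _).le))
    simpa using t1.add t4
  rw [isFarField_iff]
  intro ε hε
  have hfin := hsum.norm.eventually_lt_const (u := ε) (by simpa using hε)
  have hfin2 := (hfin.and hx0).and hy0
  rw [hldef, eventually_inf_principal, (hasBasis_cobounded_norm (E := Plane)).eventually_iff]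
    at hfin2
  obtain ⟨R, -, hR⟩ := hfin2
  refine ⟨max R 1, by positivity, fun x hx hx1 => ?_⟩
  obtain ⟨⟨g1, g2⟩, g3⟩ := hR (show x ∈ {x | R ≤ ‖x‖} from (le_max_left _ _).trans hx) hx1
  refine le_trans (le_of_eq (congrArg norm ?_)) g1.le
  have hx' : 0 < ‖x‖ := norm_pos_iff.2 g2
  have hy' : 0 < ‖x - horiz z‖ := norm_pos_iff.2 g3
  have s1 : (√(‖x‖ / ‖x - horiz z‖) : ℂ) * (√‖x - horiz z‖ : ℂ) = (√‖x‖ : ℂ) := by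
    rw [← Complex.ofReal_mul, ← Real.sqrt_mul (by positivity), div_mul_cancel₀ _ hy'.ne']
  have s2 : osc kp (‖x - horiz z‖ - (‖x‖ - inner ℝ (horiz z) (‖x‖⁻¹ • x))) *
      osc kp (‖x‖ - inner ℝ (horiz z) (‖x‖⁻¹ • x)) = osc kp ‖x - horiz z‖ := by
    rw [← osc_add, sub_add_cancel]
  have s3 : osc kp ‖x‖ * osc kp (-inner ℝ (horiz z) (‖x‖⁻¹ • x)) =
      osc kp (‖x‖ - inner ℝ (horiz z) (‖x‖⁻¹ • x)) := by
    rw [← osc_add, sub_eq_add_neg]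
  linear_combination (-u (x - horiz z)) * s1 - F (‖x‖⁻¹ • x) * s3 -
    (√(‖x‖ / ‖x - horiz z‖) : ℂ) * F (‖x - horiz z‖⁻¹ • (x - horiz z)) * s2

/-! ### Translated obstacles -/

lemma mem_translate {D : Set Plane} {z x : Plane} : x ∈ translate D z ↔ x - z ∈ D := by
  constructor
  · rintro ⟨y, hy, rfl⟩
    simpa using hy
  · exact fun h => ⟨x - z, h, sub_add_cancel x z⟩

lemma translate_eq_preimage (D : Set Plane) (z : Plane) :
    translate D z = Homeomorph.subRight z ⁻¹' D := by
  ext x; exact mem_translate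

lemma mem_closure_translate {D : Set Plane} {z x : Plane} :
    x ∈ closure (translate D z) ↔ x - z ∈ closure D := by
  rw [translate_eq_preimage, ← Homeomorph.preimage_closure]; rfl

lemma mem_frontier_translate {D : Set Plane} {z x : Plane} :
    x ∈ frontier (translate D z) ↔ x - z ∈ frontier D := by
  rw [translate_eq_preimage, ← Homeomorph.preimage_frontier]; rfl

lemma IsBuriedObstacle.translate_horiz {D : Set Plane} (hD : IsBuriedObstacle D) (z : ℝ) :
    IsBuriedObstacle (translate D (horiz z)) where
  isOpen := by
    rw [translate_eq_preimage]
    exact hD.isOpen.preimage (Homeomorph.continuous _)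
  nonempty := hD.nonempty.image _
  isBounded := by
    obtain ⟨R, hR⟩ := hD.isBounded.exists_norm_le
    refine isBounded_iff_forall_norm_le.2 ⟨R + |z|, fun x hx => ?_⟩
    have h1 := hR _ (mem_translate.1 hx)
    have h2 := norm_sub_norm_le x (horiz z)
    rw [norm_horiz] at h2
    linarith
  connected_compl := by
    rw [translate_eq_preimage, ← preimage_compl, Homeomorph.isConnected_preimage]
    exact hD.connected_compl
  closure_subset := fun x hx => by
    have h : (x - horiz z) 1 < 0 := hD.closure_subset (mem_closure_translate.1 hx)
    rwa [sub_horiz_apply_one] at h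

/-- Iterating the translation would otherwise carry a point of `D` arbitrarily far away. -/
lemma IsBuriedObstacle.translate_horiz_ne {D : Set Plane} (hD : IsBuriedObstacle D) {z : ℝ}
    (hz : z ≠ 0) : translate D (horiz z) ≠ D := by
  intro h
  obtain ⟨x, hx⟩ := hD.nonempty
  obtain ⟨R, hR⟩ := hD.isBounded.exists_norm_le
  have hn : ∀ n : ℕ, x + (n : ℝ) • horiz z ∈ D := by
    intro n
    induction n with
    | zero => simpa using hx
    | succ n ih =>
      rw [← h, mem_translate]
      convert ih using 1
      push_cast
      rw [add_smul, one_smul]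
      abel
  obtain ⟨n, hn'⟩ := exists_nat_gt ((R + ‖x‖) / |z|)
  have h1 := hR _ (hn n)
  have h2 := norm_sub_norm_le ((n : ℝ) • horiz z) (-x)
  rw [sub_neg_eq_add, add_comm _ x, norm_neg, norm_smul, norm_horiz, Real.norm_natCast] at h2
  rw [div_lt_iff₀ (abs_pos.2 hz)] at hn'
  linarith

/-! ### The scattered wave of the translated obstacle -/

section scattered

variable {kp km θd θdt : ℝ} {D : Set Plane} {u F : Plane → ℂ}

lemma planeWave_sub (k : ℝ) (d x z : Plane) :
    planeWave k d x = osc k (inner ℝ z d) * planeWave k d (x - z) := by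
  rw [planeWave, planeWave, osc, ← Complex.exp_add, inner_sub_left]
  congr 1
  push_cast
  ring

lemma radiationIntegral_const_mul (kp km : ℝ) (w : Plane → ℂ) {c : ℂ} (hc : ‖c‖ = 1) :
    radiationIntegral kp km (fun x => c * w x) = radiationIntegral kp km w := by
  have hfd : fderiv ℝ (fun x => c * w x) = fun x => c • fderiv ℝ w x := by
    ext1 x; exact congrFun (fderiv_const_smul_field (𝕜 := ℝ) (f := w) c) x
  ext r
  unfold radiationIntegral
  congr 1
  ext θ
  have e : (c • fderiv ℝ w (r • dir θ)) (dir θ) -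
      Complex.I * (waveNumber kp km (r • dir θ) : ℂ) * (c * w (r • dir θ)) =
      c * (fderiv ℝ w (r • dir θ) (dir θ) -
        Complex.I * (waveNumber kp km (r • dir θ) : ℂ) * w (r • dir θ)) := by
    rw [_root_.smul_apply, smul_eq_mul]; ring
  rw [hfd, e, norm_mul, hc, one_mul]

/-- Below the interface the reference field is a plane wave, so that a horizontal translation
multiplies the boundary data by a constant phase. -/
theorem IsScatteredWave.translate_horiz (hu : IsScatteredWave kp km θd θdt D u)
    (hD : IsBuriedObstacle D) (hkp : 0 < kp) (hkm : 0 < km) (z : ℝ) :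
    IsScatteredWave kp km θd θdt (translate D (horiz z)) fun x =>
      osc km (inner ℝ (horiz z) (dir θdt)) * Dᶜ.indicator u (x - horiz z) := by
  set c := osc km (inner ℝ (horiz z) (dir θdt)) with hc
  have hD' := hD.translate_horiz z
  have hv : IsTransmission kp km (closure (translate D (horiz z)))
      fun x => c * Dᶜ.indicator u (x - horiz z) :=
    ((hu.isTransmission hD).comp_sub_horiz fun x hx => fun h =>
      hx (mem_closure_translate.2 h)).const_mul c
  refine ⟨hv.contDiffOn, fun x hx => ?_, ?_,
    fun y hy => hv.normal_jump y hy (hD'.notMem_closure hy),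
    fun x hx => ?_, ?_⟩
  · rw [laplacian_eq]
    exact hv.helmholtz x hx
  · have h1 : ContinuousOn (Dᶜ.indicator u) Dᶜ :=
      hu.continuousOn.congr fun x hx => indicator_of_mem hx u
    exact continuousOn_const.mul (h1.comp (by fun_prop) fun x hx h => hx (mem_translate.2 h))
  · have hx' := mem_frontier_translate.1 hx
    have hy : x - horiz z ∈ Dᶜ := fun h => by
      rw [hD.isOpen.frontier_eq] at hx'; exact hx'.2 h
    have h1 : (x - horiz z) 1 < 0 := hD.closure_subset (frontier_subset_closure hx')
    have h2 : x 1 < 0 := by rwa [sub_horiz_apply_one] at h1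
    rw [indicator_of_mem hy, hu.boundary _ hx', refField, refField, if_neg h1.not_gt,
      if_neg h2.not_gt, planeWave_sub km (dir θdt) x (horiz z), ← hc]
    ring
  · obtain ⟨R₀, hR₀, hR⟩ := hD.exists_radius
    rw [radiationIntegral_const_mul kp km (fun x => Dᶜ.indicator u (x - horiz z))
      (norm_osc _ _)]
    exact ((hu.isTransmission hD).mono hR).radiation_comp_sub_horiz hR₀ hkp hkm
      (hu.radiation_indicator hD) z

lemma IsFarField.indicator (hF : IsFarField kp u F) (hD : IsBuriedObstacle D) :
    IsFarField kp (Dᶜ.indicator u) F := by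
  rw [isFarField_iff] at hF ⊢
  intro ε hε
  obtain ⟨R, hR0, hR⟩ := hF ε hε
  refine ⟨R, hR0, fun x hx hx1 => ?_⟩
  have hxD : x ∈ Dᶜ := fun h => by
    have : x 1 < 0 := hD.closure_subset (subset_closure h)
    linarith
  rw [indicator_of_mem hxD]
  exact hR x hx hx1

lemma IsFarField.const_mul (hF : IsFarField kp u F) (c : ℂ) :
    IsFarField kp (fun x => c * u x) fun x => c * F x :=
  (Asymptotics.IsLittleO.const_mul_left hF c).congr_left fun x => by ring

lemma inner_horiz (z : ℝ) (x : Plane) : inner ℝ (horiz z) x = z * x 0 := by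
  simp [horiz, PiLp.inner_apply, Fin.sum_univ_two, mul_comm]

end scattered

end TwoLayer

end

open TwoLayer in
theorem lemma2p1 (kp km : ℝ) (hkp : 0 < kp) (hkm : 0 < km) (hne : kp ≠ km)
    (θd θdt : ℝ)
    (hθd : θd ∈ Set.Icc (Real.pi + TwoLayer.critAngle kp km)
      (2 * Real.pi - TwoLayer.critAngle kp km))
    (hθdt : θdt ∈ Set.Icc Real.pi (2 * Real.pi))
    (hsnell : kp * Real.cos θd = km * Real.cos θdt)
    (D : Set TwoLayer.Plane) (hD : TwoLayer.IsBuriedObstacle D)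
    (z₁ : ℝ)
    (u F : TwoLayer.Plane → ℂ)
    (hu : TwoLayer.IsScatteredWave kp km θd θdt D u)
    (hF : TwoLayer.IsFarField kp u F) :
    -- the translated set is again a buried obstacle, different from `D` unless `z₁ = 0`
    TwoLayer.IsBuriedObstacle (TwoLayer.translate D (TwoLayer.horiz z₁)) ∧
    (z₁ ≠ 0 → TwoLayer.translate D (TwoLayer.horiz z₁) ≠ D) ∧
    -- it also has a scattered wave with a far-field pattern
    (∃ v G : TwoLayer.Plane → ℂ,
      TwoLayer.IsScatteredWave kp km θd θdt (TwoLayer.translate D (TwoLayer.horiz z₁)) v ∧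
      TwoLayer.IsFarField kp v G) ∧
    -- and every such far-field pattern is related to that of `D` by the translation formula
    (∀ v G : TwoLayer.Plane → ℂ,
      TwoLayer.IsScatteredWave kp km θd θdt (TwoLayer.translate D (TwoLayer.horiz z₁)) v →
      TwoLayer.IsFarField kp v G →
      ∀ θx θxt : ℝ,
        θx ∈ Set.Icc (TwoLayer.critAngle kp km) (Real.pi - TwoLayer.critAngle kp km) →
        θxt ∈ Set.Icc 0 Real.pi →
        kp * Real.cos θx = km * Real.cos θxt →
        G (TwoLayer.dir θx) =
            Complex.exp (Complex.I *
              (km * inner ℝ (TwoLayer.horiz z₁) (TwoLayer.dir θdt - TwoLayer.dir θxt) : ℝ)) *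
              F (TwoLayer.dir θx) ∧
        ‖G (TwoLayer.dir θx)‖ = ‖F (TwoLayer.dir θx)‖) := by
  have hD' := hD.translate_horiz z₁
  have hw := hu.translate_horiz hD hkp hkm z₁
  obtain ⟨R₀, hR₀, hR⟩ := hD.exists_radius
  have hwF := ((hF.indicator hD).comp_sub_horiz
    (((hu.isTransmission hD).mono hR).continuousOn) z₁).const_mul
      (osc km (inner ℝ (horiz z₁) (dir θdt)))
  refine ⟨hD', fun hz => hD.translate_horiz_ne hz, ⟨_, _, hw, hwF⟩,
    fun v G hv hG θx θxt hθx hθxt hx => ?_⟩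
  have hc : 0 ≤ critAngle kp km := by
    unfold critAngle
    split_ifs
    · exact Real.arccos_nonneg _
    · exact le_rfl
  obtain ⟨R₁, hR₁, hR₁'⟩ := hD'.exists_radius
  have hGF := farField_eq (hv.measurable_indicator hD') (hw.measurable_indicator hD')
    ((hv.isTransmission hD').mono hR₁').continuousOn
    ((hw.isTransmission hD').mono hR₁').continuousOn (hG.indicator hD') (hwF.indicator hD')
    (hv.annVanish_sub hw hD' hkp hkm) (θ := θx) ⟨hc.trans hθx.1, by linarith [hθx.2]⟩
  have hG' : G (dir θx) = osc km (inner ℝ (horiz z₁) (dir θdt - dir θxt)) * F (dir θx) := by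
    rw [hGF, ← mul_assoc]
    congr 1
    -- Snell's law turns the phase at the wave number `kp` into one at `km`.
    have e : kp * -inner ℝ (horiz z₁) (dir θx) = km * -inner ℝ (horiz z₁) (dir θxt) := by
      simp only [inner_horiz, dir, Matrix.cons_val_zero]
      linear_combination (-z₁) * hx
    rw [inner_sub_right, sub_eq_add_neg, osc_add, osc, osc, osc, e]
  refine ⟨hG', ?_⟩
  rw [hG', norm_mul, norm_osc, one_mul]
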